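/- Let $\mathbb F_q$ be a finite field of odd characteristic $p$, let $C$ be a smooth projective geometrically irreducible curve over $\mathbb F_q$ with function field $Q$, let $\infty\in C$ be a closed point, and let $A=\Gamma(C\setminus\{\infty\},\mathcal O_C)\subset Q$. Let $L$ be a finite field extension of $Q$ with separable closure $L^{\mathrm{sep}}$, let $\gamma\colon A\hookrightarrow L$ be the inclusion, $A_L=A\otimes_{\mathbb F_q}L$, $\sigma=\mathrm{id}_A\otimes\mathrm{Frob}_q$ on $A_L$, and $J=(a\otimes 1-1\otimes\gamma(a): a\in A)\subset A_L$. An $A$-motive of rank $r$ over $L$ is a pair $\underline M=(M,\tau)$ of a locally free $A_L$-module $M$ of constant rank $r$ and an isomorphism $\tau\colon\sigma^*M\to M$ of the associated sheaves outside $V(J)\subset\operatorname{Spec}A_L$. Its (virtual) dimension is $$d=\dim_L M/(M\cap\tau(\sigma^*M))-\dim_L\tau(\sigma^*M)/(M\cap\tau(\sigma^*M))\in\mathbb Z .$$ Let $v$ be a closed point of $C$ different from $\infty$, i.e. a maximal ideal of $A$, with residue field $\mathbb F_v=A/v$. Let $A_v$ be the $v$-adic completion of $A$; it is isomorphic to $\mathbb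 F_v[[z]]$ for a uniformizer $z$ at $v$. Let $A_{v,L^{\mathrm{sep}}}$ be the completion of $A\otimes_{\mathbb F_q}L^{\mathrm{sep}}$ along the ideal generated by $v$. The $v$-adic Tate module of $\underline M$ is the $A_v$-module of $\tau$-invariants $$\check T_v\underline M=(M\otimes_{A_L}A_{v,L^{\mathrm{sep}}})^{\tau}=\{m:\tau(\sigma^*m)=m\},$$ on which $\operatorname{Gal}(L^{\mathrm{sep}}/L)$ acts through $A_{v,L^{\mathrm{sep}}}$. Let $\underline M$ be an $A$-motive of rank $r\ge 1$ and dimension $d$ over $L$, and suppose that $\operatorname{char}(\mathbb F_v)$ divides $d$. Then $\check T_v\underline M$ is free of rank $r$ over $A_v$, and for every choice of an $A_v$-basis the image of the resulting Galois representation $$\rho_{\underline M,v}\colon\operatorname{Gal}(L^{\mathrm{sep}}/L)\to\operatorname{GL}_r(A_v)$$ is not open in $\operatorname{GL}_r(A_v)$ for the $v$-adic topology; likewise its image in $\operatorname{GL}_r(\mathbb F_v[[z]])$, under any ring isomorphism $A_v\cong\mathbb F_v[[z]]$, is not open for the $z$-adic topology. -/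

import Mathlib

open scoped TensorProduct nonZeroDivisors

noncomputable section

/-! ### The curve: function field, closed points, functions regular away from `∞` -/

/-- `Q` is the function field of a smooth projective geometrically irreducible curve over the
finite field `Fq`: it is finitely generated over `Fq`, of transcendence degree one, and remains an
integral domain after base change to an algebraic closure of `Fq`.  (Such a field determines the
curve, and its closed points are the places below.) -/
structure IsCurveFunctionField (Fq Q : Type*) [Field Fq] [Field Q] [Algebra Fq Q] : Prop where
  fg : (⊤ : IntermediateField Fq Q).FG
  trdeg_eq_one : Algebra.trdeg Fq Q = 1
  geometricallyIntegral : IsDomain (AlgebraicClosure Fq ⊗[Fq] Q)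

/-- The closed points of the curve with function field `Q`, each given by its local ring: the
valuation rings of `Q` containing the constants, other than `Q` itself (which is the local ring of
the generic point). -/
structure IsClosedPoint (Fq : Type*) {Q : Type*} [Field Fq] [Field Q] [Algebra Fq Q]
    (P : ValuationSubring Q) : Prop where
  constants_mem : ∀ c : Fq, algebraMap Fq Q c ∈ P
  ne_top : P ≠ ⊤

/-- The ring `A = Γ(C ∖ {∞}, 𝒪_C)` of functions on the curve regular outside `∞`: the rational
functions lying in the local ring of every closed point other than `∞`. -/
def regularAway (Fq : Type*) {Q : Type*} [Field Fq] [Field Q] [Algebra Fq Q]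
    (infty : ValuationSubring Q) : Subalgebra Fq Q where
  carrier := {f | ∀ P : ValuationSubring Q, IsClosedPoint Fq P → P ≠ infty → f ∈ P}
  mul_mem' hf hg := fun P hP h => P.mul_mem _ _ (hf P hP h) (hg P hP h)
  add_mem' hf hg := fun P hP h => P.add_mem _ _ (hf P hP h) (hg P hP h)
  algebraMap_mem' c := fun _ hP _ => hP.constants_mem c

/-! ### Functoriality of adic completions -/

section AdicMap

variable {R S T : Type*} [CommRing R] [CommRing S] [CommRing T]

theorem adicMap_compat (I : Ideal R) (J : Ideal S) (f : R →+* S) (h : I.map f ≤ J) (n : ℕ) :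
    I ^ n ≤ (J ^ n).comap f := by
  rw [← Ideal.map_le_iff_le_comap, Ideal.map_pow]
  exact Ideal.pow_right_mono h n

theorem adicMap_factor (I : Ideal R) (J : Ideal S) (f : R →+* S) (h : I.map f ≤ J) {m n : ℕ}
    (hle : m ≤ n) :
    (Ideal.Quotient.factorPow J hle).comp
      ((Ideal.quotientMap (J ^ n) f (adicMap_compat I J f h n)).comp
        (AdicCompletion.evalₐ I n : AdicCompletion I R →+* R ⧸ I ^ n)) =
      (Ideal.quotientMap (J ^ m) f (adicMap_compat I J f h m)).comp
        (AdicCompletion.evalₐ I m : AdicCompletion I R →+* R ⧸ I ^ m) := by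
  ext x
  obtain ⟨y, rfl⟩ := AdicCompletion.mk_surjective I R x
  simp only [RingHom.comp_apply, RingHom.coe_coe, AdicCompletion.evalₐ_mk, Ideal.quotientMap_mk]
  have e : y.val m - y.val n ∈ I ^ m := by
    have := y.property hle
    rw [SModEq.sub_mem] at this
    simpa using this
  change Ideal.Quotient.mk (J ^ m) (f (y.val n)) = Ideal.Quotient.mk (J ^ m) (f (y.val m))
  rw [eq_comm, Ideal.Quotient.eq, ← map_sub]
  exact adicMap_compat I J f h m e

/-- The ring homomorphism of completions induced by `f : R → S` with `f(I) ⊆ J`. -/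
def adicMap (I : Ideal R) (J : Ideal S) (f : R →+* S) (h : I.map f ≤ J) :
    AdicCompletion I R →+* AdicCompletion J S :=
  AdicCompletion.liftRingHom J
    (fun n => (Ideal.quotientMap (J ^ n) f (adicMap_compat I J f h n)).comp
      (AdicCompletion.evalₐ I n : AdicCompletion I R →+* R ⧸ I ^ n))
    (adicMap_factor I J f h)

theorem evalₐ_adicMap (I : Ideal R) (J : Ideal S) (f : R →+* S) (h : I.map f ≤ J) (n : ℕ)
    (x : AdicCompletion I R) {y : R} (hy : AdicCompletion.evalₐ I n x = Ideal.Quotient.mk _ y) :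
    AdicCompletion.evalₐ J n (adicMap I J f h x) = Ideal.Quotient.mk _ (f y) := by
  refine (AdicCompletion.evalₐ_liftRingHom J _ (adicMap_factor I J f h) n x).trans ?_
  rw [RingHom.comp_apply, RingHom.coe_coe, hy, Ideal.quotientMap_mk]

theorem adicMap_comp (I : Ideal R) (J : Ideal S) (K : Ideal T) (f : R →+* S) (g : S →+* T)
    (k : R →+* T) (hf : I.map f ≤ J) (hg : J.map g ≤ K) (hk : I.map k ≤ K)
    (e : ∀ x, g (f x) = k x) (x : AdicCompletion I R) :
    adicMap J K g hg (adicMap I J f hf x) = adicMap I K k hk x := by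
  apply AdicCompletion.ext_evalₐ
  intro n
  obtain ⟨y, hy⟩ := Ideal.Quotient.mk_surjective (AdicCompletion.evalₐ I n x)
  rw [evalₐ_adicMap J K g hg n _ (evalₐ_adicMap I J f hf n x hy.symm),
    evalₐ_adicMap I K k hk n x hy.symm, e]

theorem adicMap_id (I : Ideal R) (f : R →+* R) (h : I.map f ≤ I) (e : ∀ x, f x = x)
    (x : AdicCompletion I R) : adicMap I I f h x = x := by
  apply AdicCompletion.ext_evalₐ
  intro n
  obtain ⟨y, hy⟩ := Ideal.Quotient.mk_surjective (AdicCompletion.evalₐ I n x)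
  rw [evalₐ_adicMap I I f h n x hy.symm, e, hy]

theorem adicMap_algebraMap (I : Ideal R) (J : Ideal S) (f : R →+* S) (h : I.map f ≤ J) (x : R) :
    adicMap I J f h (algebraMap R _ x) = algebraMap S _ (f x) := by
  apply AdicCompletion.ext_evalₐ
  intro n
  rw [AlgHom.commutes, evalₐ_adicMap I J f h n _ (y := x) (AlgHom.commutes _ _)]
  rfl

end AdicMap

/-! ### Coefficient rings `A_K = A ⊗ K` and their completions along `v` -/

section Coefficients

variable (Fq A : Type*) [Field Fq] [CommRing A] [Algebra Fq A]

/-- The ring homomorphism `id ⊗ f : A ⊗ K → A ⊗ K'` for an `Fq`-homomorphism `f : K → K'`. -/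
def coeffMap {K K' : Type*} [Field K] [Algebra Fq K] [Field K'] [Algebra Fq K']
    (f : K →ₐ[Fq] K') : A ⊗[Fq] K →ₐ[A] A ⊗[Fq] K' :=
  Algebra.TensorProduct.map (AlgHom.id A A) f

theorem coeffMap_coeffMap {K K' K'' : Type*} [Field K] [Algebra Fq K] [Field K'] [Algebra Fq K']
    [Field K''] [Algebra Fq K''] (f : K →ₐ[Fq] K') (g : K' →ₐ[Fq] K'') (h : K →ₐ[Fq] K'')
    (e : ∀ x, g (f x) = h x) (x : A ⊗[Fq] K) :
    coeffMap Fq A g (coeffMap Fq A f x) = coeffMap Fq A h x := by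
  induction x with
  | zero => simp only [map_zero]
  | add x y hx hy => simp only [map_add, hx, hy]
  | tmul a l => simp [coeffMap, e]

theorem coeffMap_eq_self {K : Type*} [Field K] [Algebra Fq K] (f : K →ₐ[Fq] K)
    (e : ∀ x, f x = x) (x : A ⊗[Fq] K) : coeffMap Fq A f x = x := by
  induction x with
  | zero => simp only [map_zero]
  | add x y hx hy => simp only [map_add, hx, hy]
  | tmul a l => simp [coeffMap, e]

/-- The endomorphism `σ = id_A ⊗ Frob_q` of `A ⊗ K`, where `q` is the cardinality of `Fq`. -/
def frob [Fintype Fq] (K : Type*) [Field K] [Algebra Fq K] : A ⊗[Fq] K →ₐ[A] A ⊗[Fq] K :=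
  coeffMap Fq A (FiniteField.frobeniusAlgHom Fq K)

variable {A}

/-- The ideal of `A ⊗ K` generated by `v`, defining the closed subscheme `v × Spec K`. -/
abbrev coeffIdeal (v : Ideal A) (K : Type*) [Field K] [Algebra Fq K] : Ideal (A ⊗[Fq] K) :=
  v.map (algebraMap A (A ⊗[Fq] K))

/-- `A_{v,K}`: the completion of `A ⊗ K` along `v × Spec K`. -/
abbrev CompletedCoeff (v : Ideal A) (K : Type*) [Field K] [Algebra Fq K] : Type _ :=
  AdicCompletion (coeffIdeal Fq v K) (A ⊗[Fq] K)

theorem coeffIdeal_map_le (v : Ideal A) {K K' : Type*} [Field K] [Algebra Fq K]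
    [Field K'] [Algebra Fq K'] (f : A ⊗[Fq] K →ₐ[A] A ⊗[Fq] K') :
    (coeffIdeal Fq v K).map (f : A ⊗[Fq] K →+* A ⊗[Fq] K') ≤ coeffIdeal Fq v K' := by
  rw [coeffIdeal, Ideal.map_map, AlgHom.comp_algebraMap]

/-- The endomorphism of `A_{v,K}` induced by an `A`-algebra endomorphism of `A ⊗ K`. -/
def completedMap (v : Ideal A) {K : Type*} [Field K] [Algebra Fq K]
    (f : A ⊗[Fq] K →ₐ[A] A ⊗[Fq] K) : CompletedCoeff Fq v K →+* CompletedCoeff Fq v K :=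
  adicMap _ _ (f : A ⊗[Fq] K →+* A ⊗[Fq] K) (coeffIdeal_map_le Fq v f)

theorem completedMap_comp (v : Ideal A) {K : Type*} [Field K] [Algebra Fq K]
    (f g k : A ⊗[Fq] K →ₐ[A] A ⊗[Fq] K) (e : ∀ y, g (f y) = k y) (x : CompletedCoeff Fq v K) :
    completedMap Fq v g (completedMap Fq v f x) = completedMap Fq v k x :=
  adicMap_comp _ _ _ _ _ _ (coeffIdeal_map_le Fq v f) (coeffIdeal_map_le Fq v g)
    (coeffIdeal_map_le Fq v k) e x

theorem completedMap_id (v : Ideal A) {K : Type*} [Field K] [Algebra Fq K]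
    (f : A ⊗[Fq] K →ₐ[A] A ⊗[Fq] K) (e : ∀ y, f y = y) (x : CompletedCoeff Fq v K) :
    completedMap Fq v f x = x :=
  adicMap_id _ _ (coeffIdeal_map_le Fq v f) e x

/-- The canonical homomorphism `A_v → A_{v,K}`. -/
instance (v : Ideal A) (K : Type*) [Field K] [Algebra Fq K] :
    Algebra (AdicCompletion v A) (CompletedCoeff Fq v K) :=
  (adicMap v (coeffIdeal Fq v K) (algebraMap A (A ⊗[Fq] K)) le_rfl).toAlgebra

theorem completedMap_algebraMap (v : Ideal A) {K : Type*} [Field K] [Algebra Fq K]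
    (f : A ⊗[Fq] K →ₐ[A] A ⊗[Fq] K) (c : AdicCompletion v A) :
    completedMap Fq v f (algebraMap _ _ c) = algebraMap _ (CompletedCoeff Fq v K) c :=
  adicMap_comp _ _ _ _ _ _ _ _ _ (fun a => f.commutes a) c

end Coefficients

/-! ### Frobenius and Galois action on `M ⊗ A_{v,L^sep}` -/

section Completed

variable {Fq A L : Type*} [Field Fq] [CommRing A] [Algebra Fq A] [Field L] [Algebra Fq L]

/-- The `A ⊗ L`-algebra structure of `A ⊗ L^sep`. -/
instance coeffSepAlgebra : Algebra (A ⊗[Fq] L) (A ⊗[Fq] SeparableClosure L) :=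
  (coeffMap Fq A (IsScalarTower.toAlgHom Fq L (SeparableClosure L)) :
    A ⊗[Fq] L →+* A ⊗[Fq] SeparableClosure L).toAlgebra

instance (v : Ideal A) : SMulCommClass (A ⊗[Fq] L) (AdicCompletion v A)
    (CompletedCoeff Fq v (SeparableClosure L)) :=
  ⟨fun a b x => by rw [Algebra.smul_def, Algebra.smul_def, Algebra.smul_def, Algebra.smul_def,
    mul_left_comm]⟩

theorem completedMap_smul (v : Ideal A)
    (s : A ⊗[Fq] L →ₐ[A] A ⊗[Fq] L)
    (t : A ⊗[Fq] SeparableClosure L →ₐ[A] A ⊗[Fq] SeparableClosure L)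
    (h : ∀ f, t (algebraMap (A ⊗[Fq] L) _ f) = algebraMap (A ⊗[Fq] L) _ (s f))
    (f : A ⊗[Fq] L) (x : CompletedCoeff Fq v (SeparableClosure L)) :
    completedMap Fq v t (f • x) = s f • completedMap Fq v t x := by
  rw [Algebra.smul_def, Algebra.smul_def, map_mul]
  congr 1
  refine (adicMap_algebraMap _ _ _ _ (algebraMap (A ⊗[Fq] L) _ f)).trans ?_
  exact congrArg _ (h f)

variable (Fq L)

/-- `σ` on `A_{v,L^sep}`, semilinear over `σ` on `A ⊗ L`. -/
def frobHat [Fintype Fq] (v : Ideal A) :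
    CompletedCoeff Fq v (SeparableClosure L)
      →ₛₗ[(frob Fq A L : A ⊗[Fq] L →+* A ⊗[Fq] L)]
      CompletedCoeff Fq v (SeparableClosure L) where
  toFun := completedMap Fq v (frob Fq A (SeparableClosure L))
  map_add' := map_add _
  map_smul' := completedMap_smul v _ _ fun f =>
    (coeffMap_coeffMap Fq A _ _ ((FiniteField.frobeniusAlgHom Fq (SeparableClosure L)).comp
      (IsScalarTower.toAlgHom Fq L (SeparableClosure L))) (fun _ => rfl) f).trans
    (coeffMap_coeffMap Fq A _ _ _ (fun x => by
      simp [FiniteField.coe_frobeniusAlgHom]) f).symm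

/-- The action of `g ∈ Gal(L^sep/L)` on `A_{v,L^sep}` through the coefficients. -/
def galHat (v : Ideal A) (g : Gal(SeparableClosure L/L)) :
    CompletedCoeff Fq v (SeparableClosure L) →ₗ[A ⊗[Fq] L]
      CompletedCoeff Fq v (SeparableClosure L) where
  toFun := completedMap Fq v (coeffMap Fq A (g.toAlgHom.restrictScalars Fq))
  map_add' := map_add _
  map_smul' := completedMap_smul v (AlgHom.id A _) _ fun f =>
    coeffMap_coeffMap Fq A _ _ _ (fun x => g.commutes x) f

theorem galHat_mul (v : Ideal A) (g h : Gal(SeparableClosure L/L))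
    (x : CompletedCoeff Fq v (SeparableClosure L)) :
    galHat Fq L v (g * h) x = galHat Fq L v g (galHat Fq L v h x) :=
  (completedMap_comp Fq v (coeffMap Fq A (h.toAlgHom.restrictScalars Fq))
    (coeffMap Fq A (g.toAlgHom.restrictScalars Fq))
    (coeffMap Fq A ((g * h).toAlgHom.restrictScalars Fq))
    (coeffMap_coeffMap Fq A _ _ _ fun _ => rfl) x).symm

theorem galHat_one (v : Ideal A) (x : CompletedCoeff Fq v (SeparableClosure L)) :
    galHat Fq L v 1 x = x :=
  completedMap_id Fq v
    (coeffMap Fq A ((1 : Gal(SeparableClosure L/L)).toAlgHom.restrictScalars Fq))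
    (coeffMap_eq_self Fq A _ fun _ => rfl) x

theorem galHat_frobHat [Fintype Fq] (v : Ideal A) (g : Gal(SeparableClosure L/L))
    (x : CompletedCoeff Fq v (SeparableClosure L)) :
    galHat Fq L v g (frobHat Fq L v x) = frobHat Fq L v (galHat Fq L v g x) :=
  (completedMap_comp Fq v (frob Fq A (SeparableClosure L))
    (coeffMap Fq A (g.toAlgHom.restrictScalars Fq))
    (coeffMap Fq A ((g.toAlgHom.restrictScalars Fq).comp
      (FiniteField.frobeniusAlgHom Fq (SeparableClosure L))))
    (coeffMap_coeffMap Fq A _ _ _ fun _ => rfl) x).trans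
  (completedMap_comp Fq v
    (coeffMap Fq A (g.toAlgHom.restrictScalars Fq)) (frob Fq A (SeparableClosure L))
    (coeffMap Fq A ((g.toAlgHom.restrictScalars Fq).comp
      (FiniteField.frobeniusAlgHom Fq (SeparableClosure L))))
    (coeffMap_coeffMap Fq A _ _ _ fun z => by
      simp [FiniteField.coe_frobeniusAlgHom]) x).symm

variable (M : Type*) [AddCommGroup M] [Module (A ⊗[Fq] L) M]

/-- `A_{v,L^sep} ⊗ M`, the tensor product being over `A ⊗ L`. -/
abbrev CompletedModule (v : Ideal A) : Type _ :=
  CompletedCoeff Fq v (SeparableClosure L) ⊗[A ⊗[Fq] L] M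

/-- The action `g ⊗ id_M` of `g ∈ Gal(L^sep/L)` on `A_{v,L^sep} ⊗ M`. -/
def galModule (v : Ideal A) (g : Gal(SeparableClosure L/L)) :
    CompletedModule Fq L M v →ₗ[A ⊗[Fq] L] CompletedModule Fq L M v :=
  TensorProduct.map (galHat Fq L v g) LinearMap.id

theorem galModule_smul (v : Ideal A) (g : Gal(SeparableClosure L/L)) (c : AdicCompletion v A)
    (x : CompletedModule Fq L M v) :
    galModule Fq L M v g (c • x) = c • galModule Fq L M v g x := by
  induction x using TensorProduct.induction_on with
  | zero => simp only [smul_zero, map_zero]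
  | add x y hx hy => simp only [smul_add, map_add, hx, hy]
  | tmul a m =>
    rw [TensorProduct.smul_tmul', galModule, TensorProduct.map_tmul, TensorProduct.map_tmul,
      TensorProduct.smul_tmul', Algebra.smul_def, Algebra.smul_def]
    congr 1
    refine (map_mul (completedMap Fq v _) _ _).trans ?_
    rw [completedMap_algebraMap]
    rfl

variable {Fq L M}

/-- The `σ`-semilinear endomorphism `a ⊗ m ↦ σ(a) ⊗ φ(m)` of `A_{v,L^sep} ⊗ M` induced by a
`σ`-semilinear endomorphism `φ` of `M`. -/
def frobModule [Fintype Fq] (v : Ideal A)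
    (φ : M →ₛₗ[(frob Fq A L : A ⊗[Fq] L →+* A ⊗[Fq] L)] M) :
    CompletedModule Fq L M v
      →ₛₗ[(frob Fq A L : A ⊗[Fq] L →+* A ⊗[Fq] L)] CompletedModule Fq L M v :=
  TensorProduct.map (frobHat Fq L v) φ

theorem frobModule_smul [Fintype Fq] (v : Ideal A)
    (φ : M →ₛₗ[(frob Fq A L : A ⊗[Fq] L →+* A ⊗[Fq] L)] M) (c : AdicCompletion v A)
    (x : CompletedModule Fq L M v) :
    frobModule v φ (c • x) = c • frobModule v φ x := by
  induction x using TensorProduct.induction_on with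
  | zero => simp only [smul_zero, map_zero]
  | add x y hx hy => simp only [smul_add, map_add, hx, hy]
  | tmul a m =>
    rw [TensorProduct.smul_tmul', frobModule, TensorProduct.map_tmul, TensorProduct.map_tmul,
      TensorProduct.smul_tmul', Algebra.smul_def, Algebra.smul_def]
    congr 1
    refine (map_mul (completedMap Fq v _) _ _).trans ?_
    rw [completedMap_algebraMap]
    rfl

theorem galModule_frobModule [Fintype Fq] (v : Ideal A) (g : Gal(SeparableClosure L/L))
    (φ : M →ₛₗ[(frob Fq A L : A ⊗[Fq] L →+* A ⊗[Fq] L)] M)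
    (x : CompletedModule Fq L M v) :
    galModule Fq L M v g (frobModule v φ x) = frobModule v φ (galModule Fq L M v g x) := by
  induction x using TensorProduct.induction_on with
  | zero => simp only [map_zero]
  | add x y hx hy => simp only [map_add, hx, hy]
  | tmul a m =>
    simp only [galModule, frobModule, TensorProduct.map_tmul, LinearMap.id_apply, galHat_frobHat]

end Completed

/-! ### `A`-motives -/

section Motive

variable (Fq A L : Type*) [Field Fq] [CommRing A] [Algebra Fq A]
  [Field L] [Algebra Fq L] [Algebra A L]

/-- The ideal `J = (a ⊗ 1 - 1 ⊗ γ(a) : a ∈ A)` of `A ⊗ L`, where `γ : A → L` is the structure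
map. -/
def idealJ : Ideal (A ⊗[Fq] L) :=
  Ideal.span (Set.range fun a : A => a ⊗ₜ[Fq] (1 : L) - (1 : A) ⊗ₜ[Fq] algebraMap A L a)

/-- An `A`-motive of rank `r` over `L` with underlying module `M`: a locally free `A ⊗ L`-module
`M` of constant rank `r` with an isomorphism `τ : σ^* M → M` outside `V(J)`.

Sections over `Spec A_L ∖ V(J)` are viewed inside the generic fibre `M ⊗ Frac(A_L)`, and
`A_L`-linear maps out of `σ^* M` are written as `σ`-semilinear maps out of `M`; so
`τ(σ^* M)` is the `A_L`-span of the values of `τ`.  That `τ` is an isomorphism outside `V(J)` means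
that `M` and `τ(σ^* M)` agree up to powers of `J` (both have rank `r`, so that surjectivity of `τ`
outside `V(J)` implies injectivity). -/
structure AMotive [Fintype Fq] (r : ℕ) (M : Type*) [AddCommGroup M]
    [Module (A ⊗[Fq] L) M] where
  finite : Module.Finite (A ⊗[Fq] L) M
  projective : Module.Projective (A ⊗[Fq] L) M
  rank_eq : ∀ p : PrimeSpectrum (A ⊗[Fq] L), Module.rankAtStalk M p = r
  τ : M →ₛₗ[(frob Fq A L : A ⊗[Fq] L →+* A ⊗[Fq] L)] LocalizedModule (A ⊗[Fq] L)⁰ M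
  map_le : ∃ n : ℕ, (idealJ Fq A L) ^ n • Submodule.span (A ⊗[Fq] L) (Set.range τ) ≤
    LinearMap.range (LocalizedModule.mkLinearMap (A ⊗[Fq] L)⁰ M)
  le_map : ∃ n : ℕ,
    (idealJ Fq A L) ^ n • LinearMap.range (LocalizedModule.mkLinearMap (A ⊗[Fq] L)⁰ M) ≤
      Submodule.span (A ⊗[Fq] L) (Set.range τ)

variable {Fq A L}

/-- `dim_L X / (X ∩ Y)` for two `A ⊗ L`-submodules `X`, `Y` of a common module, where `L` acts
through the second factor of `A ⊗ L`. -/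
def relDim {V : Type*} [AddCommGroup V] [Module (A ⊗[Fq] L) V]
    (X Y : Submodule (A ⊗[Fq] L) V) : ℕ :=
  letI : Algebra L (A ⊗[Fq] L) := Algebra.TensorProduct.rightAlgebra
  Module.finrank L (RestrictScalars L (A ⊗[Fq] L) (X ⧸ (X ⊓ Y).submoduleOf X))

namespace AMotive

variable [Fintype Fq] {r : ℕ} {M : Type*} [AddCommGroup M] [Module (A ⊗[Fq] L) M]

/-- The (virtual) dimension
`dim_L M / (M ∩ τ(σ^* M)) - dim_L τ(σ^* M) / (M ∩ τ(σ^* M))`. -/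
def dim (𝓜 : AMotive Fq A L r M) : ℤ :=
  (relDim (LinearMap.range (LocalizedModule.mkLinearMap (A ⊗[Fq] L)⁰ M))
      (Submodule.span (A ⊗[Fq] L) (Set.range 𝓜.τ)) : ℤ) -
    (relDim (Submodule.span (A ⊗[Fq] L) (Set.range 𝓜.τ))
      (LinearMap.range (LocalizedModule.mkLinearMap (A ⊗[Fq] L)⁰ M)) : ℤ)

end AMotive

/-! ### The `v`-adic Tate module and its Galois representation -/

namespace AMotive

variable [Fintype Fq] {r : ℕ} {M : Type*} [AddCommGroup M] [Module (A ⊗[Fq] L) M]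

/-- The (dual) `v`-adic Tate module `(M ⊗ A_{v,L^sep})^τ`, as an `A_v`-module.

Over `A_{v,L^sep}` the ideal `J` becomes the unit ideal, so that `τ` induces a `σ`-semilinear
endomorphism of `M ⊗ A_{v,L^sep}`, determined by: whenever `f ∈ A_L` is such that `f τ` takes values
in `M`, that is `f τ = φ` for a `σ`-semilinear `φ : M → M`, then `f` times this endomorphism is
`σ ⊗ φ`.  Hence `x` is `τ`-invariant if and only if `(σ ⊗ φ)(x) = f x` for all such `f` and `φ`. -/
def tateModule (𝓜 : AMotive Fq A L r M) (v : Ideal A) :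
    Submodule (AdicCompletion v A) (CompletedModule Fq L M v) where
  carrier := {x | ∀ (f : A ⊗[Fq] L) (φ : M →ₛₗ[(frob Fq A L : A ⊗[Fq] L →+* A ⊗[Fq] L)] M),
    (∀ m : M, LocalizedModule.mkLinearMap (A ⊗[Fq] L)⁰ M (φ m) = f • 𝓜.τ m) →
      frobModule v φ x = f • x}
  add_mem' hx hy f φ h := by rw [map_add, hx f φ h, hy f φ h, smul_add]
  zero_mem' f φ _ := by rw [map_zero, smul_zero]
  smul_mem' c x hx f φ h := by rw [frobModule_smul, hx f φ h, smul_comm]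

/-- The action of `Gal(L^sep/L)` on the Tate module. -/
def galRep (𝓜 : AMotive Fq A L r M) (v : Ideal A) :
    Gal(SeparableClosure L/L) →* Module.End (AdicCompletion v A) (𝓜.tateModule v) where
  toFun g :=
    { toFun := fun x => ⟨galModule Fq L M v g x.1, fun f φ h => by
        rw [← galModule_frobModule, x.2 f φ h, map_smul]⟩
      map_add' := fun x y => Subtype.ext (map_add _ _ _)
      map_smul' := fun c x => Subtype.ext (galModule_smul Fq L M v g c x.1) }
  map_one' := by
    refine LinearMap.ext fun x => Subtype.ext ?_
    change galModule Fq L M v 1 x.1 = x.1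
    have : galHat Fq L v 1 = LinearMap.id := LinearMap.ext (galHat_one Fq L v)
    rw [galModule, this, TensorProduct.map_id, LinearMap.id_apply]
  map_mul' g h := by
    refine LinearMap.ext fun x => Subtype.ext ?_
    change galModule Fq L M v (g * h) x.1 = galModule Fq L M v g (galModule Fq L M v h x.1)
    have : galHat Fq L v (g * h) = galHat Fq L v g ∘ₗ galHat Fq L v h :=
      LinearMap.ext (galHat_mul Fq L v g h)
    rw [galModule, galModule, galModule, TensorProduct.map_map, this, LinearMap.id_comp]

/-- The `v`-adic Galois representation `Gal(L^sep/L) → GL_r(A_v)` in a basis of the Tate module. -/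
def galRepMatrix (𝓜 : AMotive Fq A L r M) (v : Ideal A)
    (b : Module.Basis (Fin r) (AdicCompletion v A) (𝓜.tateModule v)) :
    Gal(SeparableClosure L/L) →* Matrix.GeneralLinearGroup (Fin r) (AdicCompletion v A) :=
  MonoidHom.toHomUnits
    ((MonoidHomClass.toMonoidHom (LinearMap.toMatrixAlgEquiv b)).comp (𝓜.galRep v))

end AMotive

end Motive

/-! ### Topology on `GL_r` -/

/-- A subset of `GL_r(R)` is open for the topology induced by the `I`-adic topology of `R`. -/
def IsAdicOpen {R : Type*} [CommRing R] (I : Ideal R) {r : ℕ}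
    (S : Set (Matrix.GeneralLinearGroup (Fin r) R)) : Prop :=
  letI : TopologicalSpace R := I.adicTopology
  IsOpen S

end

open scoped Matrix

noncomputable section

/-! The obstruction lies in the determinant of ρ and is detected by a derivation. Choose a
derivation D of A over Fq and x ∈ v with Dx ≠ 0, extend D continuously to A_v, and extend it to
A_{v,L^sep} acting trivially on L^sep, so that it commutes with σ and with Galois. The function g ↦
tr(ρ(g)⁻¹ Dρ(g)), the logarithmic derivative of det ρ(g), turns out to take only finitely many
values. An open image would contain diag(1 + x^(pj+1), 1, …, 1) for all large j; the corresponding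
values x^(pj) Dx / (1 + x^(pj+1)) are nonzero and tend to 0, so there are infinitely many of them
(`not_isAdicOpen_of_finite_range_trace`).

Finiteness. Over A_{v,L^sep} the ideal J becomes the unit ideal, so τ is bijective there. Lang's
theorem modulo v, followed by lifting along the powers of v, gives a basis B of τ-invariant vectors
(`exists_frobenius_basis`, `exists_tate_basis`). Let F be the matrix of τ and C the inverse of B on
M. Differentiating B = F σ(B) and g(B) = B ρ(g) shows that h = tr(C DB) satisfies h - σ(h) = t with
t = tr(F⁻¹ DF), and g(h) - h = tr(ρ(g)⁻¹ Dρ(g)) (`trace_eq_add_frob`, `galHat_trace`). If t lies in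
A ⊗ L, then Artin–Schreier equations for finitely many coefficients give h₀ ∈ A ⊗ L^sep with h₀ -
σ(h₀) = t, and g(h₀) - h₀ takes finitely many values (`exists_sub_frob_eq`). Since h - h₀ is
σ-fixed, it lies in A_v and is Galois-invariant, so g(h) - h = g(h₀) - h₀.

Regularity of t. Being the logarithmic derivative of det τ, t can have a pole only along J. If x is
separating, the local ring at J is a discrete valuation ring with uniformizer s = x ⊗ 1 - 1 ⊗ γ(x),
and det τ is a unit times s^d. The polar part is d · Ds/s, which vanishes as p divides d
(`pow_dvd_trace_derivation`, `mul_self_dvd_trace`).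

To stay inside A ⊗ L, τ is replaced by fτ with f = s^n and q dividing n, so that Df = 0. If Φ is the
matrix of fτ and Ψ its inverse up to f², regularity of t reads f² ∣ tr(Ψ DΦ). As M is only
projective, all matrices live on a free module and are cut down by an idempotent E. -/

theorem exists_derivation_extension {R S T : Type*} [CommRing R] [CommRing S] [CommRing T]
    [Algebra R S] [Algebra R T] [Algebra S T] [IsScalarTower R S T] [Algebra.FormallyEtale S T]
    (d : Derivation R S T) : ∃ d' : Derivation R T T, ∀ s, d' (algebraMap S T s) = d s := by
  let l : T ⊗[S] Ω[S⁄R] →ₗ[T] T := LinearMap.liftBaseChange T d.liftKaehlerDifferential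
  -- Formal étaleness identifies T ⊗ Ω[S/R] with Ω[T/R], so the linear form attached to d is already
  -- one on Ω[T/R].
  let e := KaehlerDifferential.tensorKaehlerEquivOfFormallyEtale R S T
  refine ⟨(l ∘ₗ e.symm.toLinearMap).compDer (KaehlerDifferential.D R T), fun s => ?_⟩
  have := KaehlerDifferential.tensorKaehlerEquivOfFormallyEtale_symm_D_algebraMap R S T s
  simp [l, e, this]

/-! ### The function field, the ring A and its derivations -/

section FunctionField

variable {Fq Q : Type*} [Field Fq] [Field Q] [Algebra Fq Q]

open IntermediateField.algebraAdjoinAdjoin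

theorem isAlgebraic_adjoin_of_transcendental (h : Algebra.trdeg Fq Q = 1) {y : Q}
    (hy : Transcendental Fq y) : Algebra.IsAlgebraic (Algebra.adjoin Fq {y}) Q := by
  have hi : AlgebraicIndependent Fq (fun _ : Unit => y) := by
    rw [algebraicIndependent_unique_type_iff]; exact hy
  have hb : IsTranscendenceBasis Fq (fun _ : Unit => y) := by
    apply AlgebraicIndependent.isTranscendenceBasis_of_lift_trdeg_le hi <;> simp [h]
  have := hb.isAlgebraic
  rwa [Set.range_const] at this

/-- A place of the function field at which `y` has a pole. -/
theorem exists_closedPoint_not_mem {y : Q} (hy : Transcendental Fq y) :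
    ∃ P : ValuationSubring Q, IsClosedPoint Fq P ∧ y ∉ P := by
  have hy0 : y ≠ 0 := fun h => hy (h ▸ isAlgebraic_zero)
  let A' : Subring Q := (Algebra.adjoin Fq {y⁻¹}).toSubring
  have hy' : y⁻¹ ∈ Algebra.adjoin Fq {y⁻¹} := Algebra.self_mem_adjoin_singleton _ _
  let w : A' := ⟨y⁻¹, hy'⟩
  have htr : Transcendental Fq y⁻¹ := fun h => hy (by simpa using h.inv)
  -- An inverse of y⁻¹ in Fq[y⁻¹] would make y⁻¹ a root of some X f - 1, which is nonzero because
  -- its value at 0 is -1. A valuation ring in which y⁻¹ is a nonunit then omits y.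
  have hne : Ideal.span {w} ≠ ⊤ := by
    intro h
    rw [Ideal.span_singleton_eq_top] at h
    obtain ⟨u, hu⟩ := h.exists_right_inv
    have hu2 : (u : Q) ∈ Algebra.adjoin Fq {y⁻¹} := u.2
    rw [Algebra.adjoin_singleton_eq_range_aeval] at hu2
    obtain ⟨f, hf : Polynomial.aeval y⁻¹ f = u⟩ := hu2
    have h1 : Polynomial.aeval y⁻¹ ((Polynomial.X * f - 1 : Polynomial Fq)) = 0 := by
      have := congrArg Subtype.val hu
      simp only [map_sub, map_mul, Polynomial.aeval_X, map_one]
      rw [sub_eq_zero]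
      simpa [w, ← hf] using this
    have h2 := (transcendental_iff.mp htr) _ h1
    have := congrArg (Polynomial.eval 0) h2
    simp at this
  obtain ⟨B, hB, hB'⟩ := Ideal.image_subset_nonunits_valuationSubring _ hne
  have hn : y⁻¹ ∈ B.nonunits := hB' ⟨w, Ideal.mem_span_singleton_self _, rfl⟩
  have hyB : y ∉ B := by
    rcases B.inv_mem_nonunits_iff.mp hn with h | h
    · exact absurd h hy0
    · exact h
  exact ⟨B, ⟨fun c => hB (Subalgebra.algebraMap_mem _ c), fun h => hyB (h ▸ trivial)⟩, hyB⟩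

/-- A transcendental y has a pole somewhere, and for y ∈ A this can only be `infty`. So the
valuation rings containing Fq[y] are Q and the places other than `infty`, and the integral closure
is their intersection. -/
theorem mem_regularAway_iff_isIntegral {infty : ValuationSubring Q} {y : Q}
    (hy : Transcendental Fq y) (hyA : y ∈ regularAway Fq infty) (f : Q) :
    f ∈ regularAway Fq infty ↔ IsIntegral (Algebra.adjoin Fq {y}) f := by
  have hinf : y ∉ infty := by
    obtain ⟨P, hP, hyP⟩ := exists_closedPoint_not_mem hy
    by_contra h
    refine hyP (hyA P hP ?_)
    rintro rfl
    exact hyP h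
  have key := iInf_valuationSubring_superset (s := Set.range (algebraMap Fq Q) ∪ {y})
  have h1 : IsIntegral (Algebra.adjoin Fq {y}) f ↔
      f ∈ ⨅ V : {V : ValuationSubring Q // Set.range (algebraMap Fq Q) ∪ {y} ⊆ V.toSubring},
        V.1.toSubring := by
    rw [key, ← Algebra.adjoin_eq_ring_closure]
    exact Iff.rfl
  rw [h1, Subring.mem_iInf]
  constructor
  · rintro hf ⟨V, hV⟩
    by_cases ht : V = ⊤
    · subst ht; trivial
    refine hf V ⟨fun c => hV (Or.inl ⟨c, rfl⟩), ht⟩ ?_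
    rintro rfl
    exact hinf (hV (Or.inr rfl))
  · intro hf P hP hne
    refine hf ⟨P, ?_⟩
    rintro _ (⟨c, rfl⟩ | rfl)
    · exact hP.constants_mem c
    · exact hyA P hP hne

/-- Perfectness of Fq gives a separating element t. Then Q is formally étale over Fq[t], so d/dt
extends to Q, and a derivation killing t is Fq[t]-linear, hence zero. -/
theorem exists_separating_derivation [PerfectField Fq] (hQ : IsCurveFunctionField Fq Q) :
    ∃ (t : Q) (D : Derivation Fq Q Q), D t = 1 ∧
      ∀ E : Derivation Fq Q Q, E t = 0 → E = 0 := by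
  have : Algebra.EssFiniteType Fq Q := IntermediateField.fg_top_iff.mp hQ.fg
  obtain ⟨s, hs, hsep⟩ := exists_isTranscendenceBasis_and_isSeparable_of_perfectField Fq Q
  have hc := hs.cardinalMk_eq_trdeg
  rw [hQ.trdeg_eq_one] at hc
  have hc' : s.card = 1 := by simpa using hc
  obtain ⟨t, rfl⟩ := Finset.card_eq_one.mp hc'
  rw [Finset.coe_singleton] at hsep
  have htr : Transcendental Fq t := hs.1.transcendental ⟨t, by simp⟩
  have : Algebra.FormallyEtale (Algebra.adjoin Fq {t}) (IntermediateField.adjoin Fq {t}) :=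
    Algebra.FormallyEtale.of_isLocalization (Algebra.adjoin Fq {t})⁰
  have : Algebra.FormallyEtale (IntermediateField.adjoin Fq {t}) Q :=
    Algebra.FormallyEtale.of_isSeparable _ _
  have : Algebra.FormallyEtale (Algebra.adjoin Fq {t}) Q :=
    Algebra.FormallyEtale.comp _ (IntermediateField.adjoin Fq {t}) _
  let e := Polynomial.algEquivOfTranscendental Fq t htr
  have hval : ∀ a : Algebra.adjoin Fq {t}, Polynomial.aeval t (e.symm a) = (a : Q) := by
    intro a
    obtain ⟨f, rfl⟩ := e.surjective a
    rw [e.symm_apply_apply, Polynomial.algEquivOfTranscendental_apply, Polynomial.aeval_def,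
      Polynomial.aeval_def, ← Subalgebra.coe_val, ← AlgHom.coe_toRingHom, Polynomial.hom_eval₂]
    rfl
  let d : Derivation Fq (Algebra.adjoin Fq {t}) Q := Derivation.mk'
    ((Polynomial.aeval t).toLinearMap ∘ₗ Polynomial.derivative ∘ₗ e.symm.toLinearMap) (by
      intro a b
      simp only [LinearMap.comp_apply, AlgEquiv.toLinearMap_apply, map_mul,
        Polynomial.derivative_mul, map_add, AlgHom.toLinearMap_apply, hval]
      rw [Algebra.smul_def, Algebra.smul_def, add_comm, mul_comm _ (b : Q)]
      rfl)
  obtain ⟨D, hD⟩ := exists_derivation_extension d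
  refine ⟨t, D, ?_, ?_⟩
  · have := hD ⟨t, Algebra.self_mem_adjoin_singleton Fq t⟩
    have h2 : e.symm ⟨t, Algebra.self_mem_adjoin_singleton Fq t⟩ = Polynomial.X := by
      rw [AlgEquiv.symm_apply_eq, Polynomial.algEquivOfTranscendental_apply_X]
    refine this.trans ?_
    simp [d, h2]
  · intro E hE
    have hE' : ∀ a : Algebra.adjoin Fq {t}, E a = 0 := by
      intro a
      rw [← hval a, Derivation.map_aeval, hE, smul_zero]
    obtain ⟨a⟩ : Nonempty (Algebra.FormallyUnramified (Algebra.adjoin Fq {t}) Q) := ⟨inferInstance⟩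
    let E' : Derivation (Algebra.adjoin Fq {t}) Q Q := Derivation.mk'
      { toFun := E
        map_add' := map_add E
        map_smul' := fun a x => by
          rw [Algebra.smul_def, E.leibniz]
          change (a : Q) • E x + x • E (a : Q) = (a : Q) • E x
          rw [hE', smul_zero, add_zero] } (fun a b => E.leibniz a b)
    have : E' = 0 := by
      rw [← E'.liftKaehlerDifferential_comp]
      ext x
      simp [Subsingleton.elim ((KaehlerDifferential.D (Algebra.adjoin Fq {t}) Q) x) 0]
    ext x
    exact congrArg (fun F : Derivation (Algebra.adjoin Fq {t}) Q Q => F x) this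

/-- If a derivation `D` spanning all derivations does not kill `x`, then `x` is separating. -/
theorem isSeparable_adjoin_of_derivation_ne_zero (hQ : IsCurveFunctionField Fq Q)
    {t : Q} {D : Derivation Fq Q Q} (ht : D t = 1)
    (hD : ∀ E : Derivation Fq Q Q, E t = 0 → E = 0) {x : Q} (hx : D x ≠ 0) :
    Algebra.IsSeparable (IntermediateField.adjoin Fq {x}) Q := by
  have : Algebra.EssFiniteType Fq Q := IntermediateField.fg_top_iff.mp hQ.fg
  have : Algebra.EssFiniteType (IntermediateField.adjoin Fq {x}) Q :=
    Algebra.EssFiniteType.of_comp Fq _ _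
  rw [← Algebra.FormallyUnramified.iff_isSeparable]
  rw [Algebra.formallyUnramified_iff]
  -- A nonzero functional on the differentials of Q over Fq(x) would give a derivation E with E x =
  -- 0. Since E = E(t) D and D x ≠ 0, this forces E = 0.
  by_contra hns
  rw [not_subsingleton_iff_nontrivial] at hns
  obtain ⟨ω, hω⟩ := exists_ne (0 : Ω[Q⁄IntermediateField.adjoin Fq {x}])
  obtain ⟨l, hl⟩ := Module.Projective.exists_dual_ne_zero Q hω
  let E' := l.compDer (KaehlerDifferential.D (IntermediateField.adjoin Fq {x}) Q)
  let E : Derivation Fq Q Q := E'.restrictScalars Fq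
  have hEx : E x = 0 := E'.map_algebraMap
    (⟨x, IntermediateField.mem_adjoin_simple_self Fq x⟩ : IntermediateField.adjoin Fq {x})
  have hE : E = E t • D := by
    rw [← sub_eq_zero]
    apply hD
    simp [ht]
  have h0 : E t = 0 := by
    rw [hE] at hEx
    simpa [hx] using hEx
  rw [h0, zero_smul] at hE
  have hl0 : l ∘ₗ Submodule.subtype ⊤ = 0 := by
    rw [← KaehlerDifferential.span_range_derivation]
    refine LinearMap.ext_on_range (v := fun y : Q => ⟨KaehlerDifferential.D _ Q y,
      Submodule.subset_span ⟨y, rfl⟩⟩) ?_ ?_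
    · rw [eq_top_iff]
      rintro ⟨z, hz⟩ -
      induction hz using Submodule.span_induction with
      | mem z hz => obtain ⟨y, rfl⟩ := hz; exact Submodule.subset_span ⟨y, rfl⟩
      | zero => exact Submodule.zero_mem _
      | add a b ha hb h1 h2 => exact Submodule.add_mem _ h1 h2
      | smul c a ha h1 => exact Submodule.smul_mem _ c h1
    · intro y
      exact congrArg (fun F : Derivation Fq Q Q => F y) hE
  exact hl (congrArg (fun F => F ⟨ω, trivial⟩) hl0)

theorem transcendental_of_derivation_ne_zero [PerfectField Fq] {D : Derivation Fq Q Q} {x : Q}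
    (hx : D x ≠ 0) : Transcendental Fq x := by
  intro halg
  have hs := (PerfectField.separable_of_irreducible (minpoly.irreducible halg.isIntegral))
  have h1 := congrArg D (minpoly.aeval Fq x)
  rw [Derivation.map_aeval, map_zero, smul_eq_zero] at h1
  rcases h1 with h1 | h1
  · exact hs.aeval_derivative_ne_zero (minpoly.aeval Fq x) h1
  · exact hx h1

variable {infty : ValuationSubring Q}

/-- Otherwise A would be integral over Fq, hence a field, and could not have a nonzero maximal
ideal. -/
theorem exists_mem_regularAway_transcendental
    (v : Ideal (regularAway Fq infty)) [v.IsMaximal] (hv : v ≠ ⊥) :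
    ∃ y ∈ regularAway Fq infty, Transcendental Fq y := by
  by_contra! h
  have hint : Algebra.IsIntegral Fq (regularAway Fq infty) := by
    refine ⟨fun a => ?_⟩
    have h1 := h a a.2
    rw [Transcendental, not_not] at h1
    exact (isIntegral_algHom_iff (regularAway Fq infty).val Subtype.val_injective).mp
      h1.isIntegral
  have hf := isField_of_isIntegral_of_isField' (R := Fq) (S := regularAway Fq infty)
    (Field.toIsField Fq)
  let _ := hf.toField
  exact (Ideal.eq_bot_or_top v).elim hv (Ideal.IsMaximal.ne_top ‹_›)

/-- This says that Q is the fraction field of A; it serves to clear denominators of derivations. -/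
theorem exists_mul_mem_adjoin (hQ : IsCurveFunctionField Fq Q) {y : Q}
    (hy : Transcendental Fq y) (hyA : y ∈ regularAway Fq infty) (z : Q) :
    ∃ a ∈ regularAway Fq infty, a ≠ 0 ∧ a * z ∈ regularAway Fq infty := by
  have := isAlgebraic_adjoin_of_transcendental hQ.trdeg_eq_one hy
  obtain ⟨a, ha, h⟩ := (Algebra.IsAlgebraic.isAlgebraic (R := Algebra.adjoin Fq {y}) z).exists_integral_multiple
  refine ⟨a, ?_, fun h0 => ha (Subtype.ext h0), ?_⟩
  · exact (Algebra.adjoin_le (S := regularAway Fq infty) (by simpa using hyA)) a.2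
  · rw [mem_regularAway_iff_isIntegral hy hyA]
    exact h

/-- A is the integral closure of Fq[x] in the finite separable extension Q of Fq(x), hence finite
over Fq[x]. The polynomial f is the minimal polynomial of b, with coefficients transported to Fq[X];
separability makes b a simple root. This simple root is what later makes x ⊗ 1 - 1 ⊗ γ(x) a local
generator of J. -/
theorem finite_regularAway (hQ : IsCurveFunctionField Fq Q) {x : regularAway Fq infty}
    (hx : Transcendental Fq (x : Q))
    (hsep : Algebra.IsSeparable (IntermediateField.adjoin Fq {(x : Q)}) Q) :
    Algebra.FiniteType Fq (regularAway Fq infty) ∧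
    ∀ b : regularAway Fq infty, ∃ f : Polynomial (Polynomial Fq),
      f.eval₂ (Polynomial.aeval x : Polynomial Fq →ₐ[Fq] _).toRingHom b = 0 ∧
      f.derivative.eval₂ (Polynomial.aeval x : Polynomial Fq →ₐ[Fq] _).toRingHom b ≠ 0 := by
  have hess : Algebra.EssFiniteType Fq Q := IntermediateField.fg_top_iff.mp hQ.fg
  have : Algebra.EssFiniteType (IntermediateField.adjoin Fq {(x : Q)}) Q :=
    Algebra.EssFiniteType.of_comp Fq _ _
  have : FiniteDimensional (IntermediateField.adjoin Fq {(x : Q)}) Q :=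
    Algebra.finite_of_essFiniteType_of_isAlgebraic
  let e := Polynomial.algEquivOfTranscendental Fq (x : Q) hx
  have : IsNoetherianRing (Algebra.adjoin Fq {(x : Q)}) := isNoetherianRing_of_ringEquiv _ e.toRingEquiv
  have : IsIntegrallyClosed (Algebra.adjoin Fq {(x : Q)}) := IsIntegrallyClosed.of_equiv e.toRingEquiv
  have hfin : Module.Finite (Algebra.adjoin Fq {(x : Q)})
      (integralClosure (Algebra.adjoin Fq {(x : Q)}) Q) :=
    IsIntegralClosure.finite _ (IntermediateField.adjoin Fq {(x : Q)}) Q _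
  have hft : Algebra.FiniteType Fq (Algebra.adjoin Fq {(x : Q)}) :=
    Algebra.FiniteType.adjoin_of_finite (Set.finite_singleton _)
  have hft2 : Algebra.FiniteType Fq (integralClosure (Algebra.adjoin Fq {(x : Q)}) Q) :=
    Algebra.FiniteType.trans (S := Algebra.adjoin Fq {(x : Q)}) hft inferInstance
  have heq : regularAway Fq infty =
      (integralClosure (Algebra.adjoin Fq {(x : Q)}) Q).restrictScalars Fq := by
    ext f
    exact mem_regularAway_iff_isIntegral hx x.2 f
  refine ⟨?_, fun b => ?_⟩
  · rw [heq]; exact hft2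
  · have hb : IsIntegral (Algebra.adjoin Fq {(x : Q)}) (b : Q) :=
      (mem_regularAway_iff_isIntegral hx x.2 _).mp b.2
    let m := minpoly (Algebra.adjoin Fq {(x : Q)}) (b : Q)
    have hm : minpoly (IntermediateField.adjoin Fq {(x : Q)}) (b : Q) = m.map (algebraMap _ _) :=
      minpoly.isIntegrallyClosed_eq_field_fractions _ Q hb
    have hs := Algebra.IsSeparable.isSeparable (IntermediateField.adjoin Fq {(x : Q)}) (b : Q)
    let f := m.map e.symm.toRingEquiv.toRingHom
    have hev : ∀ g : Polynomial (Algebra.adjoin Fq {(x : Q)}),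
        (((g.map e.symm.toRingEquiv.toRingHom).eval₂ (Polynomial.aeval x : Polynomial Fq →ₐ[Fq] _).toRingHom b :
          regularAway Fq infty) : Q) = Polynomial.aeval (b : Q) g := by
      intro g
      rw [Polynomial.eval₂_map, Polynomial.aeval_def]
      refine (Polynomial.hom_eval₂ _ _ (regularAway Fq infty).val.toRingHom _).trans ?_
      congr 1
      ext a
      obtain ⟨f, rfl⟩ := e.surjective a
      have : e.symm.toRingEquiv.toRingHom (e f) = f := e.symm_apply_apply f
      rw [RingHom.comp_apply, RingHom.comp_apply, this, Polynomial.algEquivOfTranscendental_apply]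
      change (regularAway Fq infty).val (Polynomial.aeval x f) =
        (Algebra.adjoin Fq {(x : Q)}).val (Polynomial.aeval _ f)
      rw [← Polynomial.aeval_algHom_apply, ← Polynomial.aeval_algHom_apply]
      rfl
    refine ⟨f, ?_, fun h => ?_⟩
    · apply Subtype.val_injective
      exact (hev m).trans (minpoly.aeval _ _)
    · rw [Polynomial.derivative_map] at h
      have h2 : Polynomial.aeval (b : Q) m.derivative = 0 :=
        (hev m.derivative).symm.trans (congrArg Subtype.val h)
      have h3 : Polynomial.aeval (b : Q) (minpoly (IntermediateField.adjoin Fq {(x : Q)})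
          (b : Q)).derivative = 0 := by
        rw [hm, Polynomial.derivative_map, Polynomial.aeval_def, Polynomial.eval₂_map,
          ← IsScalarTower.algebraMap_eq, ← Polynomial.aeval_def, h2]
      exact Polynomial.Separable.aeval_derivative_ne_zero hs
        (minpoly.aeval (IntermediateField.adjoin Fq {(x : Q)}) (b : Q)) h3

theorem exists_regularAway_derivation [PerfectField Fq] (hQ : IsCurveFunctionField Fq Q)
    (v : Ideal (regularAway Fq infty)) [v.IsMaximal] (hv : v ≠ ⊥) :
    Algebra.FiniteType Fq (regularAway Fq infty) ∧
    ∃ (x : regularAway Fq infty) (D : Derivation Fq (regularAway Fq infty) (regularAway Fq infty)),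
      x ∈ v ∧ D x ≠ 0 ∧ ∀ b : regularAway Fq infty, ∃ f : Polynomial (Polynomial Fq),
      f.eval₂ (Polynomial.aeval x : Polynomial Fq →ₐ[Fq] _).toRingHom b = 0 ∧
      f.derivative.eval₂ (Polynomial.aeval x : Polynomial Fq →ₐ[Fq] _).toRingHom b ≠ 0 := by
  obtain ⟨y, hyA, hy⟩ := exists_mem_regularAway_transcendental v hv
  obtain ⟨t, D, ht, hD⟩ := exists_separating_derivation hQ
  have hfrac := exists_mul_mem_adjoin (infty := infty) hQ hy hyA
  have h1 : ∃ a : regularAway Fq infty, D a ≠ 0 := by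
    by_contra! h
    obtain ⟨a, ha, ha0, hat⟩ := hfrac t
    have h2 := h ⟨_, hat⟩
    have h3 := h ⟨a, ha⟩
    simp only at h2 h3
    rw [D.leibniz, h3, ht] at h2
    simp [ha0] at h2
  obtain ⟨w, hw, hw0⟩ := Submodule.exists_mem_ne_zero_of_ne_bot hv
  -- If D a ≠ 0 and w is a nonzero element of v with D w = 0, then a w ∈ v and D (a w) = w D a ≠ 0.
  have h2 : ∃ x ∈ v, D (x : Q) ≠ 0 := by
    by_contra! h
    obtain ⟨a, ha⟩ := h1
    have h3 := h (a * w) (v.mul_mem_left a hw)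
    rw [Subalgebra.coe_mul, D.leibniz, h w hw] at h3
    have : (w : Q) ≠ 0 := fun h => hw0 (Subtype.ext h)
    simp [ha, this] at h3
  obtain ⟨x, hxv, hx⟩ := h2
  have hsep := isSeparable_adjoin_of_derivation_ne_zero hQ ht hD hx
  obtain ⟨hft, hf⟩ := finite_regularAway hQ (transcendental_of_derivation_ne_zero hx) hsep
  refine ⟨hft, x, ?_⟩
  obtain ⟨G, hG⟩ := hft.1
  -- D need not preserve A. As A is finitely generated, a common denominator c of the values of D on
  -- generators makes c D a derivation of A.
  have hden : ∃ c : regularAway Fq infty, c ≠ 0 ∧ ∀ g ∈ G, (c : Q) * D g ∈ regularAway Fq infty := by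
    clear hG
    classical
    induction G using Finset.induction_on with
    | empty => exact ⟨1, one_ne_zero, by simp⟩
    | insert g G hg ih =>
      obtain ⟨c, hc, h⟩ := ih
      obtain ⟨a, ha, ha0, hat⟩ := hfrac (D g)
      refine ⟨⟨a, ha⟩ * c, mul_ne_zero (fun h => ha0 (congrArg Subtype.val h)) hc, ?_⟩
      intro g' hg'
      rw [Finset.mem_insert] at hg'
      rcases hg' with rfl | hg'
      · have := (regularAway Fq infty).mul_mem c.2 hat
        rw [Subalgebra.coe_mul]
        convert this using 1
        simp only
        ring
      · have := (regularAway Fq infty).mul_mem ha (h g' hg')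
        rw [Subalgebra.coe_mul]
        convert this using 1
        simp only
        ring
  obtain ⟨c, hc, hcG⟩ := hden
  have hmem : ∀ a : regularAway Fq infty, (c : Q) * D a ∈ regularAway Fq infty := by
    intro a
    have ha : a ∈ Algebra.adjoin Fq (G : Set (regularAway Fq infty)) := hG ▸ Algebra.mem_top
    induction ha using Algebra.adjoin_induction with
    | mem g hg => exact hcG g hg
    | algebraMap r =>
      have : D ((algebraMap Fq (regularAway Fq infty) r : regularAway Fq infty) : Q) = 0 :=
        D.map_algebraMap r
      rw [this, mul_zero]
      exact Subalgebra.zero_mem _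
    | add a b _ _ ha hb =>
      rw [Subalgebra.coe_add, map_add, mul_add]
      exact Subalgebra.add_mem _ ha hb
    | mul a b _ _ ha hb =>
      rw [Subalgebra.coe_mul, D.leibniz, smul_eq_mul, smul_eq_mul, mul_add,
        mul_left_comm, mul_left_comm _ (b : Q)]
      exact Subalgebra.add_mem _ (Subalgebra.mul_mem _ a.2 hb) (Subalgebra.mul_mem _ b.2 ha)
  let D' : Derivation Fq (regularAway Fq infty) (regularAway Fq infty) := Derivation.mk'
    { toFun := fun a => ⟨(c : Q) * D a, hmem a⟩
      map_add' := fun a b => Subtype.ext (by simp [mul_add])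
      map_smul' := fun r a => Subtype.ext (by simp) } (fun a b => Subtype.ext (by
        simp; ring))
  refine ⟨D', hxv, fun h => ?_, hf⟩
  have : (c : Q) * D x = 0 := congrArg Subtype.val h
  have hc' : (c : Q) ≠ 0 := fun h => hc (Subtype.ext h)
  simp [hc', hx] at this

end FunctionField

/-! ### Frobenius-semilinear maps and Lang's theorem -/

theorem exists_algebraMap_eq_of_pow_card_eq (Fq : Type*) {K : Type*} [Field Fq] [Fintype Fq]
    [Field K] [Algebra Fq K] {c : K} (hc : c ^ Fintype.card Fq = c) :
    ∃ a : Fq, algebraMap Fq K a = c := by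
  have hq := Fintype.one_lt_card (α := Fq)
  have h1 : (Polynomial.X ^ Fintype.card Fq - Polynomial.X : Polynomial Fq).Monic :=
    Polynomial.monic_X_pow_sub (by simpa using hq)
  have h2 := Polynomial.prod_multiset_X_sub_C_of_monic_of_roots_card_eq h1 (by
    rw [FiniteField.roots_X_pow_card_sub_X, FiniteField.X_pow_card_sub_X_natDegree_eq Fq hq]
    rfl)
  have h3 := congrArg (Polynomial.aeval c) h2
  rw [FiniteField.roots_X_pow_card_sub_X] at h3
  simp only [map_multiset_prod, Multiset.map_map, map_sub, map_pow, Polynomial.aeval_X, hc,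
    sub_self] at h3
  rw [Multiset.prod_eq_zero_iff, Multiset.mem_map] at h3
  obtain ⟨a, -, ha⟩ := h3
  refine ⟨a, ?_⟩
  simpa [eq_comm (a := (0 : K)), sub_eq_zero, eq_comm (a := c)] using ha

section Frobenius

variable (Fq : Type*) {K V : Type*} [Field Fq] [Fintype Fq] [Field K] [Algebra Fq K]
  [AddCommGroup V] [Module K V] {σ : K →+* K}

/-- A fixed vector of a Frobenius-semilinear map in the `K`-span of fixed vectors lies in their
`Fq`-span. -/
theorem mem_span_of_frobenius_fixed [Module Fq V] [IsScalarTower Fq K V]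
    (hσ : ∀ c, σ c = c ^ Fintype.card Fq) (φ : V →ₛₗ[σ] V) {X : Set V} (hX : ∀ x ∈ X, φ x = x)
    {v : V} (hv : v ∈ Submodule.span K X) (hφ : φ v = v) : v ∈ Submodule.span Fq X := by
  obtain ⟨b, hbX, hbs, hli⟩ := exists_linearIndependent K X
  rw [← hbs, Finsupp.mem_span_iff_linearCombination] at hv
  obtain ⟨c, rfl⟩ := hv
  rw [Finsupp.linearCombination_apply, Finsupp.sum] at hφ ⊢
  -- Applying φ to an expression in independent fixed vectors and subtracting leaves the
  -- coefficients σ(c) - c, which must vanish; so c ∈ Fq.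
  have h1 : ∑ i ∈ c.support, (σ (c i) - c i) • (i : V) = 0 := by
    rw [map_sum] at hφ
    simp only [sub_smul, Finset.sum_sub_distrib, sub_eq_zero]
    refine Eq.trans (Finset.sum_congr rfl fun i _ => ?_) hφ
    rw [map_smulₛₗ, hX _ (hbX i.2)]
  have h2 := (linearIndependent_iff'.mp hli) _ _ h1
  refine Submodule.sum_mem _ fun i hi => ?_
  have h3 := h2 i hi
  rw [hσ, sub_eq_zero] at h3
  obtain ⟨a, ha⟩ := exists_algebraMap_eq_of_pow_card_eq Fq h3
  rw [← ha, algebraMap_smul]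
  exact Submodule.smul_mem _ _ (Submodule.subset_span (hbX i.2))

/-- Fixed vectors which are linearly independent over `Fq` are so over `K`. -/
theorem linearIndependent_of_frobenius_fixed [Module Fq V] [IsScalarTower Fq K V]
    (hσ : ∀ c, σ c = c ^ Fintype.card Fq) (φ : V →ₛₗ[σ] V) {ι : Type*} {e : ι → V}
    (he : ∀ i, φ (e i) = e i) (hli : LinearIndependent Fq e) : LinearIndependent K e := by
  classical
  rw [linearIndependent_iff_finset_linearIndependent]
  intro s
  have hli' : LinearIndepOn Fq e (s : Set ι) := hli.comp _ Subtype.val_injective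
  change LinearIndepOn K e (s : Set ι)
  induction s using Finset.induction_on with
  | empty => rw [Finset.coe_empty]; exact linearIndepOn_empty K e
  | insert a s ha ih =>
    have ha' : a ∉ (s : Set ι) := by simpa using ha
    rw [Finset.coe_insert, linearIndepOn_insert ha'] at hli' ⊢
    refine ⟨ih hli'.1, fun h => hli'.2 ?_⟩
    refine mem_span_of_frobenius_fixed Fq hσ φ ?_ h (he a)
    rintro _ ⟨i, -, rfl⟩
    exact he i

variable {Fq}

/-- The family e extends to a basis, whose image under φ spans and has the right number of elements,
so is a basis again. Surjectivity of σ is not needed. -/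
theorem injective_of_span_range_eq_top [FiniteDimensional K V] (φ : V →ₛₗ[σ] V)
    (h : Submodule.span K (Set.range φ) = ⊤) {n : ℕ} {e : Fin n → V}
    (he : LinearIndependent K e) {c : Fin n → K} (hc : ∑ i, c i • φ (e i) = 0) : c = 0 := by
  let b := Module.Basis.extend (he.linearIndepOn_id)
  have : Fintype (he.linearIndepOn_id.extend (Set.subset_univ (Set.range e))) :=
    FiniteDimensional.fintypeBasisIndex b
  have hsp : (⊤ : Submodule K V) ≤ Submodule.span K (Set.range fun i => φ (b i)) := by
    rw [← h, Submodule.span_le]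
    rintro _ ⟨v, rfl⟩
    rw [← b.sum_repr v, map_sum]
    refine Submodule.sum_mem _ fun i _ => ?_
    rw [map_smulₛₗ]
    exact Submodule.smul_mem _ _ (Submodule.subset_span ⟨i, rfl⟩)
  have hli := linearIndependent_of_top_le_span_of_card_eq_finrank hsp
    (Module.finrank_eq_card_basis b).symm
  let j : Fin n → he.linearIndepOn_id.extend (Set.subset_univ (Set.range e)) :=
    fun i => ⟨e i, he.linearIndepOn_id.subset_extend _ ⟨i, rfl⟩⟩
  have hj : Function.Injective j := fun x y hxy => he.injective (congrArg Subtype.val hxy)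
  have h3 := hli.comp j hj
  have h4 : (fun i => φ (b i)) ∘ j = fun i => φ (e i) := by
    ext i
    simp [j, b]
  rw [h4, Fintype.linearIndependent_iff] at h3
  exact funext (h3 c hc)

/-- The polynomials `P₀ = a₀ X^q`, `P_{i+1} = P_i^q + a_{i+1} X^q`. -/
def frobeniusPoly (q : ℕ) (a : ℕ → K) : ℕ → Polynomial K
  | 0 => Polynomial.C (a 0) * Polynomial.X ^ q
  | i + 1 => frobeniusPoly q a i ^ q + Polynomial.C (a (i + 1)) * Polynomial.X ^ q

theorem natDegree_frobeniusPoly {q : ℕ} (hq : 1 < q) {a : ℕ → K} (ha : a 0 ≠ 0) (i : ℕ) :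
    (frobeniusPoly q a i).natDegree = q ^ (i + 1) := by
  induction i with
  | zero => simp [frobeniusPoly, ha]
  | succ i ih =>
    rw [frobeniusPoly, Polynomial.natDegree_add_eq_left_of_natDegree_lt, Polynomial.natDegree_pow,
      ih]
    · ring
    · refine (Polynomial.natDegree_C_mul_X_pow_le _ _).trans_lt ?_
      rw [Polynomial.natDegree_pow, ih, ← pow_succ']
      conv_lhs => rw [← pow_one q]
      exact Nat.pow_lt_pow_right hq (by omega)

theorem derivative_frobeniusPoly {q : ℕ} (hq : (q : K) = 0) (a : ℕ → K) (i : ℕ) :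
    (frobeniusPoly q a i).derivative = 0 := by
  cases i <;> simp [frobeniusPoly, Polynomial.derivative_pow, hq]

theorem eval_zero_frobeniusPoly {q : ℕ} (hq : 1 < q) (a : ℕ → K) (i : ℕ) :
    (frobeniusPoly q a i).eval 0 = 0 := by
  have : q ≠ 0 := by omega
  induction i with
  | zero => simp [frobeniusPoly, this]
  | succ i ih => simp [frobeniusPoly, this, ih]

/-- P - X has derivative -1, hence is separable, and has degree greater than 1. The cofactor R in P
- X = X R therefore has a root, which is not 0 because R(0) = -1. -/
theorem exists_eval_frobeniusPoly_eq [IsSepClosed K] {q : ℕ} (hq : 1 < q) (hq0 : (q : K) = 0)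
    {a : ℕ → K} (ha : a 0 ≠ 0) (i : ℕ) : ∃ z ≠ 0, (frobeniusPoly q a i).eval z = z := by
  obtain ⟨R, hR⟩ : Polynomial.X ∣ frobeniusPoly q a i - Polynomial.X := by
    rw [Polynomial.X_dvd_iff, Polynomial.coeff_zero_eq_eval_zero]
    simp [eval_zero_frobeniusPoly hq]
  have hder : (frobeniusPoly q a i - Polynomial.X).derivative = -1 := by
    simp [derivative_frobeniusPoly hq0]
  have hsep : (frobeniusPoly q a i - Polynomial.X).Separable := by
    rw [Polynomial.separable_def, hder]
    exact isCoprime_one_right.neg_right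
  have h0 : R.eval 0 = -1 := by
    rw [hR] at hder
    have := congrArg (Polynomial.eval 0) hder
    simpa using this
  have hdeg : (frobeniusPoly q a i - Polynomial.X).natDegree = q ^ (i + 1) := by
    rw [Polynomial.natDegree_sub_eq_left_of_natDegree_lt, natDegree_frobeniusPoly hq ha]
    rw [natDegree_frobeniusPoly hq ha, Polynomial.natDegree_X]
    exact Nat.one_lt_pow (by omega) hq
  have hRd : R.degree ≠ 0 := by
    intro h
    rw [Polynomial.eq_C_of_degree_eq_zero h] at hR
    have h1 := Polynomial.natDegree_mul_C_le (Polynomial.X : Polynomial K) (R.coeff 0)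
    rw [← hR, hdeg, Polynomial.natDegree_X] at h1
    exact absurd (Nat.one_lt_pow (by omega) hq) (not_lt.mpr h1)
  obtain ⟨z, hz⟩ := IsSepClosed.exists_root R hRd
    (Polynomial.Separable.of_dvd hsep (hR ▸ dvd_mul_left _ _))
  refine ⟨z, ?_, ?_⟩
  · rintro rfl
    rw [Polynomial.IsRoot, h0] at hz
    simp at hz
  · have := congrArg (Polynomial.eval z) hR
    rw [Polynomial.eval_mul, hz, mul_zero, Polynomial.eval_sub, Polynomial.eval_X, sub_eq_zero]
      at this
    exact this

/-- Let φ^(m+1) v = Σ c_i φ^i v be the first dependence among the iterates of v. Then Σ x_i φ^i v is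
fixed when x_0 = c_0 z^q and x_{i+1} = x_i^q + c_{i+1} z^q with z = x_m. Eliminating gives the
single equation P_m(z) = z, the reason for `frobeniusPoly`. -/
theorem exists_frobenius_fixed_ne_zero [IsSepClosed K] [FiniteDimensional K V] [Nontrivial V]
    {q : ℕ} (hq : 1 < q) (hq0 : (q : K) = 0)
    (hσ : ∀ c, σ c = c ^ q) (φ : V →ₛₗ[σ] V)
    (h : Submodule.span K (Set.range φ) = ⊤) : ∃ w ≠ 0, φ w = w := by
  classical
  obtain ⟨v, hv⟩ := exists_ne (0 : V)
  let f : ℕ → V := fun i => φ^[i] v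
  have hf : ∀ i, φ (f i) = f (i + 1) := fun i => (Function.iterate_succ_apply' φ i v).symm
  have hex : ∃ m, f m ∈ Submodule.span K (Set.range fun i : Fin m => f i) := by
    by_contra! hcon
    have hli : ∀ n, LinearIndependent K (fun i : Fin n => f i) := by
      intro n
      induction n with
      | zero => exact linearIndependent_empty_type
      | succ n ih => exact linearIndependent_finSucc'.mpr ⟨ih, hcon n⟩
    have := (hli (Module.finrank K V + 1)).fintype_card_le_finrank
    simp at this
  have hmin : ∀ n ≤ Nat.find hex, LinearIndependent K (fun i : Fin n => f i) := by
    intro n hn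
    induction n with
    | zero => exact linearIndependent_empty_type
    | succ n ih => exact linearIndependent_finSucc'.mpr ⟨ih (by omega), Nat.find_min hex hn⟩
  have hspec := Nat.find_spec hex
  generalize Nat.find hex = m at hmin hspec
  have hli := hmin m le_rfl
  obtain ⟨c, hc⟩ := (Submodule.mem_span_range_iff_exists_fun K).mp hspec
  obtain _ | m := m
  · exfalso
    simp at hc
    exact hv hc.symm
  -- With c 0 = 0 the dependence would be one among the images φ(f 0), …, φ(f m), contradicting that
  -- φ preserves independence.
  have hc0 : c 0 ≠ 0 := by
    intro h0
    rw [Fin.sum_univ_succ, h0, zero_smul, zero_add] at hc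
    have h1 : ∑ i : Fin (m + 1), (Fin.snoc (α := fun _ => K) (fun i : Fin m => c i.succ) (-1 : K)) i • φ (f i) = 0 := by
      rw [Fin.sum_univ_castSucc]
      simp only [Fin.snoc_castSucc, Fin.snoc_last, hf, Fin.val_castSucc, Fin.val_last]
      simp only [Fin.val_succ] at hc
      rw [hc]
      simp
    have h2 := congrFun (injective_of_span_range_eq_top φ h hli h1) (Fin.last m)
    simp at h2
  let a : ℕ → K := fun i => if hi : i < m + 1 then c ⟨i, hi⟩ else 0
  have ha : ∀ i : Fin (m + 1), a i = c i := fun i => by simp only [a, i.2, dite_true]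
  obtain ⟨z, hz, hPz⟩ := exists_eval_frobeniusPoly_eq hq hq0 (a := a) (by simpa [ha] using ha 0 ▸ hc0) m
  let x : ℕ → K := fun i => (frobeniusPoly q a i).eval z
  refine ⟨∑ i : Fin (m + 1), x i • f i, fun hw => ?_, ?_⟩
  · have := (Fintype.linearIndependent_iff.mp hli) _ hw (Fin.last m)
    exact hz (hPz.symm.trans this)
  · have h1 : φ (∑ i : Fin (m + 1), x i • f i) =
        ∑ i : Fin m, x i ^ q • f (i + 1) + z ^ q • f (m + 1) := by
      rw [map_sum, Fin.sum_univ_castSucc]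
      simp only [map_smulₛₗ, hf, hσ, Fin.val_castSucc, Fin.val_last]
      rw [show x m = z from hPz]
    rw [h1, ← hc, Finset.smul_sum, Fin.sum_univ_succ, Fin.sum_univ_succ (n := m), add_left_comm,
      ← Finset.sum_add_distrib]
    congr 1
    · rw [smul_smul, ← ha, mul_comm]
      simp [x, frobeniusPoly]
    · refine Finset.sum_congr rfl fun i _ => ?_
      rw [smul_smul, ← ha, Fin.val_succ, ← add_smul, mul_comm (z ^ q)]
      simp [x, frobeniusPoly]

/-- Lang's theorem for Frobenius-semilinear maps over a separably closed field. -/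
theorem span_frobenius_fixed_eq_top [IsSepClosed K]
    {q : ℕ} (hq : 1 < q) (hq0 : (q : K) = 0) (hσ : ∀ c, σ c = c ^ q) (n : ℕ) :
    ∀ {V : Type*} [AddCommGroup V] [Module K V] [FiniteDimensional K V] (φ : V →ₛₗ[σ] V),
    Module.finrank K V = n → Submodule.span K (Set.range φ) = ⊤ →
      Submodule.span K {v | φ v = v} = ⊤ := by
  induction n with
  | zero =>
    intro V _ _ _ φ hn h
    have := Module.finrank_zero_iff.mp hn
    exact Subsingleton.elim _ _
  | succ n ih =>
    intro V _ _ _ φ hn h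
    have : Nontrivial V := Module.nontrivial_of_finrank_pos (R := K) (by omega)
    obtain ⟨w, hw0, hw⟩ := exists_frobenius_fixed_ne_zero hq hq0 hσ φ h
    let W := Submodule.span K {w}
    have hle : W ≤ W.comap φ := by
      rw [Submodule.span_le]
      intro u hu
      rw [Set.mem_singleton_iff] at hu
      subst hu
      change φ u ∈ Submodule.span K {u}
      rw [hw]
      exact Submodule.mem_span_singleton_self u
    let ψ := W.mapQ W φ hle
    have hfr : Module.finrank K (V ⧸ W) = n := by
      have h1 := Submodule.finrank_quotient_add_finrank W
      rw [finrank_span_singleton hw0] at h1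
      omega
    have hψ : Submodule.span K (Set.range ψ) = ⊤ := by
      rw [eq_top_iff, ← W.range_mkQ, LinearMap.range_eq_map, ← h, Submodule.map_span,
        Submodule.span_le]
      rintro _ ⟨_, ⟨v, rfl⟩, rfl⟩
      exact Submodule.subset_span ⟨W.mkQ v, rfl⟩
    have h2 := ih ψ hfr hψ
    -- A fixed class modulo the fixed line W = K w has a lift u with φ u = u + c w. Adding y w with
    -- y^q - y + c = 0, a separable equation, makes it fixed.
    have h3 : Submodule.map W.mkQ (Submodule.span K {v | φ v = v}) = ⊤ := by
      rw [eq_top_iff, ← h2, Submodule.span_le]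
      intro y hy
      obtain ⟨u, rfl⟩ := W.mkQ_surjective y
      have h4 : φ u - u ∈ W := (Submodule.Quotient.eq W).mp hy
      obtain ⟨c, hc⟩ := Submodule.mem_span_singleton.mp h4
      obtain ⟨y, hy⟩ := IsSepClosed.exists_root_C_mul_X_pow_add_C_mul_X_add_C
        (1 : K) (-1) c hq0 hq (by simp)
      refine ⟨u + y • w, Submodule.subset_span ?_, ?_⟩
      · change φ (u + y • w) = u + y • w
        have h5 : φ u = u + c • w := by rw [hc]; abel
        rw [map_add, map_smulₛₗ, hw, hσ, h5, add_assoc, ← add_smul]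
        congr 2
        linear_combination hy
      · rw [map_add, map_smul]
        simp [W, (Submodule.Quotient.mk_eq_zero _).mpr (Submodule.mem_span_singleton_self w)]
    have h6 : W ≤ Submodule.span K {v | φ v = v} := by
      rw [Submodule.span_le]
      rintro _ rfl
      exact Submodule.subset_span hw
    have h7 := Submodule.comap_map_eq_self (f := W.mkQ)
      (p := Submodule.span K {v | φ v = v}) (by rwa [Submodule.ker_mkQ])
    rw [← h7, h3, Submodule.comap_top]

end Frobenius

/-! ### Adic completions: limits, units and derivations -/

section AdicGeneral

variable {k R S : Type*} [CommRing k] [CommRing R] [CommRing S] [Algebra k R] (I : Ideal R)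

theorem ext_evalₐ_succ {x y : AdicCompletion I R}
    (h : ∀ n, AdicCompletion.evalₐ I (n + 1) x = AdicCompletion.evalₐ I (n + 1) y) : x = y := by
  apply AdicCompletion.ext_evalₐ
  intro n
  obtain ⟨x, rfl⟩ := AdicCompletion.mk_surjective I R x
  obtain ⟨y, rfl⟩ := AdicCompletion.mk_surjective I R y
  have h1 := h n
  have hx := x.2 (Nat.le_succ n)
  have hy := y.2 (Nat.le_succ n)
  simp only [AdicCompletion.evalₐ_mk] at h1 ⊢
  rw [SModEq.sub_mem] at hx hy
  rw [Ideal.Quotient.eq] at h1 ⊢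
  have h2 := Ideal.pow_le_pow_right (Nat.le_succ n) h1
  have hx' : x.1 n - x.1 (n + 1) ∈ I ^ n := by simpa using hx
  have hy' : y.1 n - y.1 (n + 1) ∈ I ^ n := by simpa using hy
  have := Ideal.sub_mem _ (Ideal.add_mem _ hx' h2) hy'
  convert this using 1
  change x.1 n - y.1 n = x.1 n - x.1 (n+1) + (x.1 (n+1) - y.1 (n+1)) - (y.1 n - y.1 (n+1))
  ring

theorem exists_evalₐ_eq (s : ℕ → R) (hs : ∀ n, s (n + 1) - s n ∈ I ^ n) :
    ∃ x : AdicCompletion I R, ∀ n, AdicCompletion.evalₐ I n x = Ideal.Quotient.mk _ (s n) := by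
  refine ⟨AdicCompletion.mk I R (AdicCompletion.AdicCauchySequence.mk I R s fun n => ?_),
    fun n => ?_⟩
  · rw [SModEq.sub_mem, ← neg_mem_iff]
    simpa using hs n
  · rw [AdicCompletion.evalₐ_mk]; rfl

theorem sub_mem_of_evalₐ_eq {x : AdicCompletion I R} {m n : ℕ} (hmn : m ≤ n) {a b : R}
    (ha : AdicCompletion.evalₐ I m x = Ideal.Quotient.mk _ a)
    (hb : AdicCompletion.evalₐ I n x = Ideal.Quotient.mk _ b) : b - a ∈ I ^ m := by
  obtain ⟨x, rfl⟩ := AdicCompletion.mk_surjective I R x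
  rw [AdicCompletion.evalₐ_mk, Ideal.Quotient.eq] at ha hb
  have hx := x.2 hmn
  rw [SModEq.sub_mem] at hx
  have hx' : x.1 m - x.1 n ∈ I ^ m := by simpa using hx
  have := Ideal.sub_mem _ (Ideal.sub_mem _ ha hx') (Ideal.pow_le_pow_right hmn hb)
  convert this using 1
  ring

/-- If u is an inverse modulo I, the powers of 1 - a u lie in powers of I, and truncated geometric
series give compatible inverses modulo all I^(n+1). -/
theorem isUnit_of_isUnit_evalₐ_one {x : AdicCompletion I R}
    (h : IsUnit (AdicCompletion.evalₐ I 1 x)) : IsUnit x := by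
  choose a ha using fun n => Ideal.Quotient.mk_surjective (AdicCompletion.evalₐ I n x)
  obtain ⟨w, hw⟩ := h.exists_right_inv
  obtain ⟨u, rfl⟩ := Ideal.Quotient.mk_surjective w
  have h1 : ∀ n, 1 - a (n + 1) * u ∈ I := by
    intro n
    have h2 := sub_mem_of_evalₐ_eq I (Nat.succ_le_succ (Nat.zero_le n)) (ha 1).symm (ha (n + 1)).symm
    rw [← ha 1, ← map_mul, ← map_one (Ideal.Quotient.mk (I ^ 1)), Ideal.Quotient.eq] at hw
    simp only [Nat.succ_eq_add_one, zero_add, pow_one] at h2 hw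
    have := Ideal.add_mem _ (I.mul_mem_right u h2) hw
    rw [← neg_mem_iff]
    convert this using 1
    ring
  have h2 : ∀ n, ∃ b, a (n + 1) * b - 1 ∈ I ^ (n + 1) := by
    intro n
    refine ⟨u * ∑ i ∈ Finset.range (n + 1), (1 - a (n + 1) * u) ^ i, ?_⟩
    have h3 := mul_neg_geom_sum (1 - a (n + 1) * u) (n + 1)
    have h4 := Ideal.pow_mem_pow (h1 n) (n + 1)
    rw [← neg_mem_iff]
    convert h4 using 1
    linear_combination -h3
  choose b hb using h2
  obtain ⟨y, hy⟩ := exists_evalₐ_eq I b (fun n => by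
    have h3 := Ideal.pow_le_pow_right (Nat.le_succ _) (hb n)
    have h4 := Ideal.pow_le_pow_right (show n ≤ n + 1 + 1 by omega) (hb (n + 1))
    have h5 := Ideal.pow_le_pow_right (Nat.le_succ _)
      (sub_mem_of_evalₐ_eq I (Nat.le_succ (n + 1)) (ha (n + 1)).symm (ha (n + 1 + 1)).symm)
    have h6 := Ideal.sub_mem _ (Ideal.sub_mem _ (Ideal.mul_mem_left _ (b n) h4)
      (Ideal.mul_mem_left _ (b (n + 1)) h3)) (Ideal.mul_mem_left _ (b n * b (n + 1)) h5)
    convert h6 using 1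
    ring)
  refine IsUnit.of_mul_eq_one y (AdicCompletion.ext_evalₐ fun n => ?_)
  have h4 := sub_mem_of_evalₐ_eq I (Nat.le_succ n) (ha n).symm (ha (n + 1)).symm
  have h5 := Ideal.pow_le_pow_right (Nat.le_succ n) (hb n)
  rw [map_mul, ← ha n, hy, map_one, ← map_mul, ← map_one (Ideal.Quotient.mk (I ^ n)),
    Ideal.Quotient.eq]
  have h6 := Ideal.sub_mem _ h5 (Ideal.mul_mem_right (b n) _ h4)
  convert h6 using 1
  ring

variable (D : Derivation k R R)

theorem Derivation.mem_pow_of_mem_pow_succ {n : ℕ} {x : R} (hx : x ∈ I ^ (n + 1)) :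
    D x ∈ I ^ n := by
  induction n generalizing x with
  | zero => simp
  | succ n ih =>
    rw [pow_succ] at hx
    refine Submodule.mul_induction_on hx (fun a ha b hb => ?_) (fun a b ha hb => ?_)
    · rw [D.leibniz, smul_eq_mul, smul_eq_mul]
      refine Ideal.add_mem _ (Ideal.mul_mem_right _ _ ha) ?_
      rw [mul_comm, pow_succ]
      exact Ideal.mul_mem_mul (ih ha) hb
    · rw [map_add]
      exact Ideal.add_mem _ ha hb

/-- Since D maps I^(n+1) into I^n, the class of x modulo I^(n+1) fixes the derivative modulo I^n
only; hence the shift of levels. -/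
theorem exists_adicDeriv (x : AdicCompletion I R) : ∃ y : AdicCompletion I R, ∀ n a,
    AdicCompletion.evalₐ I (n + 1) x = Ideal.Quotient.mk _ a →
      AdicCompletion.evalₐ I n y = Ideal.Quotient.mk _ (D a) := by
  choose a ha using fun n => Ideal.Quotient.mk_surjective (AdicCompletion.evalₐ I n x)
  obtain ⟨y, hy⟩ := exists_evalₐ_eq I (fun n => D (a (n + 1))) (fun n => by
    rw [← map_sub]
    exact D.mem_pow_of_mem_pow_succ I (sub_mem_of_evalₐ_eq I (Nat.le_succ (n + 1))
      (ha (n + 1)).symm (ha (n + 1 + 1)).symm))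
  refine ⟨y, fun n b hb => ?_⟩
  rw [hy, Ideal.Quotient.eq, ← map_sub]
  exact D.mem_pow_of_mem_pow_succ I (sub_mem_of_evalₐ_eq I le_rfl hb (ha (n + 1)).symm)

/-- The continuous extension of a derivation to the adic completion. -/
def adicDeriv : Derivation ℤ (AdicCompletion I R) (AdicCompletion I R) :=
  Derivation.mk' (AddMonoidHom.toIntLinearMap
    { toFun := fun x => (exists_adicDeriv I D x).choose
      map_zero' := AdicCompletion.ext_evalₐ fun n => by
        rw [(exists_adicDeriv I D 0).choose_spec n 0 (by simp), map_zero, map_zero, map_zero]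
      map_add' := fun x y => AdicCompletion.ext_evalₐ fun n => by
        obtain ⟨a, ha⟩ := Ideal.Quotient.mk_surjective (AdicCompletion.evalₐ I (n + 1) x)
        obtain ⟨b, hb⟩ := Ideal.Quotient.mk_surjective (AdicCompletion.evalₐ I (n + 1) y)
        rw [map_add, (exists_adicDeriv I D x).choose_spec n a ha.symm,
          (exists_adicDeriv I D y).choose_spec n b hb.symm,
          (exists_adicDeriv I D (x + y)).choose_spec n (a + b) (by rw [map_add, map_add, ha, hb]),
          map_add, map_add] }) (fun x y => AdicCompletion.ext_evalₐ fun n => by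
        obtain ⟨a, ha⟩ := Ideal.Quotient.mk_surjective (AdicCompletion.evalₐ I (n + 1) x)
        obtain ⟨b, hb⟩ := Ideal.Quotient.mk_surjective (AdicCompletion.evalₐ I (n + 1) y)
        obtain ⟨a', ha'⟩ := Ideal.Quotient.mk_surjective (AdicCompletion.evalₐ I n x)
        obtain ⟨b', hb'⟩ := Ideal.Quotient.mk_surjective (AdicCompletion.evalₐ I n y)
        have h1 := sub_mem_of_evalₐ_eq I (Nat.le_succ n) ha'.symm ha.symm
        have h2 := sub_mem_of_evalₐ_eq I (Nat.le_succ n) hb'.symm hb.symm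
        change AdicCompletion.evalₐ I n (exists_adicDeriv I D (x * y)).choose =
          AdicCompletion.evalₐ I n (x * (exists_adicDeriv I D y).choose +
            y * (exists_adicDeriv I D x).choose)
        rw [map_add, map_mul, map_mul, (exists_adicDeriv I D x).choose_spec n a ha.symm,
          (exists_adicDeriv I D y).choose_spec n b hb.symm,
          (exists_adicDeriv I D (x * y)).choose_spec n (a * b) (by rw [map_mul, map_mul, ha, hb]),
          ← ha', ← hb', D.leibniz, ← map_mul, ← map_mul, ← map_add, Ideal.Quotient.eq]
        have h3 := Ideal.add_mem _ (Ideal.mul_mem_right (D b) _ h1)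
          (Ideal.mul_mem_right (D a) _ h2)
        convert h3 using 1
        simp only [smul_eq_mul]
        ring)

theorem evalₐ_adicDeriv {x : AdicCompletion I R} {n : ℕ} {a : R}
    (ha : AdicCompletion.evalₐ I (n + 1) x = Ideal.Quotient.mk _ a) :
    AdicCompletion.evalₐ I n (adicDeriv I D x) = Ideal.Quotient.mk _ (D a) :=
  (exists_adicDeriv I D x).choose_spec n a ha

theorem adicDeriv_algebraMap (x : R) :
    adicDeriv I D (algebraMap R _ x) = algebraMap R _ (D x) := by
  apply AdicCompletion.ext_evalₐ
  intro n
  rw [evalₐ_adicDeriv I D (a := x) (AlgHom.commutes _ _), AlgHom.commutes]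
  rfl

theorem adicMap_adicDeriv {k' : Type*} [CommRing k'] [Algebra k' S] (J : Ideal S) (f : R →+* S)
    (h : I.map f ≤ J)
    (D' : Derivation k' S S) (hD : ∀ x, f (D x) = D' (f x)) (x : AdicCompletion I R) :
    adicMap I J f h (adicDeriv I D x) = adicDeriv J D' (adicMap I J f h x) := by
  apply AdicCompletion.ext_evalₐ
  intro n
  obtain ⟨a, ha⟩ := Ideal.Quotient.mk_surjective (AdicCompletion.evalₐ I (n + 1) x)
  rw [evalₐ_adicMap I J f h n _ (evalₐ_adicDeriv I D ha.symm), hD,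
    evalₐ_adicDeriv J D' (evalₐ_adicMap I J f h (n + 1) _ ha.symm)]

end AdicGeneral

/-! ### The coefficient rings A ⊗ K and their completions -/

section CoeffRings

variable {Fq A K : Type*} [Field Fq] [CommRing A] [Algebra Fq A] [Field K] [Algebra Fq K]

variable (K) in
/-- The derivation `D ⊗ id` of `A ⊗ K`. -/
def coeffDeriv (D : Derivation Fq A A) : Derivation Fq (A ⊗[Fq] K) (A ⊗[Fq] K) :=
  Derivation.mk' (D.toLinearMap.rTensor K) fun x y => by
    induction x with
    | zero => simp
    | add x₁ x₂ h₁ h₂ => rw [add_mul, map_add, h₁, h₂, map_add, add_smul, smul_add]; abel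
    | tmul a l =>
      induction y with
      | zero => simp
      | add y₁ y₂ h₁ h₂ => rw [mul_add, map_add, h₁, h₂, map_add, add_smul, smul_add]; abel
      | tmul b m =>
        simp [TensorProduct.add_tmul, mul_comm m l]

@[simp] theorem coeffDeriv_tmul (D : Derivation Fq A A) (a : A) (l : K) :
    coeffDeriv K D (a ⊗ₜ l) = D a ⊗ₜ l := rfl

theorem coeffMap_coeffDeriv {K' : Type*} [Field K'] [Algebra Fq K'] (f : K →ₐ[Fq] K')
    (D : Derivation Fq A A) (x : A ⊗[Fq] K) :
    coeffMap Fq A f (coeffDeriv K D x) = coeffDeriv K' D (coeffMap Fq A f x) := by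
  induction x with
  | zero => simp
  | add x y hx hy => simp only [map_add, hx, hy]
  | tmul a l => simp [coeffMap]

theorem map_mem_pow_of_mem_coeffIdeal_pow (v : Ideal A) (f : A ⊗[Fq] K →ₗ[A] A) {n : ℕ}
    {z : A ⊗[Fq] K} (hz : z ∈ coeffIdeal Fq v K ^ n) : f z ∈ v ^ n := by
  rw [coeffIdeal, ← Ideal.map_pow] at hz
  have h2 : z ∈ (v ^ n • ⊤ : Submodule A (A ⊗[Fq] K)) := by
    rw [Ideal.smul_top_eq_map]; exact hz
  refine Submodule.smul_induction_on h2 (fun a ha y _ => ?_) (fun a b ha hb => ?_)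
  · rw [map_smul, smul_eq_mul]
    exact Ideal.mul_mem_right _ _ ha
  · rw [map_add]; exact Ideal.add_mem _ ha hb

/-- A linear form K → Fq with value 1 at 1 induces an A-linear retraction A ⊗ K → A, which respects
the v-adic filtrations. -/
theorem mem_pow_of_tmul_one_mem (v : Ideal A) {n : ℕ} {a : A}
    (h : a ⊗ₜ[Fq] (1 : K) ∈ coeffIdeal Fq v K ^ n) : a ∈ v ^ n := by
  obtain ⟨l, hl⟩ := Module.Projective.exists_dual_eq_one Fq (one_ne_zero (α := K))
  let f : A ⊗[Fq] K →ₗ[A] A :=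
    (TensorProduct.AlgebraTensorModule.rid Fq A A).toLinearMap ∘ₗ
      TensorProduct.AlgebraTensorModule.map LinearMap.id l
  have := map_mem_pow_of_mem_coeffIdeal_pow v f h
  simpa [f, hl] using this

/-- A ⊗ K is free over A on an Fq-basis of K, and each coordinate lies in every v^n. -/
theorem eq_zero_of_forall_mem_coeffIdeal_pow (v : Ideal A) (hv : ⨅ n, v ^ n = ⊥)
    {z : A ⊗[Fq] K} (hz : ∀ n, z ∈ coeffIdeal Fq v K ^ n) : z = 0 := by
  let b := Algebra.TensorProduct.basis A (Module.Basis.ofVectorSpace Fq K)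
  apply b.ext_elem
  intro i
  rw [map_zero, Finsupp.zero_apply, ← Ideal.mem_bot, ← hv, Ideal.mem_iInf]
  intro n
  exact map_mem_pow_of_mem_coeffIdeal_pow v (b.coord i) (hz n)

theorem coeff_algebraMap_injective (v : Ideal A) (hv : ⨅ n, v ^ n = ⊥) :
    Function.Injective (algebraMap (A ⊗[Fq] K) (CompletedCoeff Fq v K)) := by
  rw [injective_iff_map_eq_zero]
  intro z hz
  refine eq_zero_of_forall_mem_coeffIdeal_pow v hv fun n => ?_
  have := congrArg (AdicCompletion.evalₐ _ n) hz
  rw [AlgHom.commutes, map_zero] at this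
  exact Ideal.Quotient.eq_zero_iff_mem.mp this

theorem adic_algebraMap_injective (v : Ideal A) :
    Function.Injective (algebraMap (AdicCompletion v A) (CompletedCoeff Fq v K)) := by
  rw [injective_iff_map_eq_zero]
  intro z hz
  apply AdicCompletion.ext_evalₐ
  intro n
  obtain ⟨a, ha⟩ := Ideal.Quotient.mk_surjective (AdicCompletion.evalₐ v n z)
  have h1 := congrArg (AdicCompletion.evalₐ _ n) hz
  rw [map_zero] at h1
  have h2 : AdicCompletion.evalₐ (coeffIdeal Fq v K) n
      (algebraMap (AdicCompletion v A) (CompletedCoeff Fq v K) z) = _ :=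
    evalₐ_adicMap v (coeffIdeal Fq v K) (algebraMap A (A ⊗[Fq] K)) le_rfl n z ha.symm
  rw [h1, eq_comm, Ideal.Quotient.eq_zero_iff_mem] at h2
  rw [map_zero, ← ha, Ideal.Quotient.eq_zero_iff_mem]
  exact mem_pow_of_tmul_one_mem v h2

end CoeffRings

/-! ### Frobenius modules cut out by idempotent matrices -/

section FrobeniusMatrix

variable {Fq K R : Type*} [Field Fq] [Fintype Fq] [Field K] [Algebra Fq K]
  [CommRing R] [Algebra K R] {σ : R →+* R} {N : ℕ}

/-- The Frobenius-semilinear map `y ↦ F σ(y)`. -/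
def frobeniusMulVec (hσ : ∀ (c : K) (s : R), σ (c • s) = c ^ Fintype.card Fq • σ s)
    (F : Matrix (Fin N) (Fin N) R) :
    (Fin N → R) →ₛₗ[(FiniteField.frobeniusAlgHom Fq K : K →+* K)] (Fin N → R) where
  toFun y := F *ᵥ (σ ∘ y)
  map_add' x y := by
    rw [← Matrix.mulVec_add]; congr 1; ext i; simp
  map_smul' c y := by
    have : σ ∘ (c • y) = c ^ Fintype.card Fq • (σ ∘ y) := by ext i; simp [hσ]
    rw [this, Matrix.mulVec_smul]
    simp

theorem comp_mulVec {R R' : Type*} [CommRing R] [CommRing R'] (σ : R →+* R') {m n : Type*}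
    [Fintype n] (M : Matrix m n R)
    (y : n → R) : σ ∘ (M *ᵥ y) = M.map σ *ᵥ (σ ∘ y) := by
  ext i
  exact σ.map_mulVec M y i

/-- The K-space V = im E is stable under y ↦ F σ(y), and Lang's theorem applies once the image spans
V. Indeed x = F σ(E) (G x) for x ∈ V, and G x is a K-combination of σ-fixed vectors z, for which F
σ(E) z = F σ(E z). -/
theorem mem_span_frobenius_fixed [IsSepClosed K] [Module.Finite K R]
    (hσ : ∀ (c : K) (s : R), σ (c • s) = c ^ Fintype.card Fq • σ s)
    (hspan : Submodule.span K {s | σ s = s} = ⊤)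
    {E F G : Matrix (Fin N) (Fin N) R} (hEE : E * E = E) (hEF : E * F = F)
    (hFE : F * E.map σ = F) (hFG : F * G = E) {y : Fin N → R} (hy : E *ᵥ y = y) :
    y ∈ Submodule.span K {y : Fin N → R | F *ᵥ (σ ∘ y) = y} := by
  have hq : 1 < Fintype.card Fq := Fintype.one_lt_card
  have hq0 : ((Fintype.card Fq : ℕ) : K) = 0 := by
    rw [← map_natCast (algebraMap Fq K), FiniteField.cast_card_eq_zero, map_zero]
  let Φ := frobeniusMulVec hσ F
  let V : Submodule K (Fin N → R) := LinearMap.eqLocus (E.mulVecLin.restrictScalars K) LinearMap.id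
  have hV : ∀ x, x ∈ V ↔ E *ᵥ x = x := fun x => Iff.rfl
  have hΦ : ∀ x, Φ x ∈ V := fun x => by
    rw [hV]
    change E *ᵥ (F *ᵥ (σ ∘ x)) = F *ᵥ (σ ∘ x)
    rw [Matrix.mulVec_mulVec, hEF]
  let φ : V →ₛₗ[(FiniteField.frobeniusAlgHom Fq K : K →+* K)] V :=
    (Φ.domRestrict V).codRestrict V fun x => hΦ x
  have hpi : Submodule.span K {z : Fin N → R | σ ∘ z = z} = ⊤ := by
    rw [eq_top_iff]
    intro z _
    have hz : z = ∑ i, Pi.single i (z i) := (Finset.univ_sum_single z).symm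
    rw [hz]
    refine Submodule.sum_mem _ fun i _ => ?_
    have h1 : z i ∈ Submodule.span K {s | σ s = s} := hspan ▸ trivial
    have h2 := Submodule.mem_map_of_mem (f := LinearMap.single K (fun _ : Fin N => R) i) h1
    rw [Submodule.map_span] at h2
    refine Submodule.span_mono ?_ h2
    rintro _ ⟨s, hs, rfl⟩
    ext j
    by_cases hj : j = i
    · subst hj; simpa using hs
    · simp [hj]
  have hspanφ : Submodule.span K (Set.range φ) = ⊤ := by
    have h1 : ∀ w : Fin N → R, F *ᵥ (E.map σ *ᵥ w) ∈
        Submodule.map V.subtype (Submodule.span K (Set.range φ)) := by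
      intro w
      have hw : w ∈ Submodule.span K {z : Fin N → R | σ ∘ z = z} := hpi ▸ trivial
      induction hw using Submodule.span_induction with
      | mem z hz =>
        have hz' : σ ∘ z = z := hz
        refine ⟨φ ⟨E *ᵥ z, ?_⟩, Submodule.subset_span ⟨_, rfl⟩, ?_⟩
        · rw [hV, Matrix.mulVec_mulVec, hEE]
        · change F *ᵥ (σ ∘ (E *ᵥ z)) = _
          rw [comp_mulVec, hz']
      | zero => simp
      | add a b _ _ ha hb =>
        rw [Matrix.mulVec_add, Matrix.mulVec_add]
        exact Submodule.add_mem _ ha hb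
      | smul c a _ ha =>
        rw [Matrix.mulVec_smul, Matrix.mulVec_smul]
        exact Submodule.smul_mem _ _ ha
    rw [eq_top_iff]
    rintro ⟨x, hx⟩ -
    obtain ⟨u, hu, hux⟩ := h1 (G *ᵥ x)
    rw [Matrix.mulVec_mulVec, Matrix.mulVec_mulVec, hFE, hFG, (hV x).mp hx] at hux
    have : u = ⟨x, hx⟩ := Subtype.ext hux
    exact this ▸ hu
  have h3 := span_frobenius_fixed_eq_top hq hq0
    (fun c => by simp) _ φ rfl hspanφ
  have h4 : (⟨y, (hV y).mpr hy⟩ : V) ∈ Submodule.span K {v | φ v = v} := h3 ▸ trivial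
  have h5 := Submodule.mem_map_of_mem (f := V.subtype) h4
  rw [Submodule.map_span] at h5
  refine Submodule.span_mono ?_ h5
  rintro _ ⟨u, hu, rfl⟩
  exact congrArg Subtype.val hu

/-- Frobenius-fixed vectors lift along surjections. -/
theorem exists_lift_of_frobenius_fixed [IsSepClosed K] [Module.Finite K R] [Algebra Fq R]
    [IsScalarTower Fq K R] {R' : Type*} [CommRing R'] [Algebra K R'] [Algebra Fq R']
    [IsScalarTower Fq K R'] {σ' : R' →+* R'}
    (hσ : ∀ (c : K) (s : R), σ (c • s) = c ^ Fintype.card Fq • σ s)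
    (hσ' : ∀ (c : K) (s : R'), σ' (c • s) = c ^ Fintype.card Fq • σ' s)
    (hspan : Submodule.span K {s | σ s = s} = ⊤)
    (π : R →ₐ[K] R') (hπ : Function.Surjective π) (hπσ : ∀ s, π (σ s) = σ' (π s))
    {E F G : Matrix (Fin N) (Fin N) R} (hEE : E * E = E) (hEF : E * F = F)
    (hFE : F * E.map σ = F) (hFG : F * G = E) {y : Fin N → R'}
    (hy : F.map π *ᵥ (σ' ∘ y) = y) :
    ∃ y' : Fin N → R, F *ᵥ (σ ∘ y') = y' ∧ π ∘ y' = y := by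
  let πl : (Fin N → R) →ₗ[K] (Fin N → R') := π.toLinearMap.compLeft (Fin N)
  have hπl : ∀ z, πl z = π ∘ z := fun z => rfl
  have hπv : ∀ (M : Matrix (Fin N) (Fin N) R) (z : Fin N → R),
      π ∘ (M *ᵥ z) = M.map π *ᵥ (π ∘ z) := fun M z => comp_mulVec (π : R →+* R') M z
  have hπs : ∀ z : Fin N → R, π ∘ σ ∘ z = σ' ∘ π ∘ z := fun z => funext fun i => hπσ (z i)
  let X := {z : Fin N → R | F *ᵥ (σ ∘ z) = z}
  choose z hz using fun i => hπ (y i)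
  have hz' : π ∘ z = y := funext hz
  have hEz : E *ᵥ z ∈ Submodule.span K X := by
    refine mem_span_frobenius_fixed hσ hspan hEE hEF hFE hFG ?_
    rw [Matrix.mulVec_mulVec, hEE]
  have h1 := Submodule.mem_map_of_mem (f := πl) hEz
  have hEF' : E.map π * F.map π = F.map π := by
    rw [← Matrix.map_mul, hEF]
  have h2 : πl (E *ᵥ z) = y := by
    rw [hπl, hπv, hz', ← hy, Matrix.mulVec_mulVec, hEF']
  rw [Submodule.map_span, h2] at h1
  -- The fixed vector y is a K-combination of images of fixed vectors, hence an Fq-combination of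
  -- them, and Fq-combinations of fixed vectors upstairs are still fixed.
  have h3 := mem_span_of_frobenius_fixed Fq (fun c => by simp) (frobeniusMulVec hσ' (F.map π)) (by
      rintro _ ⟨x, hx, rfl⟩
      have hx' : F *ᵥ (σ ∘ x) = x := hx
      change F.map π *ᵥ (σ' ∘ π ∘ x) = π ∘ x
      rw [← hπs, ← hπv, hx']) h1 hy
  let Y : Submodule Fq (Fin N → R) :=
    { carrier := X
      add_mem' := fun {a b} ha hb => (map_add (frobeniusMulVec hσ F) a b).trans
        (congrArg₂ _ ha hb)
      zero_mem' := map_zero (frobeniusMulVec hσ F)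
      smul_mem' := fun c x hx => by
        have hx' : frobeniusMulVec hσ F x = x := hx
        change frobeniusMulVec hσ F (c • x) = c • x
        rw [← algebraMap_smul K, map_smulₛₗ, hx']
        simp }
  have h4 : Submodule.span Fq (πl '' X) ≤ Y.map (πl.restrictScalars Fq) := by
    rw [Submodule.span_le]
    rintro _ ⟨x, hx, rfl⟩
    exact ⟨x, hx, rfl⟩
  obtain ⟨y', hy', h5⟩ := h4 h3
  exact ⟨y', hy', h5⟩

variable (k : Type*) [Field k] [Algebra Fq k] [Algebra k R] [Algebra Fq R]
    [IsScalarTower Fq k R] [IsScalarTower Fq K R]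

/-- For an Fq-basis f_j of k the vectors f_j e_i are fixed and independent over Fq, hence over K.
Since the f_j span R over K, an R-relation among the e_i expands into a K-relation among the f_j
e_i. -/
theorem linearIndependent_of_frobenius_fixed_of_field [Module.Finite Fq k]
    (hσ : ∀ (c : K) (s : R), σ (c • s) = c ^ Fintype.card Fq • σ s)
    (hσk : ∀ a : k, σ (algebraMap k R a) = algebraMap k R a)
    (hspan : Submodule.span K (Set.range (algebraMap k R)) = ⊤)
    {F : Matrix (Fin N) (Fin N) R} {ι : Type*} {e : ι → Fin N → R}
    (he : ∀ i, F *ᵥ (σ ∘ e i) = e i) (hli : LinearIndependent k e) : LinearIndependent R e := by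
  let f := Module.finBasis Fq k
  have hli1 : LinearIndependent Fq (fun p : Fin (Module.finrank Fq k) × ι => f p.1 • e p.2) :=
    linearIndependent_smul f.linearIndependent hli
  have hfix : ∀ p : Fin (Module.finrank Fq k) × ι,
      frobeniusMulVec hσ F (f p.1 • e p.2) = f p.1 • e p.2 := by
    intro p
    have : σ ∘ (f p.1 • e p.2) = f p.1 • (σ ∘ e p.2) := by
      ext i; simp [Algebra.smul_def, hσk]
    change F *ᵥ (σ ∘ (f p.1 • e p.2)) = f p.1 • e p.2
    rw [this, Matrix.mulVec_smul, he]
  have hli2 : LinearIndependent K (fun p : Fin (Module.finrank Fq k) × ι => f p.1 • e p.2) :=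
    linearIndependent_of_frobenius_fixed Fq (fun c => by simp) (frobeniusMulVec hσ F) hfix hli1
  have hspf : Submodule.span K (Set.range fun j => algebraMap k R (f j)) = ⊤ := by
    rw [eq_top_iff, ← hspan, Submodule.span_le]
    rintro _ ⟨a, rfl⟩
    rw [← f.sum_repr a, map_sum]
    refine Submodule.sum_mem _ fun j _ => ?_
    rw [Algebra.smul_def, map_mul, ← IsScalarTower.algebraMap_apply,
      IsScalarTower.algebraMap_apply Fq K R, ← Algebra.smul_def]
    exact Submodule.smul_mem _ _ (Submodule.subset_span ⟨j, rfl⟩)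
  rw [linearIndependent_iff']
  intro s c hc
  have h1 : ∀ i, ∃ κ : Fin (Module.finrank Fq k) → K, ∑ j, κ j • algebraMap k R (f j) = c i :=
    fun i => (Submodule.mem_span_range_iff_exists_fun K).mp (hspf ▸ trivial)
  choose κ hκ using h1
  have h2 : ∑ p ∈ (Finset.univ : Finset (Fin (Module.finrank Fq k))) ×ˢ s,
      κ p.2 p.1 • (f p.1 • e p.2) = 0 := by
    rw [Finset.sum_product_right, ← hc]
    refine Finset.sum_congr rfl fun i _ => ?_
    rw [← hκ, Finset.sum_smul]
    refine Finset.sum_congr rfl fun j _ => ?_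
    rw [smul_assoc, algebraMap_smul]
  have h4 := linearIndependent_iff'.mp hli2 _ _ h2
  intro i hi
  rw [← hκ]
  refine Finset.sum_eq_zero fun j _ => ?_
  rw [h4 (j, i) (by simp [hi]), zero_smul]

/-- The family is a k-basis of the fixed vectors. It is finite because fixed vectors independent
over Fq remain independent over K, and R^N is finite-dimensional over K. -/
theorem exists_frobenius_fixed_family [Module.Finite K R]
    (hσ : ∀ (c : K) (s : R), σ (c • s) = c ^ Fintype.card Fq • σ s)
    (hσk : ∀ a : k, σ (algebraMap k R a) = algebraMap k R a)
    (F : Matrix (Fin N) (Fin N) R) :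
    ∃ (m : ℕ) (e : Fin m → Fin N → R), (∀ i, F *ᵥ (σ ∘ e i) = e i) ∧ LinearIndependent k e ∧
      ∀ z, F *ᵥ (σ ∘ z) = z → z ∈ Submodule.span R (Set.range e) := by
  let T : Submodule k (Fin N → R) :=
    { carrier := {y | F *ᵥ (σ ∘ y) = y}
      add_mem' := fun {a b} ha hb => (map_add (frobeniusMulVec hσ F) a b).trans
        (congrArg₂ _ ha hb)
      zero_mem' := map_zero (frobeniusMulVec hσ F)
      smul_mem' := fun c y hy => by
        have : σ ∘ (c • y) = c • (σ ∘ y) := by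
          ext i; simp [Algebra.smul_def, hσk]
        change F *ᵥ (σ ∘ (c • y)) = c • y
        rw [this, Matrix.mulVec_smul]
        exact congrArg _ hy }
  obtain ⟨ι, t⟩ : Σ ι : Type _, Module.Basis ι k T := ⟨_, Module.Basis.ofVectorSpace k T⟩
  have hfix : ∀ i, F *ᵥ (σ ∘ (t i : Fin N → R)) = t i := fun i => (t i).2
  have hli0 : LinearIndependent k (fun i => (t i : Fin N → R)) :=
    t.linearIndependent.map' T.subtype (Submodule.ker_subtype _)
  have hli2 : LinearIndependent K (fun i => (t i : Fin N → R)) :=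
    linearIndependent_of_frobenius_fixed Fq (fun c => by simp) (frobeniusMulVec hσ F) hfix
      (hli0.restrict_scalars (by
        intro a b h
        simp only [Algebra.smul_def, mul_one] at h
        exact (algebraMap Fq k).injective h))
  have hfin := hli2.finite
  obtain ⟨m, ⟨ε⟩⟩ := Finite.exists_equiv_fin ι
  refine ⟨m, fun i => t (ε.symm i), fun i => hfix _, hli0.comp _ ε.symm.injective, ?_⟩
  intro z hz
  have h3 := (t.reindex ε).sum_repr ⟨z, hz⟩
  rw [← show T.subtype ⟨z, hz⟩ = z from rfl, ← h3, map_sum]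
  refine Submodule.sum_mem _ fun i _ => ?_
  rw [map_smul, ← algebraMap_smul R]
  exact Submodule.smul_mem _ _ (Submodule.subset_span ⟨i, by simp⟩)

/-- Over a ring spanned over `K` by a finite field `k` fixed by Frobenius, an étale Frobenius
module has a basis of fixed vectors. -/
theorem exists_frobenius_basis_of_field [IsSepClosed K] [Module.Finite K R] [Module.Finite Fq k]
    (hσ : ∀ (c : K) (s : R), σ (c • s) = c ^ Fintype.card Fq • σ s)
    (hσk : ∀ a : k, σ (algebraMap k R a) = algebraMap k R a)
    (hspan : Submodule.span K (Set.range (algebraMap k R)) = ⊤)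
    {E F G : Matrix (Fin N) (Fin N) R} (hEE : E * E = E) (hEF : E * F = F)
    (hFE : F * E.map σ = F) (hFG : F * G = E) :
    ∃ (m : ℕ) (B : Matrix (Fin N) (Fin m) R) (C : Matrix (Fin m) (Fin N) R),
      C * B = 1 ∧ B * C = E ∧ F * B.map σ = B := by
  have hspan' : Submodule.span K {s | σ s = s} = ⊤ := by
    rw [eq_top_iff, ← hspan]
    refine Submodule.span_mono ?_
    rintro _ ⟨a, rfl⟩
    exact hσk a
  obtain ⟨m, e, he, hli, hsp⟩ := exists_frobenius_fixed_family k hσ hσk F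
  have hliR := linearIndependent_of_frobenius_fixed_of_field k hσ hσk hspan he hli
  let B : Matrix (Fin N) (Fin m) R := Matrix.of fun i j => e j i
  have hBv : ∀ c : Fin m → R, B *ᵥ c = ∑ i, c i • e i := by
    intro c; ext j; simp [B, Matrix.mulVec, dotProduct, mul_comm]
  have hinj : ∀ c : Fin m → R, B *ᵥ c = 0 → c = 0 := fun c hc =>
    funext (Fintype.linearIndependent_iff.mp hliR c (hBv c ▸ hc))
  have hsurj : ∀ y, E *ᵥ y = y → ∃ c, B *ᵥ c = y := by
    intro y hy
    have h1 := mem_span_frobenius_fixed hσ hspan' hEE hEF hFE hFG hy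
    have h2 : Submodule.span K {y : Fin N → R | F *ᵥ (σ ∘ y) = y} ≤
        (Submodule.span R (Set.range e)).restrictScalars K := by
      rw [Submodule.span_le]
      exact fun z hz => hsp z hz
    obtain ⟨c, hc⟩ := (Submodule.mem_span_range_iff_exists_fun R).mp (h2 h1)
    exact ⟨c, (hBv c).trans hc⟩
  have hcol : ∀ j, ∃ c, B *ᵥ c = fun i => E i j := by
    intro j
    refine hsurj _ ?_
    ext i
    exact congrFun (congrFun hEE i) j
  choose C hC using hcol
  have hFB : F * B.map σ = B := by
    ext i j
    exact congrFun (he j) i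
  have hBC : B * Matrix.of (fun i j => C j i) = E := by
    ext i j
    exact congrFun (hC j) i
  have hEB : E * B = B := by
    rw [← hFB, ← Matrix.mul_assoc, hEF]
  refine ⟨m, B, Matrix.of fun i j => C j i, ?_, hBC, hFB⟩
  -- E B = B gives B (C B - 1) = 0, and B is injective since its columns are independent over R.
  have h5 : B * (Matrix.of (fun i j => C j i) * B - 1) = 0 := by
    rw [Matrix.mul_sub, ← Matrix.mul_assoc, hBC, hEB, Matrix.mul_one, sub_self]
  rw [← sub_eq_zero]
  ext i j
  generalize Matrix.of (fun i j => C j i) * B - 1 = M at h5 ⊢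
  exact congrFun (hinj (fun i => M i j) (funext fun l => congrFun (congrFun h5 l) j)) i

end FrobeniusMatrix

/-! ### Frobenius modulo powers of v -/

section Levels

variable {Fq A K : Type*} [Field Fq] [CommRing A] [Algebra Fq A] [Field K] [Algebra Fq K]

attribute [local instance] Algebra.TensorProduct.rightAlgebra

theorem smul_coeff (c : K) (x : A ⊗[Fq] K) : c • x = (1 ⊗ₜ c) * x := Algebra.smul_def c x

variable {v : Ideal A}

theorem span_algebraMap_level (n : ℕ) :
    Submodule.span K (Set.range (algebraMap A ((A ⊗[Fq] K) ⧸ coeffIdeal Fq v K ^ n))) = ⊤ := by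
  rw [eq_top_iff]
  intro s _
  obtain ⟨x, rfl⟩ := Ideal.Quotient.mk_surjective s
  induction x with
  | zero => rw [map_zero]; exact Submodule.zero_mem _
  | add x y hx hy => rw [map_add]; exact Submodule.add_mem _ (hx trivial) (hy trivial)
  | tmul a c =>
    have : Ideal.Quotient.mk (coeffIdeal Fq v K ^ n) (a ⊗ₜ c) =
        c • algebraMap A ((A ⊗[Fq] K) ⧸ coeffIdeal Fq v K ^ n) a := by
      change _ = Ideal.Quotient.mk (coeffIdeal Fq v K ^ n) (c • (a ⊗ₜ 1))
      rw [smul_coeff]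
      simp
    rw [this]
    exact Submodule.smul_mem _ _ (Submodule.subset_span ⟨a, rfl⟩)

variable (Fq K v) in
theorem finite_level (n : ℕ) [Finite (A ⧸ v ^ n)] :
    Module.Finite K ((A ⊗[Fq] K) ⧸ coeffIdeal Fq v K ^ n) := by
  have h : (Set.range (algebraMap A ((A ⊗[Fq] K) ⧸ coeffIdeal Fq v K ^ n))).Finite := by
    refine (Set.finite_range fun s : A ⧸ v ^ n =>
      algebraMap A ((A ⊗[Fq] K) ⧸ coeffIdeal Fq v K ^ n) s.out).subset ?_
    rintro _ ⟨a, rfl⟩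
    refine ⟨Ideal.Quotient.mk _ a, ?_⟩
    have h1 : (Ideal.Quotient.mk (v ^ n) a).out - a ∈ v ^ n := by
      rw [← Ideal.Quotient.eq, Ideal.Quotient.mk_out]
    rw [← sub_eq_zero]
    simp only
    rw [← map_sub]
    refine Ideal.Quotient.eq_zero_iff_mem.mpr ?_
    rw [coeffIdeal, ← Ideal.map_pow]
    exact Ideal.mem_map_of_mem _ h1
  exact ⟨⟨h.toFinset, by rw [Set.Finite.coe_toFinset]; exact span_algebraMap_level n⟩⟩

variable [Fintype Fq] (v) (Fq K)

/-- The Frobenius on `(A ⊗ K) / v^n`. -/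
def levelFrob (n : ℕ) :
    (A ⊗[Fq] K) ⧸ coeffIdeal Fq v K ^ n →+* (A ⊗[Fq] K) ⧸ coeffIdeal Fq v K ^ n :=
  Ideal.quotientMap _ (frob Fq A K : A ⊗[Fq] K →+* A ⊗[Fq] K)
    (adicMap_compat _ _ _ (coeffIdeal_map_le Fq v (frob Fq A K)) n)

variable {Fq K} {v}

theorem frob_tmul (a : A) (c : K) : frob Fq A K (a ⊗ₜ c) = a ⊗ₜ (c ^ Fintype.card Fq) := by
  simp [frob, coeffMap]

theorem levelFrob_mk (n : ℕ) (x : A ⊗[Fq] K) :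
    levelFrob Fq K v n (Ideal.Quotient.mk (coeffIdeal Fq v K ^ n) x) =
      Ideal.Quotient.mk (coeffIdeal Fq v K ^ n) (frob Fq A K x) := rfl

theorem evalₐ_completedMap_frob (n : ℕ) (x : CompletedCoeff Fq v K) :
    AdicCompletion.evalₐ _ n (completedMap Fq v (frob Fq A K) x) =
      levelFrob Fq K v n (AdicCompletion.evalₐ _ n x) := by
  obtain ⟨a, ha⟩ := Ideal.Quotient.mk_surjective (AdicCompletion.evalₐ _ n x)
  refine (evalₐ_adicMap _ _ _ (coeffIdeal_map_le Fq v (frob Fq A K)) n x ha.symm).trans ?_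
  rw [← ha, levelFrob_mk]
  rfl

theorem levelFrob_smul (n : ℕ) (c : K) (s : (A ⊗[Fq] K) ⧸ coeffIdeal Fq v K ^ n) :
    levelFrob Fq K v n (c • s) = c ^ Fintype.card Fq • levelFrob Fq K v n s := by
  obtain ⟨x, rfl⟩ := Ideal.Quotient.mk_surjective s
  have h : ∀ (c : K) (x : A ⊗[Fq] K), c • Ideal.Quotient.mk (coeffIdeal Fq v K ^ n) x =
      Ideal.Quotient.mk (coeffIdeal Fq v K ^ n) (c • x) := fun c x => rfl
  rw [h, levelFrob_mk, levelFrob_mk, h, smul_coeff, smul_coeff, map_mul, frob_tmul]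

theorem levelFrob_algebraMap (n : ℕ) (a : A) :
    levelFrob Fq K v n (algebraMap A ((A ⊗[Fq] K) ⧸ coeffIdeal Fq v K ^ n) a) =
      algebraMap A ((A ⊗[Fq] K) ⧸ coeffIdeal Fq v K ^ n) a := by
  change levelFrob Fq K v n (Ideal.Quotient.mk _ (a ⊗ₜ 1)) = Ideal.Quotient.mk _ (a ⊗ₜ 1)
  rw [levelFrob_mk, frob_tmul, one_pow]

theorem span_frobenius_fixed_level (n : ℕ) :
    Submodule.span K {s | levelFrob Fq K v n s = s} = ⊤ := by
  rw [eq_top_iff, ← span_algebraMap_level n]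
  refine Submodule.span_mono ?_
  rintro _ ⟨a, rfl⟩
  exact levelFrob_algebraMap n a

/-- The image of A consists of fixed elements and spans over K, so a fixed element lies in its
Fq-span, which is the image of A itself. -/
theorem exists_algebraMap_eq_of_levelFrob_eq {n : ℕ} {s : (A ⊗[Fq] K) ⧸ coeffIdeal Fq v K ^ n}
    (hs : levelFrob Fq K v n s = s) : ∃ a : A, algebraMap A _ a = s := by
  let φ : ((A ⊗[Fq] K) ⧸ coeffIdeal Fq v K ^ n) →ₛₗ[(FiniteField.frobeniusAlgHom Fq K : K →+* K)]
      ((A ⊗[Fq] K) ⧸ coeffIdeal Fq v K ^ n) :=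
    { toFun := levelFrob Fq K v n
      map_add' := map_add _
      map_smul' := fun c x => levelFrob_smul n c x }
  have h := mem_span_of_frobenius_fixed Fq (fun c => by simp) φ
    (X := Set.range (algebraMap A _)) (by rintro _ ⟨a, rfl⟩; exact levelFrob_algebraMap n a)
    (v := s) (by rw [span_algebraMap_level]; trivial) hs
  have h2 : Submodule.span Fq (Set.range (algebraMap A ((A ⊗[Fq] K) ⧸ coeffIdeal Fq v K ^ n))) ≤
      LinearMap.range (IsScalarTower.toAlgHom Fq A
        ((A ⊗[Fq] K) ⧸ coeffIdeal Fq v K ^ n)).toLinearMap := by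
    rw [Submodule.span_le]
    rintro _ ⟨a, rfl⟩
    exact ⟨a, rfl⟩
  obtain ⟨a, ha⟩ := h2 h
  exact ⟨a, ha⟩

/-- The Frobenius-fixed elements of `A_{v,K}` are those of `A_v`. -/
theorem exists_algebraMap_eq_of_frob_eq {y : CompletedCoeff Fq v K}
    (hy : completedMap Fq v (frob Fq A K) y = y) : ∃ c : AdicCompletion v A,
      algebraMap _ (CompletedCoeff Fq v K) c = y := by
  have h : ∀ n, ∃ a : A, algebraMap A _ a = AdicCompletion.evalₐ (coeffIdeal Fq v K) n y := by
    intro n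
    apply exists_algebraMap_eq_of_levelFrob_eq
    rw [← evalₐ_completedMap_frob, hy]
  choose a ha using h
  have ha' : ∀ n, AdicCompletion.evalₐ (coeffIdeal Fq v K) n y =
    Ideal.Quotient.mk _ (a n ⊗ₜ 1) := fun n => (ha n).symm
  obtain ⟨c, hc⟩ := exists_evalₐ_eq v a fun n => by
    have := sub_mem_of_evalₐ_eq _ (Nat.le_succ n) (ha' n) (ha' (n + 1))
    rw [← TensorProduct.sub_tmul] at this
    exact mem_pow_of_tmul_one_mem v this
  refine ⟨c, AdicCompletion.ext_evalₐ fun n => ?_⟩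
  rw [ha']
  exact evalₐ_adicMap v (coeffIdeal Fq v K) (algebraMap A (A ⊗[Fq] K)) le_rfl n c (hc n)

end Levels

/-! ### Lifting fixed vectors from v to the completion -/

section Lift

variable {Fq A K : Type*} [Field Fq] [CommRing A] [Algebra Fq A] [Field K] [Algebra Fq K]

attribute [local instance] Algebra.TensorProduct.rightAlgebra

theorem factorPow_evalₐ {R : Type*} [CommRing R] (I : Ideal R) (n : ℕ) (x : AdicCompletion I R) :
    Ideal.Quotient.factorPow I (Nat.le_succ n) (AdicCompletion.evalₐ I (n + 1) x) =
      AdicCompletion.evalₐ I n x := by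
  obtain ⟨a, ha⟩ := Ideal.Quotient.mk_surjective (AdicCompletion.evalₐ I n x)
  obtain ⟨b, hb⟩ := Ideal.Quotient.mk_surjective (AdicCompletion.evalₐ I (n + 1) x)
  rw [← ha, ← hb]
  change Ideal.Quotient.mk _ b = _
  rw [Ideal.Quotient.eq]
  exact sub_mem_of_evalₐ_eq I (Nat.le_succ n) ha.symm hb.symm

variable (Fq K) in
/-- Reduction of a matrix over `A_{v,K}` modulo `v^n`. -/
def levelMatrix (v : Ideal A) (n : ℕ) {m m' : Type*} (M : Matrix m m' (CompletedCoeff Fq v K)) :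
    Matrix m m' ((A ⊗[Fq] K) ⧸ coeffIdeal Fq v K ^ n) :=
  M.map (AdicCompletion.evalₐ (coeffIdeal Fq v K) n)

variable {v : Ideal A}

theorem levelMatrix_mul {n : ℕ} {l m m' : Type*} [Fintype m]
    (M : Matrix l m (CompletedCoeff Fq v K)) (M' : Matrix m m' (CompletedCoeff Fq v K)) :
    levelMatrix Fq K v n (M * M') = levelMatrix Fq K v n M * levelMatrix Fq K v n M' :=
  Matrix.map_mul

variable [Fintype Fq]

theorem levelMatrix_frob {n : ℕ} {m m' : Type*} (M : Matrix m m' (CompletedCoeff Fq v K)) :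
    levelMatrix Fq K v n (M.map (completedMap Fq v (frob Fq A K))) =
      (levelMatrix Fq K v n M).map (levelFrob Fq K v n) := by
  ext i j
  exact evalₐ_completedMap_frob n _

variable [IsSepClosed K] {N : ℕ} {E F G : Matrix (Fin N) (Fin N) (CompletedCoeff Fq v K)}

set_option maxHeartbeats 1000000 in
theorem exists_lift_frobenius_fixed {n : ℕ} [Finite (A ⧸ v ^ (n + 1))] (hEE : E * E = E)
    (hEF : E * F = F) (hFE : F * E.map (completedMap Fq v (frob Fq A K)) = F) (hFG : F * G = E)
    {y : Fin N → (A ⊗[Fq] K) ⧸ coeffIdeal Fq v K ^ n}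
    (hy : levelMatrix Fq K v n F *ᵥ (levelFrob Fq K v n ∘ y) = y) :
    ∃ y' : Fin N → (A ⊗[Fq] K) ⧸ coeffIdeal Fq v K ^ (n + 1),
      levelMatrix Fq K v (n + 1) F *ᵥ (levelFrob Fq K v (n + 1) ∘ y') = y' ∧
      Ideal.Quotient.factorPow (coeffIdeal Fq v K) (Nat.le_succ n) ∘ y' = y := by
  have := finite_level Fq K v (n + 1)
  let π : ((A ⊗[Fq] K) ⧸ coeffIdeal Fq v K ^ (n + 1)) →ₐ[K] ((A ⊗[Fq] K) ⧸ coeffIdeal Fq v K ^ n) :=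
    Ideal.Quotient.factorₐ K (Ideal.pow_le_pow_right (Nat.le_succ n))
  have hπM : (levelMatrix Fq K v (n + 1) F).map π = levelMatrix Fq K v n F := by
    ext i j; exact factorPow_evalₐ _ n _
  have hy' : (levelMatrix Fq K v (n + 1) F).map π *ᵥ (levelFrob Fq K v n ∘ y) = y := by
    rw [hπM]; exact hy
  have hπσ : ∀ s, π (levelFrob Fq K v (n + 1) s) = levelFrob Fq K v n (π s) := by
    intro z
    obtain ⟨z, rfl⟩ := Ideal.Quotient.mk_surjective z
    rfl
  have hπs : Function.Surjective π := Ideal.Quotient.factor_surjective (Ideal.pow_le_pow_right (Nat.le_succ n))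
  have h1 : levelMatrix Fq K v (n + 1) E * levelMatrix Fq K v (n + 1) E =
      levelMatrix Fq K v (n + 1) E := by rw [← levelMatrix_mul, hEE]
  have h2 : levelMatrix Fq K v (n + 1) E * levelMatrix Fq K v (n + 1) F =
      levelMatrix Fq K v (n + 1) F := by rw [← levelMatrix_mul, hEF]
  have h3 : levelMatrix Fq K v (n + 1) F *
      (levelMatrix Fq K v (n + 1) E).map (levelFrob Fq K v (n + 1)) =
      levelMatrix Fq K v (n + 1) F := by rw [← levelMatrix_frob, ← levelMatrix_mul, hFE]
  have h4 : levelMatrix Fq K v (n + 1) F * levelMatrix Fq K v (n + 1) G =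
      levelMatrix Fq K v (n + 1) E := by rw [← levelMatrix_mul, hFG]
  obtain ⟨y', h5, h6⟩ := exists_lift_of_frobenius_fixed (levelFrob_smul (n + 1)) (levelFrob_smul n)
    (span_frobenius_fixed_level (n + 1)) π hπs hπσ h1 h2 h3 h4 hy'
  exact ⟨y', h5, h6⟩

theorem exists_frobenius_fixed_of_level (hfin : ∀ n, Finite (A ⧸ v ^ n)) (hEE : E * E = E)
    (hEF : E * F = F) (hFE : F * E.map (completedMap Fq v (frob Fq A K)) = F) (hFG : F * G = E)
    {y : Fin N → (A ⊗[Fq] K) ⧸ coeffIdeal Fq v K ^ 1}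
    (hy : levelMatrix Fq K v 1 F *ᵥ (levelFrob Fq K v 1 ∘ y) = y) :
    ∃ x : Fin N → CompletedCoeff Fq v K,
      F *ᵥ (completedMap Fq v (frob Fq A K) ∘ x) = x ∧
      AdicCompletion.evalₐ (coeffIdeal Fq v K) 1 ∘ x = y := by
  choose f hf hf' using fun (n : ℕ) (z : {z : Fin N → (A ⊗[Fq] K) ⧸ coeffIdeal Fq v K ^ (n + 1) //
    levelMatrix Fq K v (n + 1) F *ᵥ (levelFrob Fq K v (n + 1) ∘ z) = z}) =>
      have := hfin (n + 1 + 1)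
      exists_lift_frobenius_fixed hEE hEF hFE hFG z.2
  -- Y n is a fixed vector modulo v^(n+1), so that the recursion starts from the given y at level 1.
  let Y : ∀ n : ℕ, {z : Fin N → (A ⊗[Fq] K) ⧸ coeffIdeal Fq v K ^ (n + 1) //
      levelMatrix Fq K v (n + 1) F *ᵥ (levelFrob Fq K v (n + 1) ∘ z) = z} :=
    fun n => Nat.rec (motive := fun n => {z : Fin N → (A ⊗[Fq] K) ⧸ coeffIdeal Fq v K ^ (n + 1) //
      levelMatrix Fq K v (n + 1) F *ᵥ (levelFrob Fq K v (n + 1) ∘ z) = z})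
      ⟨y, hy⟩ (fun n z => ⟨f n z, hf n z⟩) n
  have hY : ∀ n, Ideal.Quotient.factorPow (coeffIdeal Fq v K) (Nat.le_succ (n + 1)) ∘ (Y (n + 1)).1 =
      (Y n).1 := fun n => hf' n (Y n)
  choose s hs using fun (i : Fin N) (n : ℕ) => Ideal.Quotient.mk_surjective ((Y n).1 i)
  have hsub : ∀ i n, s i (n + 1) - s i n ∈ coeffIdeal Fq v K ^ (n + 1) := by
    intro i n
    have h1 := congrFun (hY n) i
    rw [Function.comp_apply, ← hs, ← hs] at h1
    exact (Ideal.Quotient.eq).mp h1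
  choose x hx using fun i => exists_evalₐ_eq (coeffIdeal Fq v K) (s i) fun n =>
    Ideal.pow_le_pow_right (Nat.le_succ n) (hsub i n)
  have hx' : ∀ n, AdicCompletion.evalₐ (coeffIdeal Fq v K) (n + 1) ∘ x = (Y n).1 := by
    intro n
    ext i
    rw [Function.comp_apply, hx, ← hs, Ideal.Quotient.eq]
    exact hsub i n
  refine ⟨x, ?_, hx' 0⟩
  funext i
  apply ext_evalₐ_succ
  intro n
  have h1 := comp_mulVec (AdicCompletion.evalₐ (coeffIdeal Fq v K) (n + 1)).toRingHom F
    (completedMap Fq v (frob Fq A K) ∘ x)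
  have h2 : (AdicCompletion.evalₐ (coeffIdeal Fq v K) (n + 1)).toRingHom ∘
      (completedMap Fq v (frob Fq A K) ∘ x) = levelFrob Fq K v (n + 1) ∘ (Y n).1 := by
    rw [← hx' n]
    ext j
    exact evalₐ_completedMap_frob (n + 1) _
  rw [h2] at h1
  refine (congrFun h1 i).trans ?_
  refine (congrFun (Y n).2 i).trans ?_
  exact (congrFun (hx' n) i).symm

end Lift

/-! ### Bases of fixed vectors over A_{v,K} -/

section FrobeniusBasis

variable {Fq A K : Type*} [Field Fq] [CommRing A] [Algebra Fq A] [Field K] [Algebra Fq K]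
  [Fintype Fq] [IsSepClosed K] {v : Ideal A} {N : ℕ}

attribute [local instance] Algebra.TensorProduct.rightAlgebra

/-- An idempotent matrix congruent to zero modulo an ideal of definition vanishes. -/
theorem eq_zero_of_idempotent_of_evalₐ_one {R : Type*} [CommRing R] (I : Ideal R)
    {n : Type*} [Fintype n] [DecidableEq n] {U : Matrix n n (AdicCompletion I R)} (hU : U * U = U)
    (h : U.map (AdicCompletion.evalₐ I 1) = 0) : U = 0 := by
  -- 1 - U reduces to the identity, so is invertible, while (1 - U) U = 0.
  have h1 : IsUnit (1 - U).det := by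
    apply isUnit_of_isUnit_evalₐ_one I
    have h2 : AdicCompletion.evalₐ I 1 (1 - U).det = 1 := by
      rw [AlgHom.map_det, AlgHom.mapMatrix_apply, Matrix.map_sub _ (map_sub _), h]
      simp
    rw [h2]
    exact isUnit_one
  have h2 := (Matrix.isUnit_iff_isUnit_det _).mpr h1
  have h3 : (1 - U) * U = 0 := by rw [Matrix.sub_mul, hU, Matrix.one_mul, sub_self]
  exact (h2.mul_right_eq_zero).mp h3

theorem exists_frobenius_basis_level_one [v.IsMaximal] [Finite (A ⧸ v)]
    {E F G : Matrix (Fin N) (Fin N) ((A ⊗[Fq] K) ⧸ coeffIdeal Fq v K ^ 1)} (hEE : E * E = E)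
    (hEF : E * F = F) (hFE : F * E.map (levelFrob Fq K v 1) = F) (hFG : F * G = E) :
    ∃ (m : ℕ) (B : Matrix (Fin N) (Fin m) ((A ⊗[Fq] K) ⧸ coeffIdeal Fq v K ^ 1))
      (C : Matrix (Fin m) (Fin N) ((A ⊗[Fq] K) ⧸ coeffIdeal Fq v K ^ 1)),
      C * B = 1 ∧ B * C = E ∧ F * B.map (levelFrob Fq K v 1) = B := by
  let : Field (A ⧸ v) := Ideal.Quotient.field v
  have hle : ∀ a ∈ v, algebraMap A ((A ⊗[Fq] K) ⧸ coeffIdeal Fq v K ^ 1) a = 0 := by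
    intro a ha
    refine Ideal.Quotient.eq_zero_iff_mem.mpr ?_
    rw [pow_one]
    exact Ideal.mem_map_of_mem _ ha
  let : Algebra (A ⧸ v) ((A ⊗[Fq] K) ⧸ coeffIdeal Fq v K ^ 1) :=
    (Ideal.Quotient.lift v (algebraMap A _) hle).toAlgebra
  have hmap : ∀ a : A, algebraMap (A ⧸ v) ((A ⊗[Fq] K) ⧸ coeffIdeal Fq v K ^ 1)
      (Ideal.Quotient.mk v a) = algebraMap A _ a := fun a => rfl
  have : IsScalarTower Fq (A ⧸ v) ((A ⊗[Fq] K) ⧸ coeffIdeal Fq v K ^ 1) :=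
    IsScalarTower.of_algebraMap_eq fun c => by
      rw [IsScalarTower.algebraMap_apply Fq A (A ⧸ v), IsScalarTower.algebraMap_apply Fq A
        ((A ⊗[Fq] K) ⧸ coeffIdeal Fq v K ^ 1)]
      exact (hmap _).symm
  have hfin : Finite (A ⧸ v ^ 1) := by rw [pow_one]; infer_instance
  have := finite_level Fq K v 1
  have hσk : ∀ a : A ⧸ v, levelFrob Fq K v 1 (algebraMap (A ⧸ v) _ a) = algebraMap (A ⧸ v) _ a := by
    intro a
    obtain ⟨a, rfl⟩ := Ideal.Quotient.mk_surjective a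
    rw [hmap]
    exact levelFrob_algebraMap 1 a
  have hspan : Submodule.span K (Set.range (algebraMap (A ⧸ v)
      ((A ⊗[Fq] K) ⧸ coeffIdeal Fq v K ^ 1))) = ⊤ := by
    rw [eq_top_iff, ← span_algebraMap_level 1]
    refine Submodule.span_mono ?_
    rintro _ ⟨a, rfl⟩
    exact ⟨Ideal.Quotient.mk v a, hmap a⟩
  exact exists_frobenius_basis_of_field (A ⧸ v) (levelFrob_smul 1) hσk hspan hEE hEF hFE hFG

/-- An étale Frobenius module over `A_{v,K}` with `K` separably closed has a basis of fixed
vectors. -/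
theorem exists_frobenius_basis [v.IsMaximal] (hfin : ∀ n, Finite (A ⧸ v ^ n))
    {E F G : Matrix (Fin N) (Fin N) (CompletedCoeff Fq v K)} (hEE : E * E = E)
    (hEF : E * F = F) (hFE : F * E.map (completedMap Fq v (frob Fq A K)) = F) (hFG : F * G = E) :
    ∃ (m : ℕ) (B : Matrix (Fin N) (Fin m) (CompletedCoeff Fq v K))
      (C : Matrix (Fin m) (Fin N) (CompletedCoeff Fq v K)),
      C * B = 1 ∧ B * C = E ∧ F * B.map (completedMap Fq v (frob Fq A K)) = B := by
  have : Finite (A ⧸ v) := by have := hfin 1; rwa [pow_one] at this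
  obtain ⟨m, B₁, C₁, hCB₁, hBC₁, hFB₁⟩ := exists_frobenius_basis_level_one (Fq := Fq) (K := K)
    (v := v) (E := levelMatrix Fq K v 1 E) (F := levelMatrix Fq K v 1 F)
    (G := levelMatrix Fq K v 1 G) (by rw [← levelMatrix_mul, hEE]) (by rw [← levelMatrix_mul, hEF])
    (by rw [← levelMatrix_frob, ← levelMatrix_mul, hFE]) (by rw [← levelMatrix_mul, hFG])
  have hcol : ∀ j, levelMatrix Fq K v 1 F *ᵥ (levelFrob Fq K v 1 ∘ fun i => B₁ i j) =
      fun i => B₁ i j := fun j => funext fun i => congrFun (congrFun hFB₁ i) j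
  choose x hx hx' using fun j => exists_frobenius_fixed_of_level hfin hEE hEF hFE hFG (hcol j)
  let B : Matrix (Fin N) (Fin m) (CompletedCoeff Fq v K) := Matrix.of fun i j => x j i
  have hFB : F * B.map (completedMap Fq v (frob Fq A K)) = B := by
    ext1 i j
    exact congrFun (hx j) i
  have hB : levelMatrix Fq K v 1 B = B₁ := by
    ext1 i j
    exact congrFun (hx' j) i
  choose C' hC' using fun i j =>
    AdicCompletion.surjective_evalₐ (coeffIdeal Fq v K) 1 (C₁ i j)
  have hC : levelMatrix Fq K v 1 (Matrix.of C') = C₁ := by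
    ext1 i j
    exact hC' i j
  have hEB : E * B = B := by
    rw [← hFB, ← Matrix.mul_assoc, hEF]
  have h1 : levelMatrix Fq K v 1 (Matrix.of C' * B) = 1 := by
    rw [levelMatrix_mul, hC, hB, hCB₁]
  have hdet : IsUnit (Matrix.of C' * B).det := by
    apply isUnit_of_isUnit_evalₐ_one (coeffIdeal Fq v K)
    have h2 : AdicCompletion.evalₐ (coeffIdeal Fq v K) 1 (Matrix.of C' * B).det =
        (levelMatrix Fq K v 1 (Matrix.of C' * B)).det := AlgHom.map_det _ _
    rw [h2, h1, Matrix.det_one]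
    exact isUnit_one
  have h3 : (Matrix.of C' * B)⁻¹ * (Matrix.of C' * B) = 1 := Matrix.nonsing_inv_mul _ hdet
  have h4 : levelMatrix Fq K v 1 (Matrix.of C' * B)⁻¹ = 1 := by
    have h5 := congrArg (levelMatrix Fq K v 1) h3
    rw [levelMatrix_mul, h1, Matrix.mul_one] at h5
    rw [h5]
    exact Matrix.map_one _ (map_zero _) (map_one _)
  -- An arbitrary lift C' of C₁ is normalised so that C B = 1 and C E = C. Then E - B C is
  -- idempotent and vanishes modulo v, hence is zero.
  let C := (Matrix.of C' * B)⁻¹ * (Matrix.of C' * E)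
  have hCB : C * B = 1 := by
    change (Matrix.of C' * B)⁻¹ * (Matrix.of C' * E) * B = 1
    rw [Matrix.mul_assoc, Matrix.mul_assoc, hEB, h3]
  refine ⟨m, B, C, hCB, ?_, hFB⟩
  have hEC : C * E = C := by
    change (Matrix.of C' * B)⁻¹ * (Matrix.of C' * E) * E = (Matrix.of C' * B)⁻¹ * (Matrix.of C' * E)
    rw [Matrix.mul_assoc, Matrix.mul_assoc, hEE]
  have hC1 : levelMatrix Fq K v 1 C = C₁ := by
    change levelMatrix Fq K v 1 ((Matrix.of C' * B)⁻¹ * (Matrix.of C' * E)) = C₁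
    rw [levelMatrix_mul, levelMatrix_mul, h4, hC, Matrix.one_mul, ← hBC₁, ← Matrix.mul_assoc, hCB₁,
      Matrix.one_mul]
  have hU : E - B * C = 0 := by
    apply eq_zero_of_idempotent_of_evalₐ_one (coeffIdeal Fq v K)
    · rw [Matrix.sub_mul, Matrix.mul_sub, Matrix.mul_sub, hEE, ← Matrix.mul_assoc E B C, hEB,
        Matrix.mul_assoc B C E, hEC, Matrix.mul_assoc B C (B * C), ← Matrix.mul_assoc C B C, hCB,
        Matrix.one_mul, sub_self, sub_zero]
    · have h6 : levelMatrix Fq K v 1 (E - B * C) =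
          levelMatrix Fq K v 1 E - levelMatrix Fq K v 1 (B * C) := Matrix.map_sub _ (map_sub _) _ _
      refine h6.trans ?_
      rw [levelMatrix_mul, hB, hC1, hBC₁, sub_self]
  exact (sub_eq_zero.mp hU).symm

end FrobeniusBasis

/-! ### Local bases of projective modules and rank -/

section LocalFactorization

variable {R M : Type*} [CommRing R] [AddCommGroup M] [Module R M]

/-- A finite projective module of rank `r` at `p`, written as the image of an idempotent matrix,
becomes over `R_p` the image of a split injection from `R_p^r`. -/
theorem exists_factorization_atPrime [Module.Finite R M] [Module.Projective R M] {N r : ℕ}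
    (i : M →ₗ[R] Fin N → R) (π : (Fin N → R) →ₗ[R] M) (h : π ∘ₗ i = LinearMap.id)
    (p : PrimeSpectrum R) (hr : Module.rankAtStalk M p = r) :
    ∃ (P : Matrix (Fin N) (Fin r) (Localization.AtPrime p.asIdeal))
      (Q : Matrix (Fin r) (Fin N) (Localization.AtPrime p.asIdeal)),
      Q * P = 1 ∧ P * Q = (LinearMap.toMatrix' (i ∘ₗ π)).map (algebraMap R _) ∧
      ∃ ψ : M →ₗ[R] Fin r → Localization.AtPrime p.asIdeal,
        IsLocalizedModule p.asIdeal.primeCompl ψ ∧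
        ∀ m, ψ m = Q *ᵥ (algebraMap R (Localization.AtPrime p.asIdeal) ∘ i m) := by
  let O := Localization.AtPrime p.asIdeal
  let S := p.asIdeal.primeCompl
  let l := LocalizedModule.mkLinearMap S M
  let g : (Fin N → R) →ₗ[R] (Fin N → O) := LinearMap.pi fun i => Algebra.linearMap R O ∘ₗ .proj i
  have : IsLocalizedModule S g := inferInstance
  let i' := IsLocalizedModule.mapExtendScalars S l g O i
  let π' := IsLocalizedModule.mapExtendScalars S g l O π
  have hi : ∀ m, i' (l m) = g (i m) := fun m => IsLocalizedModule.map_apply S l g i m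
  have hπ : ∀ m, π' (g m) = l (π m) := fun m => IsLocalizedModule.map_apply S g l π m
  have hπi : π' ∘ₗ i' = LinearMap.id := by
    apply LinearMap.restrictScalars_injective R
    refine IsLocalizedModule.ext S l (IsLocalizedModule.map_units l) ?_
    ext m
    change π' (i' (l m)) = l m
    rw [hi, hπ]
    exact congrArg l (LinearMap.congr_fun h m)
  have : Module.Free O (LocalizedModule S M) := Module.free_of_flat_of_isLocalRing
  let b : Module.Basis (Fin r) O (LocalizedModule S M) := Module.finBasisOfFinrankEq _ _ hr
  refine ⟨LinearMap.toMatrix' (i' ∘ₗ b.equivFun.symm.toLinearMap),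
    LinearMap.toMatrix' (b.equivFun.toLinearMap ∘ₗ π'), ?_, ?_,
    (b.equivFun.restrictScalars R).toLinearMap ∘ₗ l, inferInstance, ?_⟩
  · rw [← LinearMap.toMatrix'_comp]
    have : (b.equivFun.toLinearMap ∘ₗ π') ∘ₗ i' ∘ₗ b.equivFun.symm.toLinearMap = LinearMap.id := by
      refine LinearMap.ext fun x => ?_
      change b.equivFun ((π' ∘ₗ i') (b.equivFun.symm x)) = x
      rw [hπi]
      exact b.equivFun.apply_symm_apply x
    rw [this, LinearMap.toMatrix'_id]
  · rw [← LinearMap.toMatrix'_comp]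
    ext j k
    rw [LinearMap.toMatrix'_apply, Matrix.map_apply, LinearMap.toMatrix'_apply]
    change i' (b.equivFun.symm (b.equivFun (π' _))) j = _
    rw [LinearEquiv.symm_apply_apply]
    have hg : (Pi.single k 1 : Fin N → O) = g (Pi.single k 1) := by
      ext a
      simp [g, Pi.single_apply]
    rw [hg, hπ, hi]
    rfl
  · intro m
    rw [← Matrix.toLin'_apply, Matrix.toLin'_toMatrix']
    change b.equivFun (l m) = b.equivFun (π' (g (i m)))
    rw [hπ]
    exact congrArg (fun x => b.equivFun (l x)) (LinearMap.congr_fun h m).symm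

/-- Over a residue field of T the same idempotent factors through free modules of rank m and of rank
r. The products C P and Q B are then mutually inverse. -/
theorem card_eq_of_factorization [Module.Finite R M] [Module.Projective R M] {N r : ℕ}
    (i : M →ₗ[R] Fin N → R) (π : (Fin N → R) →ₗ[R] M) (h : π ∘ₗ i = LinearMap.id)
    (hr : ∀ p : PrimeSpectrum R, Module.rankAtStalk M p = r) {T : Type*} [CommRing T] [Nontrivial T] (f : R →+* T)
    {m : ℕ} {B : Matrix (Fin N) (Fin m) T} {C : Matrix (Fin m) (Fin N) T} (hCB : C * B = 1)
    (hBC : B * C = (LinearMap.toMatrix' (i ∘ₗ π)).map f) : m = r := by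
  obtain ⟨I, hI⟩ := Ideal.exists_maximal T
  let g : T →+* T ⧸ I := Ideal.Quotient.mk I
  let _ : Field (T ⧸ I) := Ideal.Quotient.field I
  let p : PrimeSpectrum R := ⟨RingHom.ker (g.comp f), RingHom.ker_isPrime _⟩
  have : p.asIdeal.IsPrime := p.2
  obtain ⟨P, Q, hQP, hPQ, -⟩ := exists_factorization_atPrime i π h p (hr p)
  have hu : ∀ y : p.asIdeal.primeCompl, IsUnit ((g.comp f) y) := fun y =>
    isUnit_iff_ne_zero.mpr fun h => y.2 h
  let e : Localization.AtPrime p.asIdeal →+* T ⧸ I := IsLocalization.lift hu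
  have he : ∀ x, e (algebraMap R _ x) = g (f x) := fun x => IsLocalization.lift_eq hu x
  have hE : P.map e * Q.map e = B.map g * C.map g := by
    rw [← Matrix.map_mul, ← Matrix.map_mul, hPQ, hBC]
    ext j k
    exact he _
  have hCB' : C.map g * B.map g = 1 := by
    rw [← Matrix.map_mul, hCB]; exact Matrix.map_one _ (map_zero _) (map_one _)
  have hQP' : Q.map e * P.map e = 1 := by
    rw [← Matrix.map_mul, hQP]; exact Matrix.map_one _ (map_zero _) (map_one _)
  generalize P.map e = P' at *
  generalize Q.map e = Q' at *
  generalize B.map g = B' at *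
  generalize C.map g = C' at *
  have h1 : (C' * P') * (Q' * B') = 1 := by
    rw [Matrix.mul_assoc, ← Matrix.mul_assoc P', hE, Matrix.mul_assoc B', hCB', Matrix.mul_one, hCB']
  have h2 : (Q' * B') * (C' * P') = 1 := by
    rw [Matrix.mul_assoc, ← Matrix.mul_assoc B', ← hE, Matrix.mul_assoc P', hQP', Matrix.mul_one,
      hQP']
  simpa using Matrix.square_of_invertible _ _ h1 h2

end LocalFactorization

/-! ### Discrete valuation rings, Smith form and cokernel lengths -/

section DiscreteValuation

variable {O : Type*} [CommRing O]

/-- A noetherian local ring whose maximal ideal is generated by a nonzerodivisor is a discrete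
valuation ring. -/
theorem isDiscreteValuationRing_of_maximalIdeal_eq_span [IsLocalRing O] [IsNoetherianRing O]
    {s : O} (hs : s ∈ O⁰) (h : IsLocalRing.maximalIdeal O = Ideal.span {s}) :
    ∃ _ : IsDomain O, IsDiscreteValuationRing O ∧ Irreducible s := by
  have hsm : s ∈ IsLocalRing.maximalIdeal O := h ▸ Ideal.mem_span_singleton_self s
  -- Krull's intersection theorem bounds the powers of s dividing a nonzero x.
  have hfac : ∀ x : O, x ≠ 0 → ∃ (n : ℕ) (u : O), IsUnit u ∧ x = s ^ n * u := by
    intro x hx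
    by_contra! hc
    have hall : ∀ n, ∃ y, x = s ^ n * y := by
      intro n
      induction n with
      | zero => exact ⟨x, by simp⟩
      | succ n ih =>
        obtain ⟨y, hy⟩ := ih
        have hyu : ¬ IsUnit y := fun hu => hc n y hu hy
        have : y ∈ Ideal.span {s} := h ▸ (IsLocalRing.mem_maximalIdeal y).mpr hyu
        obtain ⟨z, rfl⟩ := Ideal.mem_span_singleton'.mp this
        exact ⟨z, by rw [hy]; ring⟩
    refine hx ?_
    have h1 : x ∈ (⨅ i : ℕ, IsLocalRing.maximalIdeal O ^ i : Ideal O) := by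
      rw [Ideal.mem_iInf]
      intro i
      obtain ⟨y, hy⟩ := hall i
      rw [hy]
      exact Ideal.mul_mem_right _ _ (Ideal.pow_mem_pow hsm i)
    rwa [Ideal.iInf_pow_eq_bot_of_isLocalRing _ (IsLocalRing.maximalIdeal.isMaximal O).ne_top,
      Ideal.mem_bot] at h1
  have hdom : IsDomain O := by
    have : NoZeroDivisors O := ⟨by
      intro a b hab
      by_contra! hc
      obtain ⟨n, u, hu, rfl⟩ := hfac a hc.1
      obtain ⟨m, w, hw, rfl⟩ := hfac b hc.2
      have h2 : u * w * s ^ (n + m) = 0 := by rw [← hab]; ring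
      have h3 := (mem_nonZeroDivisors_iff_right.mp (pow_mem hs (n + m))) _ h2
      exact (hu.mul hw).ne_zero h3⟩
    exact NoZeroDivisors.to_isDomain O
  have hs0 : s ≠ 0 := nonZeroDivisors.ne_zero hs
  have hirr : Irreducible s := by
    have hp : Prime s := by
      rw [← Ideal.span_singleton_prime hs0, ← h]
      infer_instance
    exact hp.irreducible
  refine ⟨hdom, IsDiscreteValuationRing.ofHasUnitMulPowIrreducibleFactorization
    ⟨s, hirr, fun {x} hx => ?_⟩, hirr⟩
  obtain ⟨n, u, hu, rfl⟩ := hfac x hx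
  exact ⟨n, associated_mul_unit_right _ _ hu⟩

/-- Smith normal form of a square matrix with nonzero determinant over a principal ideal domain. -/
theorem exists_smith_factorization [IsDomain O] [IsPrincipalIdealRing O] {r : ℕ}
    (X : Matrix (Fin r) (Fin r) O) (hX : X.det ≠ 0) :
    ∃ (U U' W W' : Matrix (Fin r) (Fin r) O) (a : Fin r → O), U * U' = 1 ∧ U' * U = 1 ∧
      W * W' = 1 ∧ W' * W = 1 ∧ X = U * Matrix.diagonal a * W := by
  have hinj : Function.Injective X.mulVecLin := by
    rw [← LinearMap.ker_eq_bot, LinearMap.ker_eq_bot']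
    intro v hv
    by_contra hv0
    exact hX (Matrix.exists_mulVec_eq_zero_iff.mp ⟨v, hv0, hv⟩)
  let e := LinearEquiv.ofInjective X.mulVecLin hinj
  obtain ⟨b, a, b', hb⟩ := Submodule.exists_smith_normal_form_of_rank_eq
    (N := LinearMap.range X.mulVecLin) (Pi.basisFun O (Fin r)) e.finrank_eq.symm
  have h1 : ∀ y, X.mulVecLin y = b.equivFun.symm (Matrix.diagonal a *ᵥ
      (b'.equivFun (e y))) := by
    intro y
    have h2 : (e y : Fin r → O) = X.mulVecLin y := rfl
    rw [← h2]
    conv_lhs => rw [← b'.sum_equivFun (e y)]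
    rw [Module.Basis.equivFun_symm_apply]
    simp only [AddSubmonoidClass.coe_finsetSum, Submodule.coe_smul, hb, Matrix.mulVec_diagonal,
      smul_smul]
    refine Finset.sum_congr rfl fun i _ => ?_
    rw [mul_comm]
  have hid : ∀ g g' : (Fin r → O) →ₗ[O] (Fin r → O), (∀ y, g (g' y) = y) →
      LinearMap.toMatrix' g * LinearMap.toMatrix' g' = 1 := by
    intro g g' h
    rw [← LinearMap.toMatrix'_comp, show g ∘ₗ g' = LinearMap.id from LinearMap.ext h,
      LinearMap.toMatrix'_id]
  let w := e.trans b'.equivFun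
  refine ⟨LinearMap.toMatrix' b.equivFun.symm.toLinearMap, LinearMap.toMatrix' b.equivFun.toLinearMap,
    LinearMap.toMatrix' w.toLinearMap, LinearMap.toMatrix' w.symm.toLinearMap, a,
    hid _ _ fun y => b.equivFun.symm_apply_apply y, hid _ _ fun y => b.equivFun.apply_symm_apply y,
    hid _ _ fun y => w.apply_symm_apply y, hid _ _ fun y => w.symm_apply_apply y, ?_⟩
  have h3 : X.mulVecLin = b.equivFun.symm.toLinearMap ∘ₗ (Matrix.diagonal a).mulVecLin ∘ₗ
      w.toLinearMap := LinearMap.ext h1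
  have h4 := congrArg LinearMap.toMatrix' h3
  rw [LinearMap.toMatrix'_comp, LinearMap.toMatrix'_comp] at h4
  rw [Matrix.mul_assoc]
  refine Eq.trans ?_ (h4.trans ?_)
  · exact (LinearMap.toMatrix'_toLin' X).symm
  · congr 2
    exact LinearMap.toMatrix'_toLin' _

theorem length_quotient_range_diagonal {r : ℕ} (a : Fin r → O) :
    Module.length O ((Fin r → O) ⧸ LinearMap.range (Matrix.diagonal a).mulVecLin) =
      ∑ i, Module.length O (O ⧸ Ideal.span {a i}) := by
  have h : LinearMap.range (Matrix.diagonal a).mulVecLin =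
      Submodule.pi Set.univ fun i => Ideal.span {a i} := by
    ext y
    simp only [LinearMap.mem_range, Matrix.mulVecLin_apply, Submodule.mem_pi, Set.mem_univ,
      true_imp_iff, Ideal.mem_span_singleton']
    constructor
    · rintro ⟨x, rfl⟩ i
      exact ⟨x i, by rw [Matrix.mulVec_diagonal, mul_comm]⟩
    · intro h
      choose x hx using h
      exact ⟨x, funext fun i => by rw [Matrix.mulVec_diagonal, mul_comm, hx]⟩
  rw [h, (Submodule.quotientPi fun i => (Ideal.span {a i} : Submodule O O)).length_eq,
    Module.length_pi_of_fintype]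

theorem length_quotient_range_mul {r : ℕ} {U U' W W' : Matrix (Fin r) (Fin r) O} (hU : U * U' = 1)
    (hU' : U' * U = 1) (hW : W * W' = 1) (Z : Matrix (Fin r) (Fin r) O) :
    Module.length O ((Fin r → O) ⧸ LinearMap.range (U * Z * W).mulVecLin) =
      Module.length O ((Fin r → O) ⧸ LinearMap.range Z.mulVecLin) := by
  let e : (Fin r → O) ≃ₗ[O] (Fin r → O) := LinearEquiv.ofLinearMap U.mulVecLin U'.mulVecLin
    (by rw [← Matrix.mulVecLin_mul, hU, Matrix.mulVecLin_one])
    (by rw [← Matrix.mulVecLin_mul, hU', Matrix.mulVecLin_one])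
  refine (Submodule.Quotient.equiv _ _ e ?_).symm.length_eq
  have hWs : LinearMap.range W.mulVecLin = ⊤ := LinearMap.range_eq_top.mpr fun y =>
    ⟨W' *ᵥ y, by simp [hW]⟩
  rw [Matrix.mulVecLin_mul, LinearMap.range_comp, hWs, Submodule.map_top, Matrix.mulVecLin_mul,
    LinearMap.range_comp]
  rfl

end DiscreteValuation

/-! ### Logarithmic derivatives over a discrete valuation ring -/

section Derivations

variable {k O : Type*} [CommRing k] [CommRing O] [Algebra k O] (D : Derivation k O O)

theorem Derivation.map_matrix_mul {l m n : Type*} [Fintype m] (X : Matrix l m O)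
    (Y : Matrix m n O) : (X * Y).map D = X.map D * Y + X * Y.map D := by
  ext i j
  simp only [Matrix.map_apply, Matrix.mul_apply, map_sum, Derivation.leibniz, smul_eq_mul,
    Matrix.add_apply, ← Finset.sum_add_distrib]
  refine Finset.sum_congr rfl fun x _ => ?_
  ring

/-- If `XY = YX = s^k` and the length of the cokernel of `X` vanishes in the ring, then `s^k`
divides `tr (Y DX)`. -/
theorem pow_dvd_trace_derivation [IsDomain O] [IsDiscreteValuationRing O] {s : O}
    (hs : Irreducible s) {r k ν : ℕ} {X Y : Matrix (Fin r) (Fin r) O}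
    (hXY : X * Y = s ^ k • (1 : Matrix (Fin r) (Fin r) O))
    (hYX : Y * X = s ^ k • (1 : Matrix (Fin r) (Fin r) O))
    (hν : Module.length O ((Fin r → O) ⧸ LinearMap.range X.mulVecLin) = ν) (hν0 : (ν : O) = 0) :
    s ^ k ∣ (Y * X.map D).trace := by
  have hX : X.det ≠ 0 := by
    intro h
    have h1 := congrArg Matrix.det hXY
    rw [Matrix.det_mul, h, zero_mul, Matrix.det_smul, Matrix.det_one, mul_one] at h1
    exact pow_ne_zero _ (pow_ne_zero _ hs.ne_zero) h1.symm
  obtain ⟨U, U', W, W', a, hU, hU', hW, hW', rfl⟩ := exists_smith_factorization X hX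
  have ha : ∀ i, a i ≠ 0 := by
    intro i hi
    apply hX
    rw [Matrix.det_mul, Matrix.det_mul, Matrix.det_diagonal,
      Finset.prod_eq_zero (Finset.mem_univ i) hi, mul_zero, zero_mul]
  choose n u hu using fun i => IsDiscreteValuationRing.eq_unit_mul_pow_irreducible (ha i) hs
  have hn : ∑ i, n i = ν := by
    rw [length_quotient_range_mul hU hU' hW, length_quotient_range_diagonal] at hν
    have h1 : ∀ i, Module.length O (O ⧸ Ideal.span {a i}) = n i := by
      intro i
      rw [← IsDiscreteValuationRing.length_quotient_pow_maximalIdeal (R := O) (n i),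
        hs.maximalIdeal_eq, Ideal.span_singleton_pow, hu, Ideal.span_singleton_mul_left_unit
        (u i).isUnit]
    simp only [h1] at hν
    exact_mod_cast hν
  let Z := W * Y * U
  have hZ : Z * Matrix.diagonal a = s ^ k • (1 : Matrix (Fin r) (Fin r) O) := by
    have h1 : W * (Y * (U * Matrix.diagonal a * W)) * W' =
        s ^ k • (1 : Matrix (Fin r) (Fin r) O) := by
      rw [hYX, Matrix.mul_smul, Matrix.mul_one, Matrix.smul_mul, hW]
    rw [← h1]
    simp only [Z, Matrix.mul_assoc, hW, Matrix.mul_one]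
  have hZi : ∀ i, Z i i * a i = s ^ k := by
    intro i
    have := congrFun (congrFun hZ i) i
    simpa [Matrix.mul_diagonal] using this
  -- By cyclicity of the trace and X Y = Y X = s^k, the derivatives of U and W contribute only
  -- multiples of s^k.
  have hexp : (Y * (U * Matrix.diagonal a * W).map D).trace =
      s ^ k * (U.map D * U').trace + ∑ i, Z i i * D (a i) + s ^ k * (W' * W.map D).trace := by
    rw [D.map_matrix_mul, D.map_matrix_mul, Matrix.add_mul, Matrix.mul_add, Matrix.mul_add,
      Matrix.trace_add, Matrix.trace_add]
    congr 1
    · congr 1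
      · have h1 : U.map D * Matrix.diagonal a * W * Y =
            U.map D * (U' * (U * Matrix.diagonal a * W * Y)) := by
          simp only [← Matrix.mul_assoc]
          rw [Matrix.mul_assoc (U.map D) U' U, hU', Matrix.mul_one]
        rw [Matrix.trace_mul_comm, h1, hXY, Matrix.mul_smul, Matrix.mul_smul, Matrix.mul_one,
          Matrix.trace_smul, smul_eq_mul]
      · have h1 : (Z * (Matrix.diagonal a).map D).trace = ∑ i, Z i i * D (a i) := by
          rw [Matrix.diagonal_map (map_zero D)]
          simp [Matrix.trace, Matrix.mul_diagonal]
        have h2 : Y * (U * (Matrix.diagonal a).map D * W) =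
            Y * U * (Matrix.diagonal a).map D * W := by simp only [Matrix.mul_assoc]
        rw [← h1, h2, Matrix.trace_mul_comm]
        simp only [Z, Matrix.mul_assoc]
    · have h1 : Y * (U * Matrix.diagonal a * W.map D) =
          Y * (U * Matrix.diagonal a * W) * (W' * W.map D) := by
        simp only [Matrix.mul_assoc]
        rw [← Matrix.mul_assoc W W', hW, Matrix.one_mul]
      rw [h1, hYX, Matrix.smul_mul, Matrix.one_mul, Matrix.trace_smul, smul_eq_mul]
  rw [hexp]
  refine dvd_add (dvd_add (dvd_mul_right _ _) ?_) (dvd_mul_right _ _)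
  -- Formally, Z_ii a_i = s^k and a_i = u s^n give Z_ii D a_i = s^k (Du/u + n Ds/s). The factor s
  -- removes the denominator; after summation the last term has coefficient Σ n_i = ν, which is zero
  -- in O.
  have hterm : ∀ i, s * (Z i i * D (a i)) =
      s ^ k * (s * (↑(u i)⁻¹ * D (u i : O))) + (n i : O) * (s ^ k * D s) := by
    intro i
    have h1 := hZi i
    have h2 : (u i : O) * ↑(u i)⁻¹ = 1 := (u i).mul_inv
    rw [hu] at h1 ⊢
    rw [Derivation.leibniz, Derivation.leibniz_pow]
    simp only [smul_eq_mul, nsmul_eq_mul]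
    rw [← h1]
    rcases Nat.eq_zero_or_pos (n i) with h0 | h0
    · rw [h0]
      simp only [pow_zero, Nat.cast_zero]
      linear_combination (-(s * Z i i * D (u i : O))) * h2
    · obtain ⟨m, hm⟩ := Nat.exists_eq_succ_of_ne_zero h0.ne'
      rw [hm, Nat.succ_sub_one, Nat.succ_eq_add_one]
      linear_combination (-(s * Z i i * s ^ (m + 1) * D (u i : O))) * h2
  have hsum : s * ∑ i, Z i i * D (a i) = s * (s ^ k * ∑ i, ↑(u i)⁻¹ * D (u i : O)) := by
    rw [Finset.mul_sum, Finset.sum_congr rfl fun i _ => hterm i, Finset.sum_add_distrib,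
      ← Finset.sum_mul, ← Nat.cast_sum, hn, hν0, zero_mul, add_zero, Finset.mul_sum,
      Finset.mul_sum]
    refine Finset.sum_congr rfl fun i _ => ?_
    ring
  rw [mul_left_cancel₀ hs.ne_zero hsum]
  exact dvd_mul_right _ _

end Derivations

/-! ### L-dimensions as lengths at J -/

section LocalLength

/-- An element outside the maximal ideal J is invertible modulo J^j, so it already acts bijectively
on N. -/
theorem isLocalizedModule_id_of_pow_torsion {R : Type*} [CommRing R] (J : Ideal R) [J.IsMaximal]
    {N : Type*} [AddCommGroup N] [Module R N] {j : ℕ}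
    (hN : ∀ a ∈ J ^ j, ∀ n : N, a • n = 0) :
    IsLocalizedModule J.primeCompl (LinearMap.id : N →ₗ[R] N) where
  map_units t := by
    obtain ⟨c, z, hz, h⟩ := Ideal.IsMaximal.exists_inv_pow J t.2 j
    have h2 : ∀ n : N, (c * (t : R)) • n = n := by
      intro n
      conv_rhs => rw [← one_smul R n, ← h, add_smul, hN z hz, add_zero]
    refine (Module.End.isUnit_iff _).mpr ⟨fun a b hab => ?_, fun a => ⟨c • a, ?_⟩⟩
    · change (t : R) • a = (t : R) • b at hab
      rw [← h2 a, ← h2 b, mul_smul, mul_smul, hab]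
    · change (t : R) • c • a = a
      rw [smul_smul, mul_comm, h2]
  surj m := ⟨(m, 1), one_smul _ _⟩
  exists_of_eq h := ⟨1, by simpa using h⟩

variable {L R : Type*} [Field L] [CommRing R] [Algebra L R] (J : Ideal R) [J.IsMaximal]

/-- By `hJ` the residue field at J is L, so a simple module over the local ring has length 1 over L.
-/
theorem length_restrictScalars_atPrime (hJ : ∀ x : R, ∃ l : L, x - algebraMap L R l ∈ J)
    (N : Type*) [AddCommGroup N] [Module L N] [Module (Localization.AtPrime J) N]
    [IsScalarTower L (Localization.AtPrime J) N] :
    Module.length L N = Module.length (Localization.AtPrime J) N := by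
  have hloc : IsLocalHom (algebraMap L (Localization.AtPrime J)) := inferInstance
  have h1 : Module.length (IsLocalRing.ResidueField L)
      (IsLocalRing.ResidueField (Localization.AtPrime J)) = 1 := by
    have hs : Function.Surjective (algebraMap (IsLocalRing.ResidueField L)
        (IsLocalRing.ResidueField (Localization.AtPrime J))) := by
      intro z
      obtain ⟨x, rfl⟩ := J.algebraMap_residueField_surjective z
      obtain ⟨l, hl⟩ := hJ x
      refine ⟨IsLocalRing.residue L l, ?_⟩
      have h2 : algebraMap R (J.ResidueField) (x - algebraMap L R l) = 0 := by
        rwa [Ideal.algebraMap_residueField_eq_zero]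
      rw [map_sub, sub_eq_zero] at h2
      rw [h2]
      rfl
    rw [Module.length_eq_of_surjective hs, Module.length_eq_one]
  rw [IsLocalRing.length_restrictScalars L (Localization.AtPrime J) N, h1, mul_one]

variable (R) in
/-- The length of the localization at `J` of a module. -/
def lengthAt (J : Ideal R) [J.IsPrime] (N : Type*) [AddCommGroup N] [Module R N] : ℕ∞ :=
  Module.length (Localization.AtPrime J) (LocalizedModule J.primeCompl N)

theorem finrank_eq_lengthAt (hJ : ∀ x : R, ∃ l : L, x - algebraMap L R l ∈ J)
    {N : Type*} [AddCommGroup N] [Module R N] {j : ℕ} (hN : ∀ a ∈ J ^ j, ∀ n : N, a • n = 0) :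
    Module.finrank L (RestrictScalars L R N) = (lengthAt R J N).toNat := by
  have h1 := isLocalizedModule_id_of_pow_torsion J hN
  let e : LocalizedModule J.primeCompl N ≃ₗ[R] N := IsLocalizedModule.iso J.primeCompl LinearMap.id
  let _ : Module L (LocalizedModule J.primeCompl N) :=
    Module.compHom _ (algebraMap L (Localization.AtPrime J))
  have : IsScalarTower L (Localization.AtPrime J) (LocalizedModule J.primeCompl N) :=
    ⟨fun l x y => by rw [Algebra.smul_def, mul_smul]; rfl⟩
  let e' : RestrictScalars L R N ≃ₗ[L] LocalizedModule J.primeCompl N :=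
    { toFun := fun x => e.symm x
      invFun := fun x => e x
      map_add' := fun x y => e.symm.map_add x y
      map_smul' := fun l x => by
        refine (e.symm.map_smul (algebraMap L R l) (show N from x)).trans ?_
        rw [← algebraMap_smul (Localization.AtPrime J)]
        rfl
      left_inv := fun x => e.apply_symm_apply x
      right_inv := fun x => e.symm_apply_apply x }
  rw [e'.finrank_eq, lengthAt, ← length_restrictScalars_atPrime J hJ, Module.length_eq_rank]
  rfl

variable {M : Type*} [AddCommGroup M] [Module R M]

theorem lengthAt_eq_add_of_exact (J : Ideal R) [J.IsPrime] {N N' N'' : Type*} [AddCommGroup N]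
    [Module R N] [AddCommGroup N'] [Module R N'] [AddCommGroup N''] [Module R N'']
    (f : N →ₗ[R] N') (g : N' →ₗ[R] N'') (hf : Function.Injective f) (hg : Function.Surjective g)
    (h : Function.Exact f g) : lengthAt R J N' = lengthAt R J N + lengthAt R J N'' :=
  Module.length_eq_add_of_exact (LocalizedModule.map J.primeCompl f)
    (LocalizedModule.map J.primeCompl g) (LocalizedModule.map_injective _ f hf)
    (LocalizedModule.map_surjective _ g hg) (LocalizedModule.map_exact _ f g h)

theorem lengthAt_quotient_of_le (J : Ideal R) [J.IsPrime] {X Y : Submodule R M} (h : X ≤ Y) :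
    lengthAt R J (M ⧸ X) = lengthAt R J (Y ⧸ X.submoduleOf Y) + lengthAt R J (M ⧸ Y) := by
  refine lengthAt_eq_add_of_exact J (Submodule.mapQ _ X Y.subtype le_rfl)
    (Submodule.factor h) ?_ (Submodule.factor_surjective h) ?_
  · rw [injective_iff_map_eq_zero]
    intro z hz
    obtain ⟨z, rfl⟩ := Submodule.mkQ_surjective _ z
    exact (Submodule.Quotient.mk_eq_zero _).mpr ((Submodule.Quotient.mk_eq_zero X).mp hz)
  · intro z
    obtain ⟨m, rfl⟩ := Submodule.mkQ_surjective _ z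
    have hm : Submodule.factor h (Submodule.mkQ X m) = 0 ↔ m ∈ Y := Submodule.Quotient.mk_eq_zero Y
    rw [hm]
    constructor
    · intro hm
      exact ⟨Submodule.Quotient.mk ⟨m, hm⟩, rfl⟩
    · rintro ⟨w, hw⟩
      obtain ⟨w, rfl⟩ := Submodule.mkQ_surjective _ w
      have h1 : (w : M) - m ∈ X := (Submodule.Quotient.eq X).mp hw
      have := Y.sub_mem w.2 (h h1)
      simpa using this

/-- The length of M / (X ∩ Y) at J, computed through X and through Y, gives dim X/(X∩Y) + ℓ(M/X) =
dim Y/(X∩Y) + ℓ(M/Y). -/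
theorem finrank_sub_finrank_eq (hJ : ∀ x : R, ∃ l : L, x - algebraMap L R l ∈ J)
    {X Y : Submodule R M} {j : ℕ} (hXY : J ^ j • X ≤ Y) (hYX : J ^ j • Y ≤ X) {a b : ℕ}
    (ha : lengthAt R J (M ⧸ X) = a) (hb : lengthAt R J (M ⧸ Y) = b) :
    (Module.finrank L (RestrictScalars L R (X ⧸ (X ⊓ Y).submoduleOf X)) : ℤ) -
      Module.finrank L (RestrictScalars L R (Y ⧸ (Y ⊓ X).submoduleOf Y)) = b - a := by
  rw [inf_comm Y X]
  have htors : ∀ {X Y : Submodule R M}, J ^ j • X ≤ Y → ∀ a ∈ J ^ j,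
      ∀ n : X ⧸ (X ⊓ Y).submoduleOf X, a • n = 0 := by
    intro X Y h a ha n
    obtain ⟨n, rfl⟩ := Submodule.mkQ_surjective _ n
    rw [← map_smul, Submodule.mkQ_apply, Submodule.Quotient.mk_eq_zero]
    exact ⟨X.smul_mem a n.2, h (Submodule.smul_mem_smul ha n.2)⟩
  have h1 := lengthAt_quotient_of_le J (inf_le_left : X ⊓ Y ≤ X)
  have h2 := lengthAt_quotient_of_le J (inf_le_right : X ⊓ Y ≤ Y)
  have hle : lengthAt R J (X ⧸ (X ⊓ Y).submoduleOf X) ≤ lengthAt R J (M ⧸ Y) := by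
    have hinj : Function.Injective (Submodule.mapQ ((X ⊓ Y).submoduleOf X) Y X.subtype
        fun x hx => hx.2) := by
      rw [injective_iff_map_eq_zero]
      intro z hz
      obtain ⟨z, rfl⟩ := Submodule.mkQ_surjective _ z
      exact (Submodule.Quotient.mk_eq_zero _).mpr
        ⟨z.2, (Submodule.Quotient.mk_eq_zero Y).mp hz⟩
    exact Module.length_le_of_injective _ (LocalizedModule.map_injective J.primeCompl _ hinj)
  have hX := finrank_eq_lengthAt J hJ (htors hXY)
  have hY := finrank_eq_lengthAt J hJ (N := Y ⧸ (X ⊓ Y).submoduleOf Y) (j := j)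
    (by rw [inf_comm]; exact htors hYX)
  rw [hX, hY]
  generalize lengthAt R J (X ⧸ (X ⊓ Y).submoduleOf X) = u at *
  generalize lengthAt R J (Y ⧸ (X ⊓ Y).submoduleOf Y) = w at *
  rw [h1, ha, hb] at h2
  rw [hb] at hle
  -- Finiteness matters: `toNat` sends an infinite length to 0, and the identity could not be read
  -- off in ℤ.
  have hu : u ≠ ⊤ := ne_top_of_le_ne_top (ENat.natCast_ne_top b) hle
  lift u to ℕ using hu
  have hw : w ≠ ⊤ := by
    rintro rfl
    rw [top_add, ← Nat.cast_add] at h2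
    exact ENat.natCast_ne_top _ h2
  lift w to ℕ using hw
  have h3 : u + a = w + b := by exact_mod_cast h2
  simp only [ENat.toNat_natCast]
  omega

theorem lengthAt_quotient_eq (J : Ideal R) [J.IsPrime] {N : Type*} [AddCommGroup N] [Module R N]
    [Module (Localization.AtPrime J) N] [IsScalarTower R (Localization.AtPrime J) N]
    (ψ : M →ₗ[R] N) [IsLocalizedModule J.primeCompl ψ] (X : Submodule R M) :
    lengthAt R J (M ⧸ X) = Module.length (Localization.AtPrime J)
      (N ⧸ Submodule.span (Localization.AtPrime J) (ψ '' X)) := by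
  rw [← Submodule.localized'_eq_span (Localization.AtPrime J) J.primeCompl ψ X]
  let e := IsLocalizedModule.iso J.primeCompl
    (X.toLocalizedQuotient' (Localization.AtPrime J) J.primeCompl ψ)
  exact (e.extendScalarsOfIsLocalization J.primeCompl (Localization.AtPrime J)).length_eq

end LocalLength

/-! ### Matrices of semilinear maps on a direct summand -/

section SemilinearMatrix

variable {R M : Type*} [CommRing R] [AddCommGroup M] [Module R M] {σ : R →+* R} {N : ℕ}
  (i : M →ₗ[R] Fin N → R) (π : (Fin N → R) →ₗ[R] M)

/-- The idempotent matrix of `i ∘ π`. -/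
def idempotentMatrix : Matrix (Fin N) (Fin N) R := LinearMap.toMatrix' (i ∘ₗ π)

/-- The matrix of a semilinear endomorphism of a direct summand of `R^N`. -/
def semilinearMatrix (φ : M →ₛₗ[σ] M) : Matrix (Fin N) (Fin N) R :=
  Matrix.of fun j k => i (φ (π (Pi.single k 1))) j

theorem idempotentMatrix_mulVec (y : Fin N → R) : idempotentMatrix i π *ᵥ y = i (π y) := by
  rw [← Matrix.toLin'_apply, idempotentMatrix, Matrix.toLin'_toMatrix']
  rfl

variable {i π}

theorem idempotentMatrix_mulVec_apply (h : π ∘ₗ i = LinearMap.id)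
    (m : M) : idempotentMatrix i π *ᵥ i m = i m := by
  rw [idempotentMatrix_mulVec]
  exact congrArg i (LinearMap.congr_fun h m)

theorem idempotentMatrix_mul_self (h : π ∘ₗ i = LinearMap.id) :
    idempotentMatrix i π * idempotentMatrix i π = idempotentMatrix i π := by
  rw [idempotentMatrix, ← LinearMap.toMatrix'_comp]
  congr 1
  refine LinearMap.ext fun y => ?_
  exact congrArg i (LinearMap.congr_fun h (π y))

theorem apply_semilinear (h : π ∘ₗ i = LinearMap.id)
    (φ : M →ₛₗ[σ] M) (m : M) :
    i (φ m) = semilinearMatrix i π φ *ᵥ (σ ∘ i m) := by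
  have h1 : m = ∑ k, i m k • π (Pi.single k 1) := by
    conv_lhs => rw [← LinearMap.id_apply (R := R) m, ← h, LinearMap.comp_apply,
      pi_eq_sum_univ' (i m)]
    rw [map_sum]
    refine Finset.sum_congr rfl fun k _ => ?_
    rw [map_smul]
  ext j
  conv_lhs => rw [h1]
  simp [map_sum, Matrix.mulVec, dotProduct, semilinearMatrix, mul_comm]

theorem idempotentMatrix_mul_semilinearMatrix (h : π ∘ₗ i = LinearMap.id)
    (φ : M →ₛₗ[σ] M) :
    idempotentMatrix i π * semilinearMatrix i π φ = semilinearMatrix i π φ := by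
  ext j k
  exact congrFun (idempotentMatrix_mulVec_apply h (φ (π (Pi.single k 1)))) j

theorem semilinearMatrix_mul_idempotentMatrix (h : π ∘ₗ i = LinearMap.id)
    (φ : M →ₛₗ[σ] M) :
    semilinearMatrix i π φ * (idempotentMatrix i π).map σ = semilinearMatrix i π φ := by
  ext j k
  have h1 := congrFun (apply_semilinear h φ (π (Pi.single k 1))) j
  refine Eq.trans ?_ h1.symm
  rw [← idempotentMatrix_mulVec]
  simp [Matrix.mul_apply, Matrix.mulVec, dotProduct]

theorem smul_semilinearMatrix_eq {φ φ' : M →ₛₗ[σ] M} {f f' : R}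
    (hf : ∀ m, f' • φ m = f • φ' m) :
    f' • semilinearMatrix i π φ = f • semilinearMatrix i π φ' := by
  ext j k
  have := congrFun (congrArg i (hf (π (Pi.single k 1)))) j
  rwa [map_smul, map_smul] at this

end SemilinearMatrix

/-! ### Matrix models of A-motives -/

section MatrixModel

variable {Fq A L : Type*} [Field Fq] [Fintype Fq] [CommRing A] [Algebra Fq A]
  [Field L] [Algebra Fq L] [Algebra A L] {r : ℕ} {M : Type*} [AddCommGroup M]
  [Module (A ⊗[Fq] L) M]

namespace AMotive

/-- A description of an `A`-motive by matrices: the underlying module is a direct summand of a free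
module, and `f τ` is given by a matrix `Φ f` for all `f` in a power of `J`, with inverse up to
scalars `Ψ g`. -/
structure MatrixModel (𝓜 : AMotive Fq A L r M) where
  N : ℕ
  i : M →ₗ[A ⊗[Fq] L] Fin N → A ⊗[Fq] L
  π : (Fin N → A ⊗[Fq] L) →ₗ[A ⊗[Fq] L] M
  π_i : π ∘ₗ i = LinearMap.id
  n : ℕ
  map_le : (idealJ Fq A L) ^ n • Submodule.span (A ⊗[Fq] L) (Set.range 𝓜.τ) ≤
    LinearMap.range (LocalizedModule.mkLinearMap (A ⊗[Fq] L)⁰ M)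
  le_map : (idealJ Fq A L) ^ n • LinearMap.range (LocalizedModule.mkLinearMap (A ⊗[Fq] L)⁰ M) ≤
    Submodule.span (A ⊗[Fq] L) (Set.range 𝓜.τ)
  φ : A ⊗[Fq] L → M →ₛₗ[(frob Fq A L : A ⊗[Fq] L →+* A ⊗[Fq] L)] M
  mk_φ : ∀ f ∈ (idealJ Fq A L) ^ n, ∀ m,
    LocalizedModule.mkLinearMap (A ⊗[Fq] L)⁰ M (φ f m) = f • 𝓜.τ m
  Ψ : A ⊗[Fq] L → Matrix (Fin N) (Fin N) (A ⊗[Fq] L)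
  E_Ψ : ∀ g, (idempotentMatrix i π).map (frob Fq A L) * Ψ g = Ψ g
  Ψ_E : ∀ g, Ψ g * idempotentMatrix i π = Ψ g
  Φ_Ψ : ∀ f ∈ (idealJ Fq A L) ^ n, ∀ g ∈ (idealJ Fq A L) ^ n,
    semilinearMatrix i π (φ f) * Ψ g = (f * g) • idempotentMatrix i π

/-- M embeds into a free module, on which nonzerodivisors act injectively; so identities in M may be
checked in the generic fibre. -/
theorem mkLinearMap_injective (𝓜 : AMotive Fq A L r M) :
    Function.Injective (LocalizedModule.mkLinearMap (A ⊗[Fq] L)⁰ M) := by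
  have := 𝓜.finite
  have := 𝓜.projective
  intro x y hxy
  obtain ⟨c, hc⟩ := (IsLocalizedModule.eq_iff_exists (A ⊗[Fq] L)⁰
    (LocalizedModule.mkLinearMap (A ⊗[Fq] L)⁰ M)).mp hxy
  obtain ⟨N, p, q, -, -, hpq⟩ := Module.Finite.exists_comp_eq_id_of_projective (A ⊗[Fq] L) M
  have h1 : ∀ z, p (q z) = z := fun z => LinearMap.congr_fun hpq z
  rw [← h1 x, ← h1 y]
  congr 1
  ext j
  have h2 := congrFun (congrArg q hc) j
  change q ((c : A ⊗[Fq] L) • x) j = q ((c : A ⊗[Fq] L) • y) j at h2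
  rw [map_smul, map_smul] at h2
  exact mul_cancel_left_mem_nonZeroDivisors c.2 |>.mp h2

theorem exists_semilinear (𝓜 : AMotive Fq A L r M) {f : A ⊗[Fq] L}
    (hf : ∀ m, f • 𝓜.τ m ∈ LinearMap.range (LocalizedModule.mkLinearMap (A ⊗[Fq] L)⁰ M)) :
    ∃ φ : M →ₛₗ[(frob Fq A L : A ⊗[Fq] L →+* A ⊗[Fq] L)] M, ∀ m,
      LocalizedModule.mkLinearMap (A ⊗[Fq] L)⁰ M (φ m) = f • 𝓜.τ m := by
  choose φ hφ using hf
  refine ⟨⟨⟨φ, fun x y => 𝓜.mkLinearMap_injective ?_⟩, fun c x => 𝓜.mkLinearMap_injective ?_⟩, hφ⟩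
  · rw [map_add, hφ, hφ, hφ, map_add, smul_add]
  · simp only
    rw [map_smul, hφ, hφ, map_smulₛₗ, smul_comm]

theorem nonempty_matrixModel (𝓜 : AMotive Fq A L r M) : Nonempty 𝓜.MatrixModel := by
  have := 𝓜.finite
  have := 𝓜.projective
  obtain ⟨N, p, q, -, -, hpq⟩ := Module.Finite.exists_comp_eq_id_of_projective (A ⊗[Fq] L) M
  obtain ⟨n₁, hn₁⟩ := 𝓜.map_le
  obtain ⟨n₂, hn₂⟩ := 𝓜.le_map
  let n := max n₁ n₂
  have hle₁ := (Submodule.smul_mono_left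
    (Ideal.pow_le_pow_right (I := idealJ Fq A L) (le_max_left n₁ n₂))).trans hn₁
  have hle₂ := (Submodule.smul_mono_left
    (Ideal.pow_le_pow_right (I := idealJ Fq A L) (le_max_right n₁ n₂))).trans hn₂
  have hφ : ∀ f : A ⊗[Fq] L, ∃ φ : M →ₛₗ[(frob Fq A L : A ⊗[Fq] L →+* A ⊗[Fq] L)] M,
      f ∈ (idealJ Fq A L) ^ n → ∀ m,
      LocalizedModule.mkLinearMap (A ⊗[Fq] L)⁰ M (φ m) = f • 𝓜.τ m := by
    intro f
    by_cases hf : f ∈ (idealJ Fq A L) ^ n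
    · obtain ⟨φ, h⟩ := 𝓜.exists_semilinear (f := f) fun m =>
        hle₁ (Submodule.smul_mem_smul hf (Submodule.subset_span ⟨m, rfl⟩))
      exact ⟨φ, fun _ => h⟩
    · exact ⟨0, fun h => absurd h hf⟩
  choose φ hφ using hφ
  let E := idempotentMatrix q p
  -- For g ∈ J^n, `le_map` writes g m = Σ c_x τ(x). The vector y = Σ c_x σ(q x) does not involve f,
  -- and Φ_f sends it to f g · q m. Such vectors form the columns of Ψ.
  have hcol : ∀ (g : A ⊗[Fq] L) (m : M), ∃ y : Fin N → A ⊗[Fq] L,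
      g ∈ (idealJ Fq A L) ^ n → ∀ f ∈ (idealJ Fq A L) ^ n,
      semilinearMatrix q p (φ f) *ᵥ y = (f * g) • q m := by
    intro g m
    by_cases hg : g ∈ (idealJ Fq A L) ^ n
    · have h1 := hle₂ (Submodule.smul_mem_smul hg (LinearMap.mem_range_self
        (LocalizedModule.mkLinearMap (A ⊗[Fq] L)⁰ M) m))
      obtain ⟨c, hc⟩ := (Finsupp.mem_span_range_iff_exists_finsupp).mp h1
      refine ⟨∑ x ∈ c.support, c x • (frob Fq A L ∘ q x), fun _ f hf => ?_⟩
      have h2 : ∑ x ∈ c.support, c x • φ f x = (f * g) • m := by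
        apply 𝓜.mkLinearMap_injective
        rw [map_sum, map_smul, mul_smul, ← hc, Finsupp.sum, Finset.smul_sum]
        refine Finset.sum_congr rfl fun x _ => ?_
        rw [map_smul, hφ f hf, smul_comm]
      rw [← map_smul, ← h2, map_sum, Matrix.mulVec_sum]
      refine Finset.sum_congr rfl fun x _ => ?_
      rw [Matrix.mulVec_smul, map_smul, apply_semilinear hpq]
      rfl
    · exact ⟨0, fun h => absurd h hg⟩
  choose y hy using hcol
  let Ψ : A ⊗[Fq] L → Matrix (Fin N) (Fin N) (A ⊗[Fq] L) := fun g =>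
    Matrix.of fun j k => y g (p (Pi.single k 1)) j
  have hΨ : ∀ f ∈ (idealJ Fq A L) ^ n, ∀ g ∈ (idealJ Fq A L) ^ n,
      semilinearMatrix q p (φ f) * Ψ g = (f * g) • E := by
    intro f hf g hg
    ext j k
    have h1 := congrFun (hy g (p (Pi.single k 1)) hg f hf) j
    refine h1.trans ?_
    rw [← idempotentMatrix_mulVec]
    simp [E]
  have hEE : E * E = E := idempotentMatrix_mul_self hpq
  have hσ : E.map (frob Fq A L) * E.map (frob Fq A L) = E.map (frob Fq A L) := by
    rw [← Matrix.map_mul, hEE]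
  have hΦ : ∀ f, semilinearMatrix q p (φ f) * E.map (frob Fq A L) = semilinearMatrix q p (φ f) :=
    fun f => semilinearMatrix_mul_idempotentMatrix hpq (φ f)
  exact ⟨
    { N := N, i := q, π := p, π_i := hpq, n := n, map_le := hle₁, le_map := hle₂, φ := φ
      mk_φ := fun f hf => hφ f hf
      -- Sandwiching with σ(E) and E normalises Ψ without changing Φ Ψ = f g E.
      Ψ := fun g => E.map (frob Fq A L) * Ψ g * E
      E_Ψ := fun g => by rw [← Matrix.mul_assoc, ← Matrix.mul_assoc, hσ]
      Ψ_E := fun g => by rw [Matrix.mul_assoc, hEE]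
      Φ_Ψ := fun f hf g hg => by
        rw [← Matrix.mul_assoc, ← Matrix.mul_assoc, hΦ, hΨ f hf g hg, Matrix.smul_mul, hEE] }⟩

end AMotive

end MatrixModel

/-! ### Coordinates on M ⊗ A_{v,L^sep} -/

section Coordinates

variable {Fq A L : Type*} [Field Fq] [CommRing A] [Algebra Fq A]
  [Field L] [Algebra Fq L] {M : Type*} [AddCommGroup M]
  [Module (A ⊗[Fq] L) M] (v : Ideal A) {N : ℕ} (i : M →ₗ[A ⊗[Fq] L] Fin N → A ⊗[Fq] L)
  (π : (Fin N → A ⊗[Fq] L) →ₗ[A ⊗[Fq] L] M)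

variable (Fq L) in
/-- The map `A_L → A_{v,L^sep}` on matrices. -/
def completedMatrix {m n : Type*} (E : Matrix m n (A ⊗[Fq] L)) :
    Matrix m n (CompletedCoeff Fq v (SeparableClosure L)) :=
  E.map (algebraMap _ _)

theorem completedMatrix_mul {l m n : Type*} [Fintype m] (X : Matrix l m (A ⊗[Fq] L))
    (Y : Matrix m n (A ⊗[Fq] L)) :
    completedMatrix Fq L v (X * Y) = completedMatrix Fq L v X * completedMatrix Fq L v Y :=
  Matrix.map_mul

theorem completedMatrix_smul {m n : Type*} (f : A ⊗[Fq] L) (X : Matrix m n (A ⊗[Fq] L)) :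
    completedMatrix Fq L v (f • X) =
      algebraMap _ (CompletedCoeff Fq v (SeparableClosure L)) f • completedMatrix Fq L v X := by
  refine Matrix.ext fun i j => ?_
  exact map_mul (algebraMap _ (CompletedCoeff Fq v (SeparableClosure L))) f (X i j)

theorem galHat_algebraMap (g : Gal(SeparableClosure L/L)) (f : A ⊗[Fq] L) :
    galHat Fq L v g (algebraMap _ _ f) = algebraMap _ _ f := by
  rw [Algebra.algebraMap_eq_smul_one, map_smul]
  congr 1
  exact map_one (completedMap Fq v _)

theorem frobHat_algebraMap [Fintype Fq] (f : A ⊗[Fq] L) :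
    completedMap Fq v (frob Fq A (SeparableClosure L)) (algebraMap _ _ f) =
      algebraMap _ _ (frob Fq A L f) := by
  rw [Algebra.algebraMap_eq_smul_one, Algebra.algebraMap_eq_smul_one]
  refine ((frobHat Fq L v).map_smulₛₗ f 1).trans ?_
  congr 1
  exact map_one (completedMap Fq v _)

theorem completedMatrix_frob [Fintype Fq] {m n : Type*} (X : Matrix m n (A ⊗[Fq] L)) :
    (completedMatrix Fq L v X).map (completedMap Fq v (frob Fq A (SeparableClosure L))) =
      completedMatrix Fq L v (X.map (frob Fq A L)) := by
  refine Matrix.ext fun i j => ?_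
  exact frobHat_algebraMap v (X i j)

/-- The coordinates of an element of `A_{v,L^sep} ⊗ M`. -/
def coords : CompletedModule Fq L M v →ₗ[A ⊗[Fq] L]
    (Fin N → CompletedCoeff Fq v (SeparableClosure L)) :=
  LinearMap.pi fun j => (TensorProduct.rid (A ⊗[Fq] L) _).toLinearMap ∘ₗ
    (LinearMap.proj j ∘ₗ i).lTensor _

theorem coords_tmul (x : CompletedCoeff Fq v (SeparableClosure L)) (m : M) (j : Fin N) :
    coords v i (x ⊗ₜ m) j = algebraMap _ _ (i m j) * x := by
  rw [← Algebra.smul_def]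
  simp [coords]

/-- The element of `A_{v,L^sep} ⊗ M` with given coordinates. -/
def ofCoords (y : Fin N → CompletedCoeff Fq v (SeparableClosure L)) : CompletedModule Fq L M v :=
  ∑ j, y j ⊗ₜ π (Pi.single j 1)

variable {i π}

theorem ofCoords_coords (h : π ∘ₗ i = LinearMap.id) (z : CompletedModule Fq L M v) :
    ofCoords v π (coords v i z) = z := by
  induction z using TensorProduct.induction_on with
  | zero => simp [ofCoords]
  | add x y hx hy =>
    rw [map_add]
    conv_rhs => rw [← hx, ← hy]
    simp only [ofCoords, Pi.add_apply, TensorProduct.add_tmul, Finset.sum_add_distrib]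
  | tmul x m =>
    simp only [ofCoords, coords_tmul, ← Algebra.smul_def]
    conv_rhs => rw [← LinearMap.id_apply (R := A ⊗[Fq] L) m, ← h, LinearMap.comp_apply,
      pi_eq_sum_univ' (i m), map_sum, TensorProduct.tmul_sum]
    refine Finset.sum_congr rfl fun j _ => ?_
    rw [map_smul, TensorProduct.smul_tmul]

theorem coords_injective (h : π ∘ₗ i = LinearMap.id) :
    Function.Injective (coords (Fq := Fq) (L := L) v i) :=
  Function.LeftInverse.injective (ofCoords_coords v h)

theorem coords_ofCoords (y : Fin N → CompletedCoeff Fq v (SeparableClosure L)) :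
    coords v i (ofCoords v π y) = completedMatrix Fq L v (idempotentMatrix i π) *ᵥ y := by
  ext j : 1
  rw [ofCoords, map_sum, Finset.sum_apply]
  refine Finset.sum_congr rfl fun k _ => ?_
  rw [coords_tmul, ← idempotentMatrix_mulVec]
  simp [completedMatrix]

theorem coords_smul (c : AdicCompletion v A) (z : CompletedModule Fq L M v) :
    coords v i (c • z) = c • coords v i z := by
  induction z using TensorProduct.induction_on with
  | zero => simp
  | add x y hx hy => rw [smul_add, map_add, hx, hy, map_add, smul_add]
  | tmul x m =>
    ext j : 1
    rw [TensorProduct.smul_tmul', coords_tmul, Pi.smul_apply, coords_tmul, mul_smul_comm]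

theorem coords_galModule (g : Gal(SeparableClosure L/L)) (z : CompletedModule Fq L M v) :
    coords v i (galModule Fq L M v g z) = galHat Fq L v g ∘ coords v i z := by
  induction z using TensorProduct.induction_on with
  | zero => ext j : 1; simp
  | add x y hx hy =>
    rw [map_add, map_add, hx, hy, map_add]
    ext j : 1
    simp
  | tmul x m =>
    ext j : 1
    rw [galModule, TensorProduct.map_tmul, coords_tmul, Function.comp_apply, coords_tmul,
      LinearMap.id_apply, ← Algebra.smul_def, ← Algebra.smul_def, map_smul]

variable [Fintype Fq]

theorem coords_frobModule (h : π ∘ₗ i = LinearMap.id)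
    (φ : M →ₛₗ[(frob Fq A L : A ⊗[Fq] L →+* A ⊗[Fq] L)] M) (z : CompletedModule Fq L M v) :
    coords v i (frobModule v φ z) = completedMatrix Fq L v (semilinearMatrix i π φ) *ᵥ
      (completedMap Fq v (frob Fq A (SeparableClosure L)) ∘ coords v i z) := by
  induction z using TensorProduct.induction_on with
  | zero => ext j : 1; simp [Matrix.mulVec, dotProduct]
  | add x y hx hy =>
    rw [map_add, map_add, hx, hy, map_add, ← Matrix.mulVec_add]
    congr 1
    ext j : 1
    simp
  | tmul x m =>
    ext j : 1
    have h1 := congrArg (algebraMap _ (CompletedCoeff Fq v (SeparableClosure L)))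
      (congrFun (apply_semilinear h φ m) j)
    rw [frobModule, TensorProduct.map_tmul, coords_tmul, h1]
    simp only [Matrix.mulVec, dotProduct, map_sum, map_mul, completedMatrix, Matrix.map_apply,
      Function.comp_apply, coords_tmul, Finset.sum_mul]
    refine Finset.sum_congr rfl fun k _ => ?_
    rw [frobHat_algebraMap, mul_assoc]
    rfl

end Coordinates

/-! ### The Tate module is free of rank r -/

section TateBasis

variable {Fq A L : Type*} [Field Fq] [Fintype Fq] [CommRing A] [Algebra Fq A]
  [Field L] [Algebra Fq L] [Algebra A L] {r : ℕ} {M : Type*} [AddCommGroup M]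
  [Module (A ⊗[Fq] L) M] {𝓜 : AMotive Fq A L r M}

namespace AMotive

namespace MatrixModel

variable (m : 𝓜.MatrixModel) (v : Ideal A) (f : A ⊗[Fq] L)
  (w : CompletedCoeff Fq v (SeparableClosure L))

/-- The idempotent matrix over `A_{v,L^sep}`. -/
def hatE : Matrix (Fin m.N) (Fin m.N) (CompletedCoeff Fq v (SeparableClosure L)) :=
  completedMatrix Fq L v (idempotentMatrix m.i m.π)

/-- The matrix of `τ` over `A_{v,L^sep}`, if `w` is inverse to `f`. -/
def hatF : Matrix (Fin m.N) (Fin m.N) (CompletedCoeff Fq v (SeparableClosure L)) :=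
  w • completedMatrix Fq L v (semilinearMatrix m.i m.π (m.φ f))

/-- The matrix of `τ⁻¹` over `A_{v,L^sep}`, if `w` is inverse to `f`. -/
def hatG : Matrix (Fin m.N) (Fin m.N) (CompletedCoeff Fq v (SeparableClosure L)) :=
  w • completedMatrix Fq L v (m.Ψ f)

theorem hatE_mul_self : m.hatE v * m.hatE v = m.hatE v := by
  rw [hatE, ← completedMatrix_mul, idempotentMatrix_mul_self m.π_i]

theorem hatE_mul_hatF : m.hatE v * m.hatF v f w = m.hatF v f w := by
  rw [hatE, hatF, Matrix.mul_smul, ← completedMatrix_mul,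
    idempotentMatrix_mul_semilinearMatrix m.π_i]

theorem hatF_mul_hatE : m.hatF v f w *
    (m.hatE v).map (completedMap Fq v (frob Fq A (SeparableClosure L))) = m.hatF v f w := by
  rw [hatE, hatF, Matrix.smul_mul, completedMatrix_frob, ← completedMatrix_mul]
  congr 2
  exact semilinearMatrix_mul_idempotentMatrix m.π_i (m.φ f)

theorem hatE_mul_hatG : (m.hatE v).map (completedMap Fq v (frob Fq A (SeparableClosure L))) *
    m.hatG v f w = m.hatG v f w := by
  rw [hatE, hatG, Matrix.mul_smul, completedMatrix_frob, ← completedMatrix_mul, m.E_Ψ]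

variable {v f w}

theorem hatF_mul_hatG (hf : f ∈ (idealJ Fq A L) ^ m.n)
    (hw : algebraMap _ (CompletedCoeff Fq v (SeparableClosure L)) f * w = 1) :
    m.hatF v f w * m.hatG v f w = m.hatE v := by
  rw [hatE, hatF, hatG, Matrix.smul_mul, Matrix.mul_smul, ← completedMatrix_mul,
    m.Φ_Ψ f hf f hf, completedMatrix_smul, smul_smul, smul_smul, map_mul]
  have : w * w * (algebraMap (A ⊗[Fq] L) (CompletedCoeff Fq v (SeparableClosure L)) f *
      algebraMap (A ⊗[Fq] L) (CompletedCoeff Fq v (SeparableClosure L)) f) = 1 := by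
    linear_combination (algebraMap (A ⊗[Fq] L) (CompletedCoeff Fq v (SeparableClosure L)) f * w + 1)
      * hw
  rw [this, one_smul]

/-- One pair (f, φ_f) with f invertible in the completion decides the condition for all pairs (f',
φ'), because f φ' = f' φ_f and f can be cancelled. -/
theorem mem_tateModule_iff (hf : f ∈ (idealJ Fq A L) ^ m.n)
    (hw : algebraMap _ (CompletedCoeff Fq v (SeparableClosure L)) f * w = 1)
    (z : CompletedModule Fq L M v) : z ∈ 𝓜.tateModule v ↔
      m.hatF v f w *ᵥ (completedMap Fq v (frob Fq A (SeparableClosure L)) ∘ coords v m.i z) =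
        coords v m.i z := by
  have hinj := coords_injective (Fq := Fq) (L := L) v m.π_i
  have h1 : ∀ z : CompletedModule Fq L M v, w • coords v m.i (f • z) = coords v m.i z := by
    intro z
    ext j : 1
    rw [map_smul, Pi.smul_apply, Pi.smul_apply, smul_eq_mul, Algebra.smul_def, ← mul_assoc,
      mul_comm w, hw, one_mul]
  have h2 : m.hatF v f w *ᵥ
      (completedMap Fq v (frob Fq A (SeparableClosure L)) ∘ coords v m.i z) =
        w • coords v m.i (frobModule v (m.φ f) z) := by
    rw [coords_frobModule v m.π_i, hatF, Matrix.smul_mulVec]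
  rw [h2]
  constructor
  · intro hz
    rw [hz f (m.φ f) (m.mk_φ f hf), h1]
  · intro hz
    have h3 : frobModule v (m.φ f) z = f • z := by
      apply hinj
      rw [← h1 z] at hz
      have h4 := congrArg
        (algebraMap (A ⊗[Fq] L) (CompletedCoeff Fq v (SeparableClosure L)) f • ·) hz
      simpa only [smul_smul, hw, one_smul] using h4
    intro f' φ' hφ'
    have h5 : ∀ x, f • φ' x = f' • m.φ f x := by
      intro x
      apply 𝓜.mkLinearMap_injective
      rw [map_smul, map_smul, hφ', m.mk_φ f hf, smul_comm]
    have h6 : ∀ z : CompletedModule Fq L M v,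
        f • frobModule v φ' z = f' • frobModule v (m.φ f) z := by
      intro z
      induction z using TensorProduct.induction_on with
      | zero => simp
      | add x y hx hy => rw [map_add, map_add, smul_add, smul_add, hx, hy]
      | tmul a x =>
        rw [frobModule, frobModule, TensorProduct.map_tmul, TensorProduct.map_tmul,
          ← TensorProduct.tmul_smul, ← TensorProduct.tmul_smul, h5]
    apply hinj
    rw [← h1, h6, h3, smul_comm, h1]

/-- The matrix of coordinates of a basis of the Tate module. -/
def basisMatrix (b : Module.Basis (Fin r) (AdicCompletion v A) (𝓜.tateModule v)) :
    Matrix (Fin m.N) (Fin r) (CompletedCoeff Fq v (SeparableClosure L)) :=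
  Matrix.of fun j k => coords v m.i (b k : CompletedModule Fq L M v) j

variable (Fq L) in
/-- The map `A_v → A_{v,L^sep}` on matrices. -/
def scalarMatrix {m n : Type*} (P : Matrix m n (AdicCompletion v A)) :
    Matrix m n (CompletedCoeff Fq v (SeparableClosure L)) :=
  P.map (algebraMap _ _)

theorem coords_eq_mulVec (b : Module.Basis (Fin r) (AdicCompletion v A) (𝓜.tateModule v))
    (c : Fin r → AdicCompletion v A) :
    coords v m.i ((∑ k, c k • b k : 𝓜.tateModule v) : CompletedModule Fq L M v) =
      m.basisMatrix b *ᵥ (algebraMap _ _ ∘ c) := by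
  rw [AddSubmonoidClass.coe_finsetSum, map_sum]
  ext j : 1
  rw [Finset.sum_apply]
  refine Finset.sum_congr rfl fun k _ => ?_
  rw [Submodule.coe_smul, coords_smul, Pi.smul_apply, Algebra.smul_def, mul_comm]
  rfl

theorem hatF_mul_basisMatrix (hf : f ∈ (idealJ Fq A L) ^ m.n)
    (hw : algebraMap _ (CompletedCoeff Fq v (SeparableClosure L)) f * w = 1)
    (b : Module.Basis (Fin r) (AdicCompletion v A) (𝓜.tateModule v)) :
    m.hatF v f w * (m.basisMatrix b).map (completedMap Fq v (frob Fq A (SeparableClosure L))) =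
      m.basisMatrix b := by
  refine Matrix.ext fun j k => ?_
  exact congrFun ((m.mem_tateModule_iff hf hw (b k)).mp (b k).2) j

theorem basisMatrix_map_galHat (b : Module.Basis (Fin r) (AdicCompletion v A) (𝓜.tateModule v))
    (g : Gal(SeparableClosure L/L)) :
    (m.basisMatrix b).map (galHat Fq L v g) =
      m.basisMatrix b * scalarMatrix Fq L (𝓜.galRepMatrix v b g : Matrix _ _ (AdicCompletion v A)) := by
  refine Matrix.ext fun j k => ?_
  have h1 : (𝓜.galRepMatrix v b g : Matrix _ _ (AdicCompletion v A)) =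
      LinearMap.toMatrix b b (𝓜.galRep v g) := rfl
  have h2 : (𝓜.galRep v g (b k)) = ∑ l, LinearMap.toMatrix b b (𝓜.galRep v g) l k • b l := by
    conv_lhs => rw [← b.sum_repr (𝓜.galRep v g (b k))]
    simp only [LinearMap.toMatrix_apply]
  have h3 := congrFun (m.coords_eq_mulVec b
    (fun l => LinearMap.toMatrix b b (𝓜.galRep v g) l k)) j
  rw [← h2] at h3
  have h4 := congrFun (coords_galModule (i := m.i) v g (b k : CompletedModule Fq L M v)) j
  rw [h1]
  exact h4.symm.trans h3

/-- The fixed columns of `exists_frobenius_basis` are the basis. The coordinates C x of an invariant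
x are σ-fixed because B has a left inverse, hence lie in A_v; comparison of ranks gives the number
r. -/
theorem exists_tate_basis [v.IsMaximal] (hfin : ∀ n, Finite (A ⧸ v ^ n))
    (hf : f ∈ (idealJ Fq A L) ^ m.n)
    (hw : algebraMap _ (CompletedCoeff Fq v (SeparableClosure L)) f * w = 1) :
    ∃ (b : Module.Basis (Fin r) (AdicCompletion v A) (𝓜.tateModule v))
      (C : Matrix (Fin r) (Fin m.N) (CompletedCoeff Fq v (SeparableClosure L))),
      C * m.basisMatrix b = 1 ∧ m.basisMatrix b * C = m.hatE v := by
  obtain ⟨k, B, C, hCB, hBC, hFB⟩ := exists_frobenius_basis hfin (m.hatE_mul_self v)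
    (m.hatE_mul_hatF v f w) (m.hatF_mul_hatE v f w) (m.hatF_mul_hatG hf hw)
  have := 𝓜.finite
  have := 𝓜.projective
  have : Nontrivial (A ⧸ v ^ 1) := Ideal.Quotient.nontrivial_iff.mpr (by
    rw [pow_one]; exact Ideal.IsPrime.ne_top')
  have := (AdicCompletion.evalₐ v 1).toRingHom.domain_nontrivial
  have hnt : Nontrivial (CompletedCoeff Fq v (SeparableClosure L)) :=
    (adic_algebraMap_injective (Fq := Fq) (K := SeparableClosure L) v).nontrivial
  obtain rfl : k = r := card_eq_of_factorization m.i m.π m.π_i 𝓜.rank_eq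
    (algebraMap _ (CompletedCoeff Fq v (SeparableClosure L))) hCB hBC
  have hEB : m.hatE v * B = B := by rw [← hBC, Matrix.mul_assoc, hCB, Matrix.mul_one]
  let z : Fin k → CompletedModule Fq L M v := fun l => ofCoords v m.π fun j => B j l
  have hz : ∀ l, coords v m.i (z l) = fun j => B j l := by
    intro l
    rw [coords_ofCoords]
    exact funext fun j => congrFun (congrFun hEB j) l
  have hzT : ∀ l, z l ∈ 𝓜.tateModule v := by
    intro l
    rw [m.mem_tateModule_iff hf hw, hz]
    exact funext fun j => congrFun (congrFun hFB j) l
  have hsum : ∀ c : Fin k → AdicCompletion v A,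
      coords v m.i ((∑ l, c l • (⟨z l, hzT l⟩ : 𝓜.tateModule v) : 𝓜.tateModule v) :
        CompletedModule Fq L M v) = B *ᵥ (algebraMap _ _ ∘ c) := by
    intro c
    rw [AddSubmonoidClass.coe_finsetSum, map_sum]
    ext j : 1
    rw [Finset.sum_apply]
    refine Finset.sum_congr rfl fun l _ => ?_
    rw [Submodule.coe_smul, coords_smul, Pi.smul_apply, Algebra.smul_def, mul_comm, hz]
    rfl
  have hBinj : ∀ c, B *ᵥ c = 0 → c = 0 := by
    intro c hc
    rw [← Matrix.one_mulVec c, ← hCB, ← Matrix.mulVec_mulVec, hc, Matrix.mulVec_zero]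
  have hli : LinearIndependent (AdicCompletion v A) fun l => (⟨z l, hzT l⟩ : 𝓜.tateModule v) := by
    rw [Fintype.linearIndependent_iff]
    intro c hc l
    have h1 := hsum c
    rw [hc, Submodule.coe_zero, map_zero] at h1
    have h2 := congrFun (hBinj _ h1.symm) l
    exact adic_algebraMap_injective (Fq := Fq) (K := SeparableClosure L) v
      (h2.trans (map_zero _).symm)
  have hsp : ⊤ ≤ Submodule.span (AdicCompletion v A)
      (Set.range fun l => (⟨z l, hzT l⟩ : 𝓜.tateModule v)) := by
    rintro ⟨x, hx⟩ -
    have h1 := (m.mem_tateModule_iff hf hw x).mp hx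
    have h2 : B *ᵥ (C *ᵥ coords v m.i x) = coords v m.i x := by
      rw [Matrix.mulVec_mulVec, hBC]
      conv_lhs => rw [← h1]
      rw [Matrix.mulVec_mulVec, hatE_mul_hatF, h1]
    have h3 : ∀ l, completedMap Fq v (frob Fq A (SeparableClosure L)) ((C *ᵥ coords v m.i x) l) =
        (C *ᵥ coords v m.i x) l := by
      intro l
      have h4 : B *ᵥ (completedMap Fq v (frob Fq A (SeparableClosure L)) ∘
          (C *ᵥ coords v m.i x)) = B *ᵥ (C *ᵥ coords v m.i x) := by
        conv_lhs => rw [← hFB]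
        rw [← Matrix.mulVec_mulVec, ← comp_mulVec, h2, h1]
      have h5 := hBinj _ ((Matrix.mulVec_sub _ _ _).trans (sub_eq_zero.mpr h4))
      exact sub_eq_zero.mp (congrFun h5 l)
    choose c hc using fun l => exists_algebraMap_eq_of_frob_eq (h3 l)
    have h6 : (⟨x, hx⟩ : 𝓜.tateModule v) = ∑ l, c l • (⟨z l, hzT l⟩ : 𝓜.tateModule v) := by
      apply Subtype.ext
      apply coords_injective (Fq := Fq) (L := L) v m.π_i
      rw [hsum, show algebraMap _ (CompletedCoeff Fq v (SeparableClosure L)) ∘ c =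
        C *ᵥ coords v m.i x from funext hc, h2]
    rw [h6]
    exact Submodule.sum_mem _ fun l _ => Submodule.smul_mem _ _ (Submodule.subset_span ⟨l, rfl⟩)
  have hBb : m.basisMatrix (Module.Basis.mk hli hsp) = B := by
    refine Matrix.ext fun j l => ?_
    rw [basisMatrix, Matrix.of_apply, Module.Basis.mk_apply, hz]
  exact ⟨Module.Basis.mk hli hsp, C, by rw [hBb, hCB], by rw [hBb, hBC]⟩

theorem basisMatrix_eq_mul (b b' : Module.Basis (Fin r) (AdicCompletion v A) (𝓜.tateModule v)) :
    m.basisMatrix b' = m.basisMatrix b * scalarMatrix Fq L (b.toMatrix b') := by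
  refine Matrix.ext fun j k => ?_
  have h1 := congrFun (m.coords_eq_mulVec b (fun l => b.toMatrix b' l k)) j
  rw [b.sum_toMatrix_smul_self] at h1
  exact h1

theorem exists_dual_basisMatrix [v.IsMaximal] (hfin : ∀ n, Finite (A ⧸ v ^ n))
    (hf : f ∈ (idealJ Fq A L) ^ m.n)
    (hw : algebraMap _ (CompletedCoeff Fq v (SeparableClosure L)) f * w = 1)
    (b : Module.Basis (Fin r) (AdicCompletion v A) (𝓜.tateModule v)) :
    ∃ C : Matrix (Fin r) (Fin m.N) (CompletedCoeff Fq v (SeparableClosure L)),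
      C * m.basisMatrix b = 1 ∧ m.basisMatrix b * C = m.hatE v := by
  obtain ⟨b', C, hCB, hBC⟩ := m.exists_tate_basis hfin hf hw
  refine ⟨scalarMatrix Fq L (b.toMatrix b') * C, ?_, ?_⟩
  · rw [m.basisMatrix_eq_mul b' b, Matrix.mul_assoc, ← Matrix.mul_assoc C, hCB, Matrix.one_mul,
      scalarMatrix, scalarMatrix, ← Matrix.map_mul, Module.Basis.toMatrix_mul_toMatrix_flip]
    exact Matrix.map_one _ (map_zero _) (map_one _)
  · rw [← Matrix.mul_assoc, ← m.basisMatrix_eq_mul, hBC]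

end MatrixModel

end AMotive

end TateBasis

/-! ### Artin–Schreier equations over A ⊗ L^sep -/

section ArtinSchreier

variable {Fq A L : Type*} [Field Fq] [Fintype Fq] [CommRing A] [Algebra Fq A]
  [Field L] [Algebra Fq L]

/-- Artin–Schreier equations over `A ⊗ L^sep` are solvable, with finitely many differences of
conjugates. -/
theorem exists_sub_frob_eq (t : A ⊗[Fq] L) : ∃ h : A ⊗[Fq] SeparableClosure L,
    h - frob Fq A (SeparableClosure L) h = algebraMap (A ⊗[Fq] L) _ t ∧
    (Set.range fun g : Gal(SeparableClosure L/L) =>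
      coeffMap Fq A (g.toAlgHom.restrictScalars Fq) h - h).Finite := by
  induction t with
  | zero => exact ⟨0, by simp, (Set.finite_singleton 0).subset (by rintro _ ⟨g, rfl⟩; simp)⟩
  | add x y hx hy =>
    obtain ⟨a, ha, ha'⟩ := hx
    obtain ⟨b, hb, hb'⟩ := hy
    refine ⟨a + b, by rw [map_add, RingHom.map_add, ← ha, ← hb]; ring,
      (ha'.image2 (· + ·) hb').subset ?_⟩
    rintro _ ⟨g, rfl⟩
    refine ⟨_, ⟨g, rfl⟩, _, ⟨g, rfl⟩, ?_⟩
    simp only [map_add]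
    ring
  | tmul a l =>
    have hq : 1 < Fintype.card Fq := Fintype.one_lt_card
    have hq0 : ((Fintype.card Fq : ℕ) : SeparableClosure L) = 0 := by
      rw [← map_natCast (algebraMap Fq (SeparableClosure L)), FiniteField.cast_card_eq_zero,
        map_zero]
    obtain ⟨x, hx⟩ : ∃ x : SeparableClosure L,
        x - x ^ Fintype.card Fq = algebraMap L (SeparableClosure L) l := by
      obtain ⟨x, hx⟩ := IsSepClosed.exists_root_C_mul_X_pow_add_C_mul_X_add_C (1 : SeparableClosure L)
        (-1) (algebraMap L (SeparableClosure L) l) hq0 hq (neg_ne_zero.mpr one_ne_zero)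
      exact ⟨x, by linear_combination -hx⟩
    refine ⟨a ⊗ₜ x, ?_, (Set.finite_range fun c : Fq =>
      a ⊗ₜ[Fq] algebraMap Fq (SeparableClosure L) c).subset ?_⟩
    · rw [frob_tmul, ← TensorProduct.tmul_sub, hx]
      rfl
    · rintro _ ⟨g, rfl⟩
      -- Two solutions of x - x^q = l differ by an element of Fq, and Fq is finite.
      have h1 : (g x - x) ^ Fintype.card Fq = g x - x := by
        have h3 : (g x - x) ^ Fintype.card Fq = g x ^ Fintype.card Fq - x ^ Fintype.card Fq :=
          map_sub (FiniteField.frobeniusAlgHom Fq (SeparableClosure L)) (g x) x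
        have h4 := congrArg g hx
        rw [map_sub, map_pow, g.commutes, ← hx] at h4
        rw [h3]
        linear_combination -h4
      obtain ⟨c, hc⟩ := exists_algebraMap_eq_of_pow_card_eq Fq h1
      refine ⟨c, ?_⟩
      simp only
      rw [hc, TensorProduct.tmul_sub]
      rfl

end ArtinSchreier

/-! ### The derivation commutes with Frobenius and Galois -/

section DerivationCompat

variable {Fq A L : Type*} [Field Fq] [CommRing A] [Algebra Fq A]
  [Field L] [Algebra Fq L] (v : Ideal A) (D : Derivation Fq A A)

variable (L) in
/-- The derivation of `A_{v,L^sep}` induced by a derivation of `A`. -/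
def hatDeriv : Derivation ℤ (CompletedCoeff Fq v (SeparableClosure L))
    (CompletedCoeff Fq v (SeparableClosure L)) :=
  adicDeriv (coeffIdeal Fq v (SeparableClosure L)) (coeffDeriv (SeparableClosure L) D)

theorem algebraMap_completedCoeff (x : A ⊗[Fq] L) :
    algebraMap _ (CompletedCoeff Fq v (SeparableClosure L)) x =
      algebraMap (A ⊗[Fq] SeparableClosure L) _
        (coeffMap Fq A (IsScalarTower.toAlgHom Fq L (SeparableClosure L)) x) := rfl

theorem hatDeriv_algebraMap (x : A ⊗[Fq] L) :
    hatDeriv L v D (algebraMap _ _ x) = algebraMap _ _ (coeffDeriv L D x) := by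
  rw [algebraMap_completedCoeff, algebraMap_completedCoeff, coeffMap_coeffDeriv]
  exact adicDeriv_algebraMap _ _ _

theorem completedMap_hatDeriv (s : SeparableClosure L →ₐ[Fq] SeparableClosure L)
    (x : CompletedCoeff Fq v (SeparableClosure L)) :
    completedMap Fq v (coeffMap Fq A s) (hatDeriv L v D x) =
      hatDeriv L v D (completedMap Fq v (coeffMap Fq A s) x) :=
  adicMap_adicDeriv _ _ _ _ _ _ (coeffMap_coeffDeriv s D) x

theorem hatDeriv_algebraMap_adic (c : AdicCompletion v A) :
    hatDeriv L v D (algebraMap _ _ c) = algebraMap _ _ (adicDeriv v D c) :=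
  (adicMap_adicDeriv v D _ (algebraMap A (A ⊗[Fq] SeparableClosure L)) le_rfl
    (coeffDeriv (SeparableClosure L) D) (fun _ => rfl) c).symm

end DerivationCompat

/-! ### The trace of the logarithmic derivative -/

section Trace

variable {Fq A L : Type*} [Field Fq] [Fintype Fq] [CommRing A] [Algebra Fq A]
  [Field L] [Algebra Fq L] [Algebra A L] {r : ℕ} {M : Type*} [AddCommGroup M]
  [Module (A ⊗[Fq] L) M] {𝓜 : AMotive Fq A L r M}

namespace AMotive.MatrixModel

variable (m : 𝓜.MatrixModel) {v : Ideal A} {f : A ⊗[Fq] L}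
  {w : CompletedCoeff Fq v (SeparableClosure L)} (D : Derivation Fq A A)

section

variable {b : Module.Basis (Fin r) (AdicCompletion v A) (𝓜.tateModule v)}
  {C : Matrix (Fin r) (Fin m.N) (CompletedCoeff Fq v (SeparableClosure L))}

/-- In the basis of invariants τ is the identity, so F is determined by B, C and Frobenius; likewise
its inverse in `hatG_eq`. -/
theorem hatF_eq (hf : f ∈ (idealJ Fq A L) ^ m.n)
    (hw : algebraMap _ (CompletedCoeff Fq v (SeparableClosure L)) f * w = 1)
    (hBC : m.basisMatrix b * C = m.hatE v) : m.hatF v f w =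
      m.basisMatrix b * C.map (completedMap Fq v (frob Fq A (SeparableClosure L))) := by
  rw [← m.hatF_mul_hatE, ← hBC, Matrix.map_mul, ← Matrix.mul_assoc, m.hatF_mul_basisMatrix hf hw]

theorem hatG_eq (hf : f ∈ (idealJ Fq A L) ^ m.n)
    (hw : algebraMap _ (CompletedCoeff Fq v (SeparableClosure L)) f * w = 1)
    (hCB : C * m.basisMatrix b = 1) (hBC : m.basisMatrix b * C = m.hatE v) : m.hatG v f w =
      (m.basisMatrix b).map (completedMap Fq v (frob Fq A (SeparableClosure L))) * C := by
  have h1 : C * (m.hatF v f w * m.hatG v f w) = C := by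
    rw [m.hatF_mul_hatG hf hw, ← hBC, ← Matrix.mul_assoc, hCB, Matrix.one_mul]
  rw [m.hatF_eq hf hw hBC, Matrix.mul_assoc, ← Matrix.mul_assoc, hCB, Matrix.one_mul] at h1
  rw [← m.hatE_mul_hatG, ← hBC, Matrix.map_mul, Matrix.mul_assoc, h1]

/-- Differentiate B = F σ(B), multiply by C and take traces: the term with DF becomes tr(G DF) = t
by cyclicity, the other is σ of the left side. Since Df = 0, the denominator f passes through D. -/
theorem trace_eq_add_frob (hf : f ∈ (idealJ Fq A L) ^ m.n)
    (hw : algebraMap _ (CompletedCoeff Fq v (SeparableClosure L)) f * w = 1)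
    (hCB : C * m.basisMatrix b = 1) (hBC : m.basisMatrix b * C = m.hatE v)
    (hDf : coeffDeriv L D f = 0) {t : A ⊗[Fq] L}
    (ht : (m.Ψ f * (semilinearMatrix m.i m.π (m.φ f)).map (coeffDeriv L D)).trace = f * f * t) :
    (C * (m.basisMatrix b).map (hatDeriv L v D)).trace = algebraMap _ _ t +
      completedMap Fq v (frob Fq A (SeparableClosure L))
        (C * (m.basisMatrix b).map (hatDeriv L v D)).trace := by
  have hDw : hatDeriv L v D w = 0 := by
    have h1 := congrArg (hatDeriv L v D) hw
    rw [Derivation.leibniz, hatDeriv_algebraMap, hDf, map_zero, smul_zero, add_zero,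
      Derivation.map_one_eq_zero, smul_eq_mul] at h1
    calc hatDeriv L v D w = w * (algebraMap _ _ f * hatDeriv L v D w) := by
          rw [← mul_assoc, mul_comm w, hw, one_mul]
      _ = 0 := by rw [h1, mul_zero]
  have hDF : (m.hatF v f w).map (hatDeriv L v D) =
      w • completedMatrix Fq L v ((semilinearMatrix m.i m.π (m.φ f)).map (coeffDeriv L D)) := by
    refine Matrix.ext fun i j => ?_
    rw [hatF, Matrix.map_apply, Matrix.smul_apply, smul_eq_mul, Derivation.leibniz, hDw, smul_zero,
      add_zero]
    exact congrArg (w • ·) (hatDeriv_algebraMap v D _)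
  have htr : (m.hatG v f w * (m.hatF v f w).map (hatDeriv L v D)).trace = algebraMap _ _ t := by
    rw [hDF, hatG, Matrix.smul_mul, Matrix.mul_smul, ← completedMatrix_mul, Matrix.trace_smul,
      Matrix.trace_smul]
    have h1 : ∀ X : Matrix (Fin m.N) (Fin m.N) (A ⊗[Fq] L), (completedMatrix Fq L v X).trace =
        algebraMap _ (CompletedCoeff Fq v (SeparableClosure L)) X.trace := fun X =>
      (map_sum (algebraMap (A ⊗[Fq] L) (CompletedCoeff Fq v (SeparableClosure L))) _ _).symm
    rw [h1, ht, map_mul, map_mul, smul_eq_mul, smul_eq_mul]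
    linear_combination ((algebraMap (A ⊗[Fq] L) (CompletedCoeff Fq v (SeparableClosure L)) f * w + 1)
      * algebraMap (A ⊗[Fq] L) (CompletedCoeff Fq v (SeparableClosure L)) t) * hw
  have h1 : (m.basisMatrix b).map (hatDeriv L v D) = (m.hatF v f w).map (hatDeriv L v D) *
      (m.basisMatrix b).map (completedMap Fq v (frob Fq A (SeparableClosure L))) +
      m.hatF v f w * ((m.basisMatrix b).map (hatDeriv L v D)).map
        (completedMap Fq v (frob Fq A (SeparableClosure L))) := by
    conv_lhs => rw [← m.hatF_mul_basisMatrix hf hw b]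
    rw [Derivation.map_matrix_mul]
    congr 2
    refine Matrix.ext fun i j => ?_
    exact (completedMap_hatDeriv v D _ _).symm
  have h2 : C * m.hatF v f w =
      C.map (completedMap Fq v (frob Fq A (SeparableClosure L))) := by
    rw [m.hatF_eq hf hw hBC, ← Matrix.mul_assoc, hCB, Matrix.one_mul]
  have h3 : completedMap Fq v (frob Fq A (SeparableClosure L))
        (C * (m.basisMatrix b).map (hatDeriv L v D)).trace =
      (C.map (completedMap Fq v (frob Fq A (SeparableClosure L))) *
        ((m.basisMatrix b).map (hatDeriv L v D)).map
        (completedMap Fq v (frob Fq A (SeparableClosure L)))).trace := by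
    rw [← Matrix.map_mul]
    exact map_sum _ _ _
  rw [h3, ← htr, m.hatG_eq hf hw hCB hBC, ← h2]
  conv_lhs => rw [h1]
  rw [Matrix.mul_add, Matrix.trace_add, Matrix.mul_assoc C (m.hatF v f w)]
  congr 1
  rw [← Matrix.mul_assoc, Matrix.trace_mul_comm, ← Matrix.mul_assoc]

/-- Differentiate g(B) = B ρ(g) and use g(C) = ρ(g)⁻¹ C; the term with DB is conjugation-invariant
under the trace. -/
theorem galHat_trace (hCB : C * m.basisMatrix b = 1) (hBC : m.basisMatrix b * C = m.hatE v)
    (g : Gal(SeparableClosure L/L)) :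
    galHat Fq L v g (C * (m.basisMatrix b).map (hatDeriv L v D)).trace =
      (C * (m.basisMatrix b).map (hatDeriv L v D)).trace + algebraMap _ _
        (((𝓜.galRepMatrix v b g)⁻¹ : Matrix.GeneralLinearGroup (Fin r) (AdicCompletion v A)).1 *
          (𝓜.galRepMatrix v b g).1.map (adicDeriv v D)).trace := by
  let γ : CompletedCoeff Fq v (SeparableClosure L) →+* CompletedCoeff Fq v (SeparableClosure L) :=
    completedMap Fq v (coeffMap Fq A (g.toAlgHom.restrictScalars Fq))
  let B := m.basisMatrix b
  let ρ := scalarMatrix Fq L (𝓜.galRepMatrix v b g).1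
  let ρ' := scalarMatrix Fq L
    ((𝓜.galRepMatrix v b g)⁻¹ : Matrix.GeneralLinearGroup (Fin r) (AdicCompletion v A)).1
  have hρ' : ρ' * ρ = 1 := by
    change scalarMatrix Fq L _ * scalarMatrix Fq L _ = 1
    rw [scalarMatrix, scalarMatrix, ← Matrix.map_mul, Units.inv_mul]
    exact Matrix.map_one _ (map_zero _) (map_one _)
  have hρ : ρ * ρ' = 1 := mul_eq_one_comm.mp hρ'
  have hB : B.map γ = B * ρ := m.basisMatrix_map_galHat b g
  have hE : (m.hatE v).map γ = m.hatE v := by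
    refine Matrix.ext fun i j => ?_
    exact galHat_algebraMap v g _
  have hC : C.map γ = ρ' * C := by
    have h1 : C.map γ * B.map γ = 1 := by
      rw [← Matrix.map_mul, hCB]
      exact Matrix.map_one _ (map_zero _) (map_one _)
    have h2 : C.map γ * B = ρ' := by
      rw [hB, ← Matrix.mul_assoc] at h1
      rw [← Matrix.mul_one (C.map γ * B), ← hρ, ← Matrix.mul_assoc, h1, Matrix.one_mul]
    have h3 : C * m.hatE v = C := by rw [← hBC, ← Matrix.mul_assoc, hCB, Matrix.one_mul]
    calc C.map γ = C.map γ * (m.hatE v).map γ := by rw [← Matrix.map_mul, h3]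
      _ = C.map γ * B * C := by rw [hE, ← hBC, Matrix.mul_assoc]
      _ = ρ' * C := by rw [h2]
  have hDB : (B.map (hatDeriv L v D)).map γ = (B.map γ).map (hatDeriv L v D) := by
    refine Matrix.ext fun i j => ?_
    exact completedMap_hatDeriv v D _ _
  have h4 : galHat Fq L v g (C * B.map (hatDeriv L v D)).trace =
      (C.map γ * (B.map (hatDeriv L v D)).map γ).trace := by
    rw [← Matrix.map_mul]
    exact map_sum γ _ _
  have h5 : ρ.map (hatDeriv L v D) =
      scalarMatrix Fq L ((𝓜.galRepMatrix v b g).1.map (adicDeriv v D)) := by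
    refine Matrix.ext fun i j => ?_
    exact hatDeriv_algebraMap_adic v D _
  rw [h4, hDB, hC, hB, Derivation.map_matrix_mul, Matrix.mul_add, Matrix.trace_add]
  congr 1
  · rw [Matrix.trace_mul_comm, Matrix.mul_assoc, ← Matrix.mul_assoc ρ, hρ, Matrix.one_mul,
      Matrix.trace_mul_comm]
  · rw [Matrix.mul_assoc, ← Matrix.mul_assoc C, hCB, Matrix.one_mul, h5]
    simp only [ρ', scalarMatrix]
    rw [← Matrix.map_mul]
    exact (map_sum (algebraMap (AdicCompletion v A) _) _ _).symm

end

/-- If the trace of `Ψ DΦ` is divisible by `f ^ 2`, then the logarithmic derivative of the Galois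
representation has only finitely many traces. -/
theorem finite_range_trace [v.IsMaximal] (hfin : ∀ n, Finite (A ⧸ v ^ n))
    (hf : f ∈ (idealJ Fq A L) ^ m.n)
    (hw : algebraMap _ (CompletedCoeff Fq v (SeparableClosure L)) f * w = 1)
    (hDf : coeffDeriv L D f = 0) {t : A ⊗[Fq] L}
    (ht : (m.Ψ f * (semilinearMatrix m.i m.π (m.φ f)).map (coeffDeriv L D)).trace = f * f * t)
    (b : Module.Basis (Fin r) (AdicCompletion v A) (𝓜.tateModule v)) :
    (Set.range fun g : Gal(SeparableClosure L/L) =>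
      (((𝓜.galRepMatrix v b g)⁻¹ : Matrix.GeneralLinearGroup (Fin r) (AdicCompletion v A)).1 *
        (𝓜.galRepMatrix v b g).1.map (adicDeriv v D)).trace).Finite := by
  obtain ⟨C, hCB, hBC⟩ := m.exists_dual_basisMatrix hfin hf hw b
  obtain ⟨h₀, hh₀, hfin₀⟩ := exists_sub_frob_eq t
  have h1 := m.trace_eq_add_frob D hf hw hCB hBC hDf ht
  have h2 := fun g => m.galHat_trace D hCB hBC g
  generalize (C * (m.basisMatrix b).map (hatDeriv L v D)).trace = h at h1 h2
  let ι := algebraMap (A ⊗[Fq] SeparableClosure L) (CompletedCoeff Fq v (SeparableClosure L))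
  -- h and h₀ solve the same Artin–Schreier equation, so their difference comes from A_v and is
  -- Galois-invariant. Hence h and h₀ have the same differences of conjugates.
  have h3 : completedMap Fq v (frob Fq A (SeparableClosure L)) (h - ι h₀) = h - ι h₀ := by
    have h4 : completedMap Fq v (frob Fq A (SeparableClosure L)) (ι h₀) =
        ι (frob Fq A (SeparableClosure L) h₀) := adicMap_algebraMap _ _ _ _ _
    have h5 : ι h₀ - ι (frob Fq A (SeparableClosure L) h₀) = algebraMap _ _ t := by
      rw [← RingHom.map_sub, hh₀]
      rfl
    rw [map_sub, h4]
    linear_combination h5 - h1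
  obtain ⟨c, hc⟩ := exists_algebraMap_eq_of_frob_eq h3
  refine Set.Finite.of_finite_image (f := algebraMap (AdicCompletion v A)
    (CompletedCoeff Fq v (SeparableClosure L))) ?_ (adic_algebraMap_injective v).injOn
  refine (hfin₀.image ι).subset ?_
  rintro _ ⟨_, ⟨g, rfl⟩, rfl⟩
  refine ⟨_, ⟨g, rfl⟩, ?_⟩
  have h6 := h2 g
  have h7 : galHat Fq L v g (algebraMap (AdicCompletion v A) _ c) = algebraMap _ _ c :=
    completedMap_algebraMap Fq v _ c
  have h8 : galHat Fq L v g (ι h₀) = ι (coeffMap Fq A (g.toAlgHom.restrictScalars Fq) h₀) :=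
    adicMap_algebraMap _ _ _ (coeffIdeal_map_le Fq v _) _
  have h9 : h = algebraMap (AdicCompletion v A) _ c + ι h₀ := by rw [hc]; ring
  simp only
  rw [h9, map_add, h7, h8] at h6
  rw [RingHom.map_sub]
  linear_combination h6

end AMotive.MatrixModel

end Trace

/-! ### The ideal J and its local ring -/

section IdealJ

variable {Fq A L : Type*} [Field Fq] [CommRing A] [Algebra Fq A]
  [Field L] [Algebra Fq L] [Algebra A L]

attribute [local instance] Algebra.TensorProduct.rightAlgebra

variable (Fq L) in
/-- The generator `a ⊗ 1 - 1 ⊗ γ(a)` of `J`. -/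
def generatorJ (a : A) : A ⊗[Fq] L := a ⊗ₜ 1 - 1 ⊗ₜ algebraMap A L a

theorem generatorJ_mem (a : A) : generatorJ Fq L a ∈ idealJ Fq A L :=
  Ideal.subset_span ⟨a, rfl⟩

variable [IsScalarTower Fq A L]

variable (Fq A L) in
/-- The multiplication `A ⊗ L → L`, with kernel `J`. -/
def evalJ : A ⊗[Fq] L →ₐ[Fq] L :=
  Algebra.TensorProduct.lift (IsScalarTower.toAlgHom Fq A L) (AlgHom.id Fq L)
    fun _ _ => Commute.all _ _

theorem evalJ_tmul (a : A) (l : L) : evalJ Fq A L (a ⊗ₜ l) = algebraMap A L a * l := by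
  simp [evalJ]

theorem sub_evalJ_mem (x : A ⊗[Fq] L) : x - 1 ⊗ₜ evalJ Fq A L x ∈ idealJ Fq A L := by
  induction x with
  | zero => simp
  | add x y hx hy =>
    rw [map_add, TensorProduct.tmul_add, add_sub_add_comm]
    exact Ideal.add_mem _ hx hy
  | tmul a l =>
    have : a ⊗ₜ l - 1 ⊗ₜ evalJ Fq A L (a ⊗ₜ l) = generatorJ Fq L a * (1 ⊗ₜ l) := by
      rw [evalJ_tmul, generatorJ, sub_mul, Algebra.TensorProduct.tmul_mul_tmul,
        Algebra.TensorProduct.tmul_mul_tmul]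
      simp
    rw [this]
    exact Ideal.mul_mem_right _ _ (generatorJ_mem a)

theorem ker_evalJ : RingHom.ker (evalJ Fq A L) = idealJ Fq A L := by
  apply le_antisymm
  · intro x hx
    have := sub_evalJ_mem x
    rwa [RingHom.mem_ker.mp hx, TensorProduct.tmul_zero, sub_zero] at this
  · rw [idealJ, Ideal.span_le]
    rintro _ ⟨a, rfl⟩
    change evalJ Fq A L _ = 0
    rw [map_sub, evalJ_tmul, evalJ_tmul]
    simp

theorem isMaximal_idealJ : (idealJ Fq A L).IsMaximal := by
  rw [← ker_evalJ]
  exact RingHom.ker_isMaximal_of_surjective _ fun l => ⟨1 ⊗ₜ l, by rw [evalJ_tmul]; simp⟩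

theorem exists_sub_algebraMap_mem_idealJ (x : A ⊗[Fq] L) :
    ∃ l : L, x - algebraMap L (A ⊗[Fq] L) l ∈ idealJ Fq A L :=
  ⟨_, sub_evalJ_mem x⟩

variable [(idealJ Fq A L).IsMaximal]

/-- If every element of `A` is a simple root of a polynomial over `Fq[x]`, then
`x ⊗ 1 - 1 ⊗ γ(x)` generates `J` locally at `J`. -/
theorem maximalIdeal_eq_span_generatorJ (hγ : Function.Injective (algebraMap A L)) (x : A)
    (hx : ∀ b : A, ∃ f : Polynomial (Polynomial Fq),
      f.eval₂ (Polynomial.aeval x : Polynomial Fq →ₐ[Fq] A).toRingHom b = 0 ∧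
      f.derivative.eval₂ (Polynomial.aeval x : Polynomial Fq →ₐ[Fq] A).toRingHom b ≠ 0) :
    IsLocalRing.maximalIdeal (Localization.AtPrime (idealJ Fq A L)) =
      Ideal.span {algebraMap (A ⊗[Fq] L) _ (generatorJ Fq L x)} := by
  let O := Localization.AtPrime (idealJ Fq A L)
  let s : O := algebraMap (A ⊗[Fq] L) O (generatorJ Fq L x)
  have hmem : ∀ y ∈ idealJ Fq A L, algebraMap (A ⊗[Fq] L) O y ∈ IsLocalRing.maximalIdeal O := by
    intro y hy
    rw [← Localization.AtPrime.map_eq_maximalIdeal]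
    exact Ideal.mem_map_of_mem _ hy
  apply le_antisymm
  · rw [← Localization.AtPrime.map_eq_maximalIdeal]
    refine Ideal.map_le_iff_le_comap.mpr (Ideal.span_le.mpr ?_)
    rintro _ ⟨b, rfl⟩
    obtain ⟨f, hf, hf'⟩ := hx b
    let q : O →+* O ⧸ Ideal.span {s} := Ideal.Quotient.mk _
    let α : A →ₐ[Fq] O := (IsScalarTower.toAlgHom Fq (A ⊗[Fq] L) O).comp
      Algebra.TensorProduct.includeLeft
    let β : L →ₐ[Fq] O := (IsScalarTower.toAlgHom Fq (A ⊗[Fq] L) O).comp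
      Algebra.TensorProduct.includeRight
    let γ : A →ₐ[Fq] L := IsScalarTower.toAlgHom Fq A L
    let qa : O →ₐ[Fq] O ⧸ Ideal.span {s} := Ideal.Quotient.mkₐ Fq _
    -- Modulo s, b ⊗ 1 and 1 ⊗ γ(b) are roots of one polynomial. With δ their difference, Taylor
    -- expansion at 1 ⊗ γ(b) gives (f'(γ(b)) + k δ) δ ≡ 0. Here f'(γ(b)) is a nonzero constant of L
    -- and δ lies in the maximal ideal, so δ ∈ (s).
    have hxx : q (α x) = q (β (γ x)) := by
      rw [← sub_eq_zero, ← map_sub]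
      refine Ideal.Quotient.eq_zero_iff_mem.mpr ?_
      refine Ideal.mem_span_singleton.mpr (dvd_of_eq ?_)
      exact map_sub (algebraMap (A ⊗[Fq] L) O) _ _
    have hθ : (qa.comp α).comp (Polynomial.aeval x : Polynomial Fq →ₐ[Fq] A) =
        (qa.comp (β.comp γ)).comp (Polynomial.aeval x) := by
      apply Polynomial.algHom_ext
      change qa (α (Polynomial.aeval x Polynomial.X)) = qa (β (γ (Polynomial.aeval x Polynomial.X)))
      rw [Polynomial.aeval_X]
      exact hxx
    let θ : Polynomial Fq →+* O ⧸ Ideal.span {s} :=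
      ((qa.comp α).comp (Polynomial.aeval x : Polynomial Fq →ₐ[Fq] A)).toRingHom
    have h1 : ∀ g : Polynomial (Polynomial Fq), (g.map θ).eval (q (α b)) =
        q (α (g.eval₂ (Polynomial.aeval x : Polynomial Fq →ₐ[Fq] A).toRingHom b)) := by
      intro g
      rw [Polynomial.eval_map]
      exact (Polynomial.hom_eval₂ g (Polynomial.aeval x : Polynomial Fq →ₐ[Fq] A).toRingHom
        (qa.comp α).toRingHom b).symm
    have h2 : ∀ g : Polynomial (Polynomial Fq), (g.map θ).eval (q (β (γ b))) =
        q (β (γ (g.eval₂ (Polynomial.aeval x : Polynomial Fq →ₐ[Fq] A).toRingHom b))) := by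
      intro g
      have : θ = ((qa.comp (β.comp γ)).comp
        (Polynomial.aeval x : Polynomial Fq →ₐ[Fq] A)).toRingHom := by rw [← hθ]
      rw [Polynomial.eval_map, this]
      exact (Polynomial.hom_eval₂ g (Polynomial.aeval x : Polynomial Fq →ₐ[Fq] A).toRingHom
        (qa.comp (β.comp γ)).toRingHom b).symm
    let δ : O := algebraMap (A ⊗[Fq] L) O (generatorJ Fq L b)
    have hδ : q (α b) = q (β (γ b)) + q δ := by
      rw [← map_add]
      congr 1
      have : δ = α b - β (γ b) := map_sub (algebraMap (A ⊗[Fq] L) O) _ _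
      rw [this]; ring
    obtain ⟨k, hk⟩ := Polynomial.binomExpansion (f.map θ) (q (β (γ b))) (q δ)
    rw [← hδ, h1, h2, hf, map_zero, map_zero, map_zero, map_zero, map_zero, zero_add,
      Polynomial.derivative_map, h2] at hk
    obtain ⟨k, rfl⟩ := Ideal.Quotient.mk_surjective k
    set u := β (γ (f.derivative.eval₂ (Polynomial.aeval x : Polynomial Fq →ₐ[Fq] A).toRingHom b))
      with hu
    have huu : IsUnit u := by
      have h3 : γ (f.derivative.eval₂ (Polynomial.aeval x : Polynomial Fq →ₐ[Fq] A).toRingHom b) ≠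
        0 := fun h => hf' (hγ (h.trans (map_zero _).symm))
      exact (isUnit_iff_ne_zero.mpr h3).map β
    have hunit : IsUnit (u + k * δ) := by
      by_contra hc
      have h4 : u ∈ IsLocalRing.maximalIdeal O := by
        have h5 : u = (u + k * δ) - k * δ := by ring
        rw [h5]
        exact Ideal.sub_mem _ ((IsLocalRing.mem_maximalIdeal _).mpr hc)
          (Ideal.mul_mem_left _ _ (hmem _ (generatorJ_mem b)))
      exact (IsLocalRing.mem_maximalIdeal _).mp h4 huu
    have h6 : (u + k * δ) * δ ∈ Ideal.span {s} := by
      rw [← Ideal.Quotient.eq_zero_iff_mem, map_mul, map_add, map_mul]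
      refine Eq.trans ?_ hk.symm
      change (q u + q k * q δ) * q δ = q u * q δ + q k * q δ ^ 2
      ring
    exact (Ideal.unit_mul_mem_iff_mem _ hunit).mp h6
  · rw [Ideal.span_le, Set.singleton_subset_iff]
    exact hmem _ (generatorJ_mem x)

/-- The local ring of `Spec A_L` at `J` is a discrete valuation ring. -/
theorem isDiscreteValuationRing_atPrime_idealJ [Algebra.FiniteType Fq A]
    (hγ : Function.Injective (algebraMap A L)) (x : A)
    (hx : ∀ b : A, ∃ f : Polynomial (Polynomial Fq),
      f.eval₂ (Polynomial.aeval x : Polynomial Fq →ₐ[Fq] A).toRingHom b = 0 ∧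
      f.derivative.eval₂ (Polynomial.aeval x : Polynomial Fq →ₐ[Fq] A).toRingHom b ≠ 0)
    (hs : generatorJ Fq L x ∈ (A ⊗[Fq] L)⁰) :
    ∃ _ : IsDomain (Localization.AtPrime (idealJ Fq A L)),
      IsDiscreteValuationRing (Localization.AtPrime (idealJ Fq A L)) ∧
      Irreducible (algebraMap (A ⊗[Fq] L) (Localization.AtPrime (idealJ Fq A L))
        (generatorJ Fq L x)) := by
  have hnoeth : IsNoetherianRing (A ⊗[Fq] L) := by
    have : IsNoetherianRing (L ⊗[Fq] A) := Algebra.FiniteType.isNoetherianRing L _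
    exact isNoetherianRing_of_ringEquiv _ (Algebra.TensorProduct.comm Fq L A).toRingEquiv
  have : IsNoetherianRing (Localization.AtPrime (idealJ Fq A L)) :=
    IsLocalization.isNoetherianRing (idealJ Fq A L).primeCompl _ hnoeth
  exact isDiscreteValuationRing_of_maximalIdeal_eq_span
    (IsLocalization.nonZeroDivisors_le_comap (idealJ Fq A L).primeCompl _ hs)
    (maximalIdeal_eq_span_generatorJ hγ x hx)

end IdealJ

/-! ### Passing between idempotent matrices and square matrices -/

section Sandwich

variable {O ι κ : Type*} [CommRing O] [Fintype ι] [Fintype κ]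
  {E E' Φ Ψ : Matrix ι ι O} {P P₁ : Matrix ι κ O} {Q Q₁ : Matrix κ ι O} {c : O}

theorem sandwich_mul [DecidableEq κ] (hPQ : P * Q = E) (hQP : Q * P = 1) (hPQ₁ : P₁ * Q₁ = E') (hE : E' * Ψ = Ψ)
    (h : Φ * Ψ = c • E) : (Q * Φ * P₁) * (Q₁ * Ψ * P) = c • (1 : Matrix κ κ O) :=
  calc (Q * Φ * P₁) * (Q₁ * Ψ * P) = Q * (Φ * ((P₁ * Q₁) * Ψ)) * P := by
        simp only [Matrix.mul_assoc]
    _ = c • ((Q * P) * (Q * P)) := by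
        rw [hPQ₁, hE, h, ← hPQ]
        simp only [Matrix.mul_smul, Matrix.smul_mul, Matrix.mul_assoc]
    _ = c • (1 : Matrix κ κ O) := by rw [hQP, Matrix.mul_one]

theorem sandwich_eq (hPQ : P * Q = E) (hPQ₁ : P₁ * Q₁ = E') (hE : E * Φ = Φ) (hE' : Φ * E' = Φ) :
    P * (Q * Φ * P₁) * Q₁ = Φ :=
  calc P * (Q * Φ * P₁) * Q₁ = (P * Q) * Φ * (P₁ * Q₁) := by simp only [Matrix.mul_assoc]
    _ = Φ := by rw [hPQ, hPQ₁, hE, hE']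

/-- Modulo `c`, the trace of `Ψ DΦ` does not change on passing to bases of the images of the
idempotents. -/
theorem dvd_trace_of_dvd_trace_sandwich [DecidableEq κ] {k : Type*} [CommRing k] [Algebra k O]
    (D : Derivation k O O)
    (hPQ : P * Q = E) (hQP : Q * P = 1) (hPQ₁ : P₁ * Q₁ = E') (hQP₁ : Q₁ * P₁ = 1)
    (hEΦ : E * Φ = Φ) (hΦE : Φ * E' = Φ) (hEΨ : E' * Ψ = Ψ) (hΨE : Ψ * E = Ψ)
    (h : Φ * Ψ = c • E) (h' : Ψ * Φ = c • E')
    (hdvd : c ∣ ((Q₁ * Ψ * P) * (Q * Φ * P₁).map D).trace) :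
    c ∣ (Ψ * Φ.map D).trace := by
  have hXY := sandwich_mul hPQ hQP hPQ₁ hEΨ h
  have hYX := sandwich_mul hPQ₁ hQP₁ hPQ hEΦ h'
  have hΦ := sandwich_eq hPQ hPQ₁ hEΦ hΦE
  have hΨ := sandwich_eq hPQ₁ hPQ hEΨ hΨE
  generalize Q * Φ * P₁ = X at *
  generalize Q₁ * Ψ * P = Y at *
  -- In D(P X Q₁) the terms with DP and DQ₁ contribute multiples of c, because X Y = Y X = c.
  have key : (Ψ * Φ.map D).trace =
      (Y * X.map D).trace + c * ((Q * P.map D).trace + (P₁ * Q₁.map D).trace) := by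
    rw [← hΦ, ← hΨ, D.map_matrix_mul, D.map_matrix_mul]
    simp only [Matrix.mul_add, Matrix.add_mul, Matrix.trace_add]
    have h1 : (P₁ * Y * Q * (P.map D * X * Q₁)).trace = c * (Q * P.map D).trace := by
      calc (P₁ * Y * Q * (P.map D * X * Q₁)).trace
          = (P₁ * (Y * Q * (P.map D * X) * Q₁)).trace := by simp only [Matrix.mul_assoc]
        _ = (Y * Q * (P.map D * X) * (Q₁ * P₁)).trace := by
          rw [Matrix.trace_mul_comm]; simp only [Matrix.mul_assoc]
        _ = ((Y * Q * P.map D) * X).trace := by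
          rw [hQP₁, Matrix.mul_one]; simp only [Matrix.mul_assoc]
        _ = ((X * Y) * (Q * P.map D)).trace := by
          rw [Matrix.trace_mul_comm]; simp only [Matrix.mul_assoc]
        _ = c * (Q * P.map D).trace := by
          rw [hXY, Matrix.smul_mul, Matrix.one_mul, Matrix.trace_smul, smul_eq_mul]
    have h2 : (P₁ * Y * Q * (P * X.map D * Q₁)).trace = (Y * X.map D).trace := by
      calc (P₁ * Y * Q * (P * X.map D * Q₁)).trace
          = (P₁ * (Y * (Q * P) * X.map D * Q₁)).trace := by simp only [Matrix.mul_assoc]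
        _ = (Y * (Q * P) * X.map D * (Q₁ * P₁)).trace := by
          rw [Matrix.trace_mul_comm]; simp only [Matrix.mul_assoc]
        _ = (Y * X.map D).trace := by rw [hQP, hQP₁, Matrix.mul_one, Matrix.mul_one]
    have h3 : (P₁ * Y * Q * (P * X * Q₁.map D)).trace = c * (P₁ * Q₁.map D).trace := by
      calc (P₁ * Y * Q * (P * X * Q₁.map D)).trace
          = (P₁ * (Y * (Q * P) * X) * Q₁.map D).trace := by simp only [Matrix.mul_assoc]
        _ = c * (P₁ * Q₁.map D).trace := by
          rw [hQP, Matrix.mul_one, hYX, Matrix.mul_smul, Matrix.mul_one, Matrix.smul_mul,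
            Matrix.trace_smul, smul_eq_mul]
    rw [h1, h2, h3]
    ring
  rw [key]
  exact dvd_add hdvd (dvd_mul_right _ _)

end Sandwich

/-! ### Finite length of cokernels -/

section CokernelLength

variable {O : Type*} [CommRing O] [IsDomain O] [IsDiscreteValuationRing O] {s : O}

theorem length_quotient_range_smul_one (hs : Irreducible s) (r k : ℕ) :
    Module.length O ((Fin r → O) ⧸
      LinearMap.range (s ^ k • (1 : Matrix (Fin r) (Fin r) O)).mulVecLin) = (r * k : ℕ) := by
  rw [Matrix.smul_one_eq_diagonal, length_quotient_range_diagonal]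
  have h1 : Module.length O (O ⧸ Ideal.span {s ^ k}) = k := by
    rw [← Ideal.span_singleton_pow, ← hs.maximalIdeal_eq,
      IsDiscreteValuationRing.length_quotient_pow_maximalIdeal]
  simp [h1]

/-- The cokernel of X is a quotient of (O/s^k)^r, since X Y = s^k. -/
theorem exists_length_quotient_range_eq (hs : Irreducible s) {r k : ℕ}
    {X Y : Matrix (Fin r) (Fin r) O} (hXY : X * Y = s ^ k • (1 : Matrix (Fin r) (Fin r) O)) :
    ∃ ν : ℕ, Module.length O ((Fin r → O) ⧸ LinearMap.range X.mulVecLin) = ν := by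
  have h : LinearMap.range (s ^ k • (1 : Matrix (Fin r) (Fin r) O)).mulVecLin ≤
      LinearMap.range X.mulVecLin := by
    rw [← hXY, Matrix.mulVecLin_mul]
    exact LinearMap.range_comp_le_range _ _
  have h1 := Module.length_le_of_surjective _ (Submodule.factor_surjective h)
  rw [length_quotient_range_smul_one hs] at h1
  exact ⟨_, (ENat.natCast_toNat (ne_top_of_le_ne_top (ENat.natCast_ne_top _) h1)).symm⟩

end CokernelLength

/-! ### Relative dimension under injective maps -/

section RelDim

variable {Fq A L : Type*} [Field Fq] [CommRing A] [Algebra Fq A] [Field L] [Algebra Fq L]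
  {V V' : Type*} [AddCommGroup V] [Module (A ⊗[Fq] L) V] [AddCommGroup V'] [Module (A ⊗[Fq] L) V']

theorem relDim_map {g : V →ₗ[A ⊗[Fq] L] V'} (hg : Function.Injective g)
    (X Y : Submodule (A ⊗[Fq] L) V) : relDim (X.map g) (Y.map g) = relDim X Y := by
  let _ : Algebra L (A ⊗[Fq] L) := Algebra.TensorProduct.rightAlgebra
  let e : X ≃ₗ[A ⊗[Fq] L] X.map g := Submodule.equivMapOfInjective g hg X
  have he : ((X ⊓ Y).submoduleOf X).map (e : X →ₗ[A ⊗[Fq] L] X.map g) =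
      (X.map g ⊓ Y.map g).submoduleOf (X.map g) := by
    rw [← Submodule.map_inf g hg]
    ext ⟨z, hz⟩
    constructor
    · rintro ⟨y, hy, hyz⟩
      exact ⟨y, hy, congrArg Subtype.val hyz⟩
    · rintro ⟨y, hy, hyz⟩
      exact ⟨⟨y, hy.1⟩, hy, Subtype.ext hyz⟩
  let e' := Submodule.Quotient.equiv _ _ e he
  let e'' : RestrictScalars L (A ⊗[Fq] L) (X ⧸ (X ⊓ Y).submoduleOf X) ≃ₗ[L]
      RestrictScalars L (A ⊗[Fq] L) (X.map g ⧸ (X.map g ⊓ Y.map g).submoduleOf (X.map g)) :=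
    { e' with map_smul' := fun l x => e'.map_smul (algebraMap L (A ⊗[Fq] L) l) x }
  exact e''.finrank_eq.symm

end RelDim

/-! ### Regularity of the trace away from J -/

section TraceRelations

variable {Fq A L : Type*} [Field Fq] [CommRing A] [Algebra Fq A] [Field L] [Algebra Fq L]

theorem coeffMap_injective {K K' : Type*} [Field K] [Algebra Fq K] [Field K'] [Algebra Fq K']
    (f : K →ₐ[Fq] K') : Function.Injective (coeffMap Fq A f) :=
  Module.Flat.lTensor_preserves_injective_linearMap f.toLinearMap f.injective

theorem completedCoeff_algebraMap_injective {v : Ideal A} (hv : ⨅ n, v ^ n = ⊥) :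
    Function.Injective
      (algebraMap (A ⊗[Fq] L) (CompletedCoeff Fq v (SeparableClosure L))) :=
  (coeff_algebraMap_injective v hv).comp (coeffMap_injective _)

theorem completedMatrix_injective {v : Ideal A} (hv : ⨅ n, v ^ n = ⊥) {m n : Type*} :
    Function.Injective (completedMatrix (m := m) (n := n) Fq L v) :=
  Matrix.map_injective (completedCoeff_algebraMap_injective hv)

variable [Fintype Fq] [Algebra A L] {r : ℕ} {M : Type*} [AddCommGroup M]
  [Module (A ⊗[Fq] L) M] {𝓜 : AMotive Fq A L r M}

namespace AMotive.MatrixModel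

variable (m : 𝓜.MatrixModel) {v : Ideal A} {f g : A ⊗[Fq] L}
  {w : CompletedCoeff Fq v (SeparableClosure L)}

/-- The model only records Φ Ψ. The opposite product is read off in A_{v,L^sep}, where F and G are
expressed through a basis of invariants, and A ⊗ L embeds there. -/
theorem Ψ_mul_semilinearMatrix [v.IsMaximal] (hfin : ∀ n, Finite (A ⧸ v ^ n))
    (hv : ⨅ n, v ^ n = ⊥) (hf : f ∈ (idealJ Fq A L) ^ m.n)
    (hw : algebraMap _ (CompletedCoeff Fq v (SeparableClosure L)) f * w = 1) :
    m.Ψ f * semilinearMatrix m.i m.π (m.φ f) =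
      (f * f) • (idempotentMatrix m.i m.π).map (frob Fq A L) := by
  obtain ⟨b, C, hCB, hBC⟩ := m.exists_tate_basis hfin hf hw
  have h1 : m.hatG v f w * m.hatF v f w =
      (m.hatE v).map (completedMap Fq v (frob Fq A (SeparableClosure L))) := by
    rw [m.hatG_eq hf hw hCB hBC, m.hatF_eq hf hw hBC, ← hBC, Matrix.map_mul, Matrix.mul_assoc,
      ← Matrix.mul_assoc C, hCB, Matrix.one_mul]
  apply completedMatrix_injective (L := L) hv
  rw [completedMatrix_smul, ← completedMatrix_frob, completedMatrix_mul]
  change _ = _ • (m.hatE v).map _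
  rw [← h1, hatG, hatF, Matrix.smul_mul, Matrix.mul_smul, smul_smul, smul_smul, map_mul]
  have : algebraMap (A ⊗[Fq] L) (CompletedCoeff Fq v (SeparableClosure L)) f *
      algebraMap (A ⊗[Fq] L) (CompletedCoeff Fq v (SeparableClosure L)) f * (w * w) = 1 := by
    linear_combination (algebraMap (A ⊗[Fq] L) (CompletedCoeff Fq v (SeparableClosure L)) f * w + 1)
      * hw
  rw [← mul_assoc] at this
  rw [this, one_smul]

/-- Evaluate Ψ_f Φ_f Ψ_g in two ways and cancel f. -/
theorem smul_Ψ_eq (hf : f ∈ (idealJ Fq A L) ^ m.n) (hg : g ∈ (idealJ Fq A L) ^ m.n)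
    (hf0 : f ∈ (A ⊗[Fq] L)⁰)
    (h : m.Ψ f * semilinearMatrix m.i m.π (m.φ f) =
      (f * f) • (idempotentMatrix m.i m.π).map (frob Fq A L)) :
    f • m.Ψ g = g • m.Ψ f := by
  have h1 : (f * f) • m.Ψ g = (f * g) • m.Ψ f := by
    calc (f * f) • m.Ψ g = m.Ψ f * semilinearMatrix m.i m.π (m.φ f) * m.Ψ g := by
          rw [h, Matrix.smul_mul, m.E_Ψ]
      _ = (f * g) • m.Ψ f := by rw [Matrix.mul_assoc, m.Φ_Ψ f hf g hg, Matrix.mul_smul, m.Ψ_E]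
  refine Matrix.ext fun j k => ?_
  have h2 := congrFun (congrFun h1 j) k
  simp only [Matrix.smul_apply, smul_eq_mul, mul_assoc] at h2
  exact (mul_cancel_left_mem_nonZeroDivisors hf0).mp h2

theorem smul_Φ_eq (hf : f ∈ (idealJ Fq A L) ^ m.n) (hg : g ∈ (idealJ Fq A L) ^ m.n) :
    f • semilinearMatrix m.i m.π (m.φ g) = g • semilinearMatrix m.i m.π (m.φ f) :=
  smul_semilinearMatrix_eq fun x => 𝓜.mkLinearMap_injective (by
    rw [map_smul, map_smul, m.mk_φ f hf, m.mk_φ g hg, smul_comm])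

/-- The dependence of the trace of `Ψ DΦ` on the denominator. -/
theorem mul_trace_eq (D : Derivation Fq A A) (hf : f ∈ (idealJ Fq A L) ^ m.n)
    (hg : g ∈ (idealJ Fq A L) ^ m.n) (hf0 : f ∈ (A ⊗[Fq] L)⁰)
    (h : m.Ψ f * semilinearMatrix m.i m.π (m.φ f) =
      (f * f) • (idempotentMatrix m.i m.π).map (frob Fq A L))
    (hDf : coeffDeriv L D f = 0) (hDg : coeffDeriv L D g = 0) :
    g * g * (m.Ψ f * (semilinearMatrix m.i m.π (m.φ f)).map (coeffDeriv L D)).trace =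
      f * f * (m.Ψ g * (semilinearMatrix m.i m.π (m.φ g)).map (coeffDeriv L D)).trace := by
  have hD : ∀ {c : A ⊗[Fq] L}, coeffDeriv L D c = 0 → ∀ X : Matrix (Fin m.N) (Fin m.N) (A ⊗[Fq] L),
      (c • X).map (coeffDeriv L D) = c • X.map (coeffDeriv L D) := by
    intro c hc X
    refine Matrix.ext fun j k => ?_
    change coeffDeriv L D (c * X j k) = c * coeffDeriv L D (X j k)
    rw [Derivation.leibniz, hc, smul_zero, add_zero, smul_eq_mul]
  rw [← smul_eq_mul (g * g), ← smul_eq_mul (f * f), ← Matrix.trace_smul, ← Matrix.trace_smul, mul_smul, mul_smul,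
    ← Matrix.smul_mul, ← Matrix.mul_smul, ← hD hDg, ← m.smul_Φ_eq hf hg, ← m.smul_Ψ_eq hf hg hf0 h,
    hD hDf, Matrix.mul_smul, Matrix.smul_mul]

/-- Divisibility of the trace of `Ψ DΦ` may be checked locally at `J`. -/
theorem mul_self_dvd_trace (D : Derivation Fq A A) [(idealJ Fq A L).IsMaximal] {n : ℕ}
    (hn : m.n ≤ n) (hn0 : (n : Fq) = 0) {x : A}
    (hs0 : generatorJ Fq L x ∈ (A ⊗[Fq] L)⁰)
    (h : m.Ψ (generatorJ Fq L x ^ n) * semilinearMatrix m.i m.π (m.φ (generatorJ Fq L x ^ n)) =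
      (generatorJ Fq L x ^ n * generatorJ Fq L x ^ n) •
        (idempotentMatrix m.i m.π).map (frob Fq A L))
    (hloc : algebraMap _ (Localization.AtPrime (idealJ Fq A L))
        (generatorJ Fq L x ^ n * generatorJ Fq L x ^ n) ∣
      algebraMap _ (Localization.AtPrime (idealJ Fq A L))
        (m.Ψ (generatorJ Fq L x ^ n) * (semilinearMatrix m.i m.π
          (m.φ (generatorJ Fq L x ^ n))).map (coeffDeriv L D)).trace) :
    generatorJ Fq L x ^ n * generatorJ Fq L x ^ n ∣
      (m.Ψ (generatorJ Fq L x ^ n) * (semilinearMatrix m.i m.π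
          (m.φ (generatorJ Fq L x ^ n))).map (coeffDeriv L D)).trace := by
  have hmem : ∀ a, generatorJ Fq L a ^ n ∈ (idealJ Fq A L) ^ m.n := fun a =>
    Ideal.pow_le_pow_right hn (Ideal.pow_mem_pow (generatorJ_mem a) n)
  have hD : ∀ a, coeffDeriv L D (generatorJ Fq L a ^ n) = 0 := by
    intro a
    have h1 : ((n : ℕ) : A ⊗[Fq] L) = 0 := by
      rw [← map_natCast (algebraMap Fq (A ⊗[Fq] L)), hn0, map_zero]
    rw [Derivation.leibniz_pow, ← Nat.cast_smul_eq_nsmul (A ⊗[Fq] L), h1, zero_smul]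
  have hf0 : generatorJ Fq L x ^ n ∈ (A ⊗[Fq] L)⁰ := pow_mem hs0 n
  have hrel := fun a => m.mul_trace_eq D (hmem x) (hmem a) hf0 h (hD x) (hD a)
  generalize (m.Ψ (generatorJ Fq L x ^ n) * (semilinearMatrix m.i m.π
    (m.φ (generatorJ Fq L x ^ n))).map (coeffDeriv L D)).trace = T at *
  generalize generatorJ Fq L x ^ n * generatorJ Fq L x ^ n = c at *
  -- I is the ideal of denominators of T / c. Changing the denominator by `hrel` puts a power of
  -- every generator of J into I, so a maximal ideal over I is J itself, and there `hloc` yields an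
  -- element of I outside J.
  let I : Ideal (A ⊗[Fq] L) := (Ideal.span {c}).colon {T}
  have hI : ∀ z, z ∈ I ↔ c ∣ z * T := by
    intro z
    rw [Submodule.mem_colon_singleton, smul_eq_mul, Ideal.mem_span_singleton]
  suffices hI1 : (1 : A ⊗[Fq] L) ∈ I by simpa [hI] using hI1
  by_contra hI1
  obtain ⟨𝔪, h𝔪, hle⟩ := Ideal.exists_le_maximal I ((Ideal.ne_top_iff_one I).mpr hI1)
  have hJ : idealJ Fq A L ≤ 𝔪 := by
    rw [idealJ, Ideal.span_le]
    rintro _ ⟨a, rfl⟩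
    have h1 : generatorJ Fq L a ^ n * generatorJ Fq L a ^ n ∈ I := by
      rw [hI, hrel a]
      exact dvd_mul_right _ _
    rw [← pow_add] at h1
    exact h𝔪.isPrime.mem_of_pow_mem _ (hle h1)
  have hJ' : idealJ Fq A L = 𝔪 := Ideal.IsMaximal.eq_of_le ‹_› h𝔪.ne_top hJ
  obtain ⟨y, hy⟩ := hloc
  obtain ⟨⟨a, t⟩, hat⟩ := IsLocalization.surj (idealJ Fq A L).primeCompl y
  have h2 : algebraMap _ (Localization.AtPrime (idealJ Fq A L)) (t * T) =
      algebraMap _ (Localization.AtPrime (idealJ Fq A L)) (c * a) := by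
    rw [map_mul, map_mul, hy, ← hat]
    ring
  obtain ⟨u, hu⟩ := (IsLocalization.eq_iff_exists (idealJ Fq A L).primeCompl _).mp h2
  have h3 : (u * t : A ⊗[Fq] L) ∈ I := by
    rw [hI, mul_assoc, hu, mul_left_comm]
    exact dvd_mul_right _ _
  exact (u * t).2 (hJ'.ge (hle h3))

end AMotive.MatrixModel

end TraceRelations

/-! ### The dimension as a difference of lengths at J -/

section Dimension

section

variable {R M : Type*} [CommRing R] [AddCommGroup M] [Module R M] {f : R}

theorem map_range_lsmul (f : R) :
    (LinearMap.range (LinearMap.lsmul R M f)).map (LocalizedModule.mkLinearMap R⁰ M) =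
    (LinearMap.range (LocalizedModule.mkLinearMap R⁰ M)).map
      (LinearMap.lsmul R (LocalizedModule R⁰ M) f) := by
  rw [← LinearMap.range_comp, ← LinearMap.range_comp]
  congr 1
  ext x
  simp

theorem lsmul_localizedModule_injective (hf0 : f ∈ R⁰) : Function.Injective
    (LinearMap.lsmul R (LocalizedModule R⁰ M) f) :=
  ((Module.End.isUnit_iff _).mp (IsLocalizedModule.map_units
    (LocalizedModule.mkLinearMap R⁰ M) ⟨f, hf0⟩)).1

end

variable {Fq A L : Type*} [Field Fq] [CommRing A] [Algebra Fq A] [Field L] [Algebra Fq L]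
  [Fintype Fq] [Algebra A L] {r : ℕ} {M : Type*} [AddCommGroup M]
  [Module (A ⊗[Fq] L) M] {𝓜 : AMotive Fq A L r M}

namespace AMotive.MatrixModel

variable (m : 𝓜.MatrixModel) {f : A ⊗[Fq] L}

theorem map_span_range_φ (hf : f ∈ (idealJ Fq A L) ^ m.n) :
    (Submodule.span (A ⊗[Fq] L) (Set.range (m.φ f))).map
      (LocalizedModule.mkLinearMap (A ⊗[Fq] L)⁰ M) =
    (Submodule.span (A ⊗[Fq] L) (Set.range 𝓜.τ)).map
      (LinearMap.lsmul (A ⊗[Fq] L) (LocalizedModule (A ⊗[Fq] L)⁰ M) f) := by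
  rw [Submodule.map_span, Submodule.map_span, ← Set.range_comp, ← Set.range_comp]
  congr 2
  ext x
  exact m.mk_φ f hf x

theorem pow_smul_range_lsmul_le (hf : f ∈ (idealJ Fq A L) ^ m.n) :
    (idealJ Fq A L) ^ m.n • LinearMap.range (LinearMap.lsmul (A ⊗[Fq] L) M f) ≤
      Submodule.span (A ⊗[Fq] L) (Set.range (m.φ f)) := by
  rw [← Submodule.map_le_map_iff_of_injective 𝓜.mkLinearMap_injective, Submodule.map_smul'',
    map_range_lsmul, m.map_span_range_φ hf, ← Submodule.map_smul'']
  exact Submodule.map_mono m.le_map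

theorem pow_smul_span_range_φ_le (hf : f ∈ (idealJ Fq A L) ^ m.n) :
    (idealJ Fq A L) ^ m.n • Submodule.span (A ⊗[Fq] L) (Set.range (m.φ f)) ≤
      LinearMap.range (LinearMap.lsmul (A ⊗[Fq] L) M f) := by
  rw [← Submodule.map_le_map_iff_of_injective 𝓜.mkLinearMap_injective, Submodule.map_smul'',
    map_range_lsmul, m.map_span_range_φ hf, ← Submodule.map_smul'']
  exact Submodule.map_mono m.map_le

/-- Multiplication by f is injective on the generic fibre, so the two lattices may be replaced by f
M and f τ(σ^* M), both contained in M. -/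
theorem dim_eq (hf : f ∈ (idealJ Fq A L) ^ m.n) (hf0 : f ∈ (A ⊗[Fq] L)⁰) :
    𝓜.dim =
      (relDim (LinearMap.range (LinearMap.lsmul (A ⊗[Fq] L) M f))
        (Submodule.span (A ⊗[Fq] L) (Set.range (m.φ f))) : ℤ) -
      (relDim (Submodule.span (A ⊗[Fq] L) (Set.range (m.φ f)))
        (LinearMap.range (LinearMap.lsmul (A ⊗[Fq] L) M f)) : ℤ) := by
  rw [← relDim_map 𝓜.mkLinearMap_injective, ← relDim_map 𝓜.mkLinearMap_injective,
    map_range_lsmul, m.map_span_range_φ hf, relDim_map (lsmul_localizedModule_injective hf0),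
    relDim_map (lsmul_localizedModule_injective hf0)]
  rfl

theorem dim_eq_sub [IsScalarTower Fq A L] [(idealJ Fq A L).IsMaximal]
    (hf : f ∈ (idealJ Fq A L) ^ m.n) (hf0 : f ∈ (A ⊗[Fq] L)⁰)
    {N : Type*} [AddCommGroup N] [Module (A ⊗[Fq] L) N]
    [Module (Localization.AtPrime (idealJ Fq A L)) N]
    [IsScalarTower (A ⊗[Fq] L) (Localization.AtPrime (idealJ Fq A L)) N]
    (ψ : M →ₗ[A ⊗[Fq] L] N) [IsLocalizedModule (idealJ Fq A L).primeCompl ψ] {a b : ℕ}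
    (ha : Module.length (Localization.AtPrime (idealJ Fq A L)) (N ⧸
      Submodule.span (Localization.AtPrime (idealJ Fq A L)) (Set.range fun x => ψ (f • x))) = a)
    (hb : Module.length (Localization.AtPrime (idealJ Fq A L)) (N ⧸
      Submodule.span (Localization.AtPrime (idealJ Fq A L)) (Set.range fun x => ψ (m.φ f x))) = b) :
    𝓜.dim = b - a := by
  let _ : Algebra L (A ⊗[Fq] L) := Algebra.TensorProduct.rightAlgebra
  have h1 : ψ '' (LinearMap.range (LinearMap.lsmul (A ⊗[Fq] L) M f)) =
      Set.range fun x => ψ (f • x) := by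
    rw [LinearMap.coe_range, ← Set.range_comp]
    rfl
  have h2 : Submodule.span (Localization.AtPrime (idealJ Fq A L))
      (ψ '' (Submodule.span (A ⊗[Fq] L) (Set.range (m.φ f)))) =
      Submodule.span _ (Set.range fun x => ψ (m.φ f x)) := by
    apply le_antisymm
    · rw [Submodule.span_le]
      rintro _ ⟨y, hy, rfl⟩
      have h3 : Submodule.span (A ⊗[Fq] L) (Set.range (m.φ f)) ≤
          ((Submodule.span (Localization.AtPrime (idealJ Fq A L))
            (Set.range fun x => ψ (m.φ f x))).restrictScalars (A ⊗[Fq] L)).comap ψ := by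
        rw [Submodule.span_le]
        rintro _ ⟨x, rfl⟩
        exact Submodule.subset_span ⟨x, rfl⟩
      exact h3 hy
    · apply Submodule.span_mono
      rintro _ ⟨x, rfl⟩
      exact ⟨_, Submodule.subset_span ⟨x, rfl⟩, rfl⟩
  rw [m.dim_eq hf hf0]
  refine finrank_sub_finrank_eq (idealJ Fq A L) exists_sub_algebraMap_mem_idealJ
    (m.pow_smul_range_lsmul_le hf) (m.pow_smul_span_range_φ_le hf) ?_ ?_
  · rw [lengthAt_quotient_eq (idealJ Fq A L) ψ, h1, ha]
  · rw [lengthAt_quotient_eq (idealJ Fq A L) ψ, h2, hb]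

end AMotive.MatrixModel

end Dimension

/-! ### Divisibility of the trace at J -/

section LocalTrace

variable {Fq A L : Type*} [Field Fq] [CommRing A] [Algebra Fq A] [Field L] [Algebra Fq L]
  [Fintype Fq] [Algebra A L] [IsScalarTower Fq A L] {r : ℕ} {M : Type*} [AddCommGroup M]
  [Module (A ⊗[Fq] L) M] {𝓜 : AMotive Fq A L r M}

theorem mul_eq_smul_one_comm {O : Type*} [CommRing O] [IsDomain O] {r : ℕ} {c : O} (hc : c ≠ 0)
    {X Y : Matrix (Fin r) (Fin r) O} (h : X * Y = c • (1 : Matrix (Fin r) (Fin r) O)) :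
    Y * X = c • (1 : Matrix (Fin r) (Fin r) O) := by
  have hX : X.det ≠ 0 := by
    intro h0
    have h1 := congrArg Matrix.det h
    rw [Matrix.det_mul, h0, zero_mul, Matrix.det_smul, Matrix.det_one, mul_one] at h1
    exact pow_ne_zero _ hc h1.symm
  have h1 : X * (Y * X) = X * (c • (1 : Matrix (Fin r) (Fin r) O)) := by
    rw [← Matrix.mul_assoc, h, Matrix.smul_mul, Matrix.one_mul, Matrix.mul_smul, Matrix.mul_one]
  have h2 := congrArg (X.adjugate * ·) h1
  simp only [← Matrix.mul_assoc, Matrix.adjugate_mul, Matrix.smul_mul, Matrix.one_mul] at h2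
  refine Matrix.ext fun i j => ?_
  exact mul_left_cancel₀ hX (congrFun (congrFun h2 i) j)

namespace AMotive.MatrixModel

variable (m : 𝓜.MatrixModel)

/-- In bases of im E and im σ(E) over O, Φ becomes a square matrix X with X Y = s^(2n). Its cokernel
has length ν = dim + r n, which is zero in Fq, so `pow_dvd_trace_derivation` applies. -/
theorem mul_self_dvd_localization_trace (D : Derivation Fq A A) [(idealJ Fq A L).IsMaximal]
    [IsDomain (Localization.AtPrime (idealJ Fq A L))]
    [IsDiscreteValuationRing (Localization.AtPrime (idealJ Fq A L))]
    {n : ℕ} (hn : m.n ≤ n) (hn0 : (n : Fq) = 0) (hd : (𝓜.dim : Fq) = 0) {x : A}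
    (hs0 : generatorJ Fq L x ∈ (A ⊗[Fq] L)⁰)
    (hs : Irreducible (algebraMap (A ⊗[Fq] L) (Localization.AtPrime (idealJ Fq A L))
        (generatorJ Fq L x)))
    (h : m.Ψ (generatorJ Fq L x ^ n) * semilinearMatrix m.i m.π (m.φ (generatorJ Fq L x ^ n)) =
      (generatorJ Fq L x ^ n * generatorJ Fq L x ^ n) •
        (idempotentMatrix m.i m.π).map (frob Fq A L)) :
    algebraMap _ (Localization.AtPrime (idealJ Fq A L))
        (generatorJ Fq L x ^ n * generatorJ Fq L x ^ n) ∣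
      algebraMap _ (Localization.AtPrime (idealJ Fq A L))
        (m.Ψ (generatorJ Fq L x ^ n) * (semilinearMatrix m.i m.π
          (m.φ (generatorJ Fq L x ^ n))).map (coeffDeriv L D)).trace := by
  have := 𝓜.finite
  have := 𝓜.projective
  let R := A ⊗[Fq] L
  let O := Localization.AtPrime (idealJ Fq A L)
  let σ : R →+* R := (frob Fq A L : A ⊗[Fq] L →+* A ⊗[Fq] L)
  let f : R := generatorJ Fq L x ^ n
  have hf : f ∈ (idealJ Fq A L) ^ m.n :=
    Ideal.pow_le_pow_right hn (Ideal.pow_mem_pow (generatorJ_mem x) n)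
  have hf0 : f ∈ R⁰ := pow_mem hs0 n
  let ι : R →+* O := algebraMap R O
  -- bases of the images of `E` and `σ(E)`
  let p : PrimeSpectrum R := ⟨idealJ Fq A L, inferInstance⟩
  -- A basis of im σ(E) at J is obtained from a basis of im E at the preimage of J under σ,
  -- transported by the local homomorphism κ.
  let p₁ : PrimeSpectrum R := ⟨(idealJ Fq A L).comap σ, inferInstance⟩
  obtain ⟨P, Q, hQP, hPQ, ψ, hψ, hψQ⟩ :=
    exists_factorization_atPrime m.i m.π m.π_i p (𝓜.rank_eq p)
  obtain ⟨P₀, Q₀, hQP₀, hPQ₀, -⟩ :=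
    exists_factorization_atPrime m.i m.π m.π_i p₁ (𝓜.rank_eq p₁)
  let κ : Localization.AtPrime p₁.asIdeal →+* O :=
    Localization.localRingHom p₁.asIdeal (idealJ Fq A L) σ rfl
  have hκ : ∀ y, κ (algebraMap R _ y) = ι (σ y) := fun y =>
    Localization.localRingHom_to_map _ _ _ _ y
  let P₁ := P₀.map κ
  let Q₁ := Q₀.map κ
  have hQP₁ : Q₁ * P₁ = 1 := by
    rw [← Matrix.map_mul, hQP₀]
    exact Matrix.map_one _ (map_zero _) (map_one _)
  let E := (idempotentMatrix m.i m.π).map ι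
  let E' := ((idempotentMatrix m.i m.π).map σ).map ι
  have hPQ₁ : P₁ * Q₁ = E' := by
    rw [← Matrix.map_mul, hPQ₀]
    refine Matrix.ext fun j k => ?_
    exact hκ _
  let Φ := (semilinearMatrix m.i m.π (m.φ f)).map ι
  let Ψ := (m.Ψ f).map ι
  have hEΦ : E * Φ = Φ := by
    rw [← Matrix.map_mul, idempotentMatrix_mul_semilinearMatrix m.π_i]
  have hΦE : Φ * E' = Φ := by
    rw [← Matrix.map_mul, semilinearMatrix_mul_idempotentMatrix m.π_i]
  have hEΨ : E' * Ψ = Ψ := by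
    rw [← Matrix.map_mul]
    exact congrArg (fun X => Matrix.map X ι) (m.E_Ψ f)
  have hΨE : Ψ * E = Ψ := by
    rw [← Matrix.map_mul, m.Ψ_E f]
  have hsmul : ∀ (c : R) (X : Matrix (Fin m.N) (Fin m.N) R), (c • X).map ι = ι c • X.map ι :=
    fun c X => Matrix.ext fun j k => map_mul ι c (X j k)
  have hΦΨ : Φ * Ψ = ι (f * f) • E := by
    rw [← Matrix.map_mul, m.Φ_Ψ f hf f hf, hsmul]
  have hΨΦ : Ψ * Φ = ι (f * f) • E' := by
    rw [← hsmul, ← Matrix.map_mul]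
    exact congrArg (fun X => Matrix.map X ι) h
  have hff : ι (f * f) = ι (generatorJ Fq L x) ^ (n + n) := by
    rw [← map_pow, pow_add]
  let X := Q * Φ * P₁
  let Y := Q₁ * Ψ * P
  have hXY : X * Y = ι (generatorJ Fq L x) ^ (n + n) • (1 : Matrix (Fin r) (Fin r) O) := by
    rw [← hff]
    exact sandwich_mul hPQ hQP hPQ₁ hEΨ hΦΨ
  have hYX := mul_eq_smul_one_comm (pow_ne_zero _ hs.ne_zero) hXY
  obtain ⟨ν, hν⟩ := exists_length_quotient_range_eq hs hXY
  -- the length of the cokernel of `X` and the dimension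
  have hspan : ∀ (Z : Matrix (Fin r) (Fin r) O) (u : M → Fin r → O),
      Submodule.span O (Set.range u) = ⊤ →
      Submodule.span O (Set.range fun y => Z *ᵥ u y) = LinearMap.range Z.mulVecLin := by
    intro Z u hu
    rw [← Submodule.map_top, ← hu, Submodule.map_span, ← Set.range_comp]
    rfl
  have hψf : Submodule.span O (Set.range fun y => ψ (f • y)) =
      LinearMap.range (ι (generatorJ Fq L x) ^ n • (1 : Matrix (Fin r) (Fin r) O)).mulVecLin := by
    rw [← hspan _ ψ]
    · congr 2
      ext1 y
      rw [Matrix.smul_mulVec, Matrix.one_mulVec, map_smul, ← map_pow]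
      exact (algebraMap_smul O f (ψ y)).symm
    · have h1 := span_eq_top_of_isLocalizedModule O (idealJ Fq A L).primeCompl ψ
        (v := Set.univ) Submodule.span_univ
      rwa [Set.image_univ] at h1
  have hψφ : Submodule.span O (Set.range fun y => ψ (m.φ f y)) = LinearMap.range X.mulVecLin := by
    rw [← hspan X fun y => Q₁ *ᵥ (ι ∘ σ ∘ m.i y)]
    · congr 2
      ext1 y
      have h1 : ι ∘ m.i (m.φ f y) = Φ *ᵥ (ι ∘ σ ∘ m.i y) := by
        rw [apply_semilinear m.π_i]
        ext j
        exact RingHom.map_mulVec ι _ _ j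
      rw [hψQ, Matrix.mulVec_mulVec, Matrix.mul_assoc, Matrix.mul_assoc, hPQ₁, hΦE,
        ← Matrix.mulVec_mulVec]
      exact congrArg (Q *ᵥ ·) h1
    -- Standard basis vectors are σ-invariant, so these elements are Q₁ applied to the columns of
    -- σ(E); they span although σ need not be surjective.
    · have h1 : ∀ k, Q₁ *ᵥ (ι ∘ σ ∘ m.i (m.π (Pi.single k 1))) = Q₁ *ᵥ Pi.single k 1 := by
        intro k
        have h2 : ι ∘ σ ∘ m.i (m.π (Pi.single k 1)) = E' *ᵥ Pi.single k 1 := by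
          rw [← idempotentMatrix_mulVec]
          ext j
          simp [E']
        rw [h2, Matrix.mulVec_mulVec, ← hPQ₁, ← Matrix.mul_assoc, hQP₁, Matrix.one_mul]
      rw [eq_top_iff]
      intro z _
      have h3 : z = ∑ k, (P₁ *ᵥ z) k • Q₁ *ᵥ Pi.single k 1 := by
        conv_lhs => rw [← Matrix.one_mulVec z, ← hQP₁, ← Matrix.mulVec_mulVec,
          pi_eq_sum_univ' (P₁ *ᵥ z), Matrix.mulVec_sum]
        refine Finset.sum_congr rfl fun k _ => ?_
        rw [Matrix.mulVec_smul]
      rw [h3]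
      refine Submodule.sum_mem _ fun k _ => Submodule.smul_mem _ _ (Submodule.subset_span ?_)
      exact ⟨_, h1 k⟩
  have hdim : 𝓜.dim = ν - (r * n : ℕ) := by
    refine m.dim_eq_sub hf hf0 ψ ?_ ?_
    · rw [hψf]
      exact length_quotient_range_smul_one hs r n
    · rw [hψφ]
      exact hν
  have hν0 : (ν : O) = 0 := by
    have h1 : ((ν : ℤ) : Fq) = 0 := by
      have h2 : (ν : ℤ) = 𝓜.dim + r * n := by rw [hdim]; push_cast; ring
      rw [h2]
      push_cast
      rw [hd, hn0, mul_zero, add_zero]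
    rw [← map_natCast (algebraMap Fq O), ← Int.cast_natCast (R := Fq), h1, map_zero]
  -- the derivation of `O`
  have : Algebra.FormallyEtale R O :=
    Algebra.FormallyEtale.of_isLocalization (idealJ Fq A L).primeCompl
  obtain ⟨D', hD'⟩ := exists_derivation_extension
    ((Algebra.linearMap R O).compDer (coeffDeriv L D))
  have hDΦ : Φ.map D' = ((semilinearMatrix m.i m.π (m.φ f)).map (coeffDeriv L D)).map ι :=
    Matrix.ext fun j k => hD' _
  have htr : ι (m.Ψ f * (semilinearMatrix m.i m.π (m.φ f)).map (coeffDeriv L D)).trace =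
      (Ψ * Φ.map D').trace := by
    rw [hDΦ, ← Matrix.map_mul]
    exact map_sum ι _ _
  have hdvd := pow_dvd_trace_derivation D' hs hXY hYX hν hν0
  change ι (f * f) ∣ ι _
  rw [htr]
  refine dvd_trace_of_dvd_trace_sandwich D' hPQ hQP hPQ₁ hQP₁ hEΦ hΦE hEΨ hΨE hΦΨ hΨΦ ?_
  rw [hff]
  exact hdvd

end AMotive.MatrixModel

end LocalTrace

/-! ### Elements of open subgroups of GL_r -/

section Openness

open Filter Topology

/-- The homomorphism `u ↦ diag(u, 1, …, 1)`. -/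
def diagonalSingle (R : Type*) [CommRing R] {r : ℕ} (i : Fin r) :
    R →* Matrix (Fin r) (Fin r) R :=
  (Matrix.diagonalRingHom (Fin r) R).toMonoidHom.comp (MonoidHom.mulSingle (fun _ => R) i)

theorem diagonalSingle_apply {R : Type*} [CommRing R] {r : ℕ} (i : Fin r) (u : R) :
    diagonalSingle R i u = Matrix.diagonal (Pi.mulSingle i u) := rfl

theorem diagonalSingle_map {R S : Type*} [CommRing R] [CommRing S] (e : R →+* S) {r : ℕ} (i : Fin r)
    (u : R) : (diagonalSingle R i u).map e = diagonalSingle S i (e u) := by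
  rw [diagonalSingle_apply, diagonalSingle_apply, Matrix.diagonal_map (map_zero e)]
  congr 1
  ext j
  rcases eq_or_ne j i with rfl | h
  · simp
  · simp [h]

theorem trace_diagonalSingle_mul_map {k R : Type*} [CommRing k] [CommRing R] [Algebra k R]
    (D : Derivation k R R) {r : ℕ} (i : Fin r) (u w : R) :
    (diagonalSingle R i w * (diagonalSingle R i u).map D).trace = w * D u := by
  rw [diagonalSingle_apply, diagonalSingle_apply, Matrix.diagonal_map (map_zero D),
    Matrix.diagonal_mul_diagonal, Matrix.trace_diagonal, Finset.sum_eq_single i]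
  · simp
  · intro j _ h
    simp [h]
  · simp

/-- A sequence of units tending to `1` eventually gives elements `diag(u, 1, …, 1)` of any open
neighbourhood of `1`. -/
theorem IsAdicOpen.eventually_mem {B : Type*} [CommRing B] {I : Ideal B} {r : ℕ}
    {S : Set (Matrix.GeneralLinearGroup (Fin r) B)} (hS : IsAdicOpen I S) (h1 : 1 ∈ S) (i : Fin r)
    {u : ℕ → Bˣ} (hu : ∀ k, ∀ᶠ j in atTop, (u j : B) - 1 ∈ I ^ k) :
    ∀ᶠ j in atTop, Units.map (diagonalSingle B i) (u j) ∈ S := by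
  let _ : TopologicalSpace B := I.adicTopology
  have hB : IsTopologicalRing B := I.nonarchimedean.toIsTopologicalRing
  have hlim : ∀ {w : ℕ → B}, (∀ k, ∀ᶠ j in atTop, w j - 1 ∈ I ^ k) → Tendsto w atTop (𝓝 1) := by
    intro w hw
    refine (I.hasBasis_nhds_adic 1).tendsto_right_iff.mpr fun k _ => (hw k).mono fun j hj => ?_
    exact ⟨w j - 1, hj, by simp⟩
  -- The topology on units is induced by u ↦ (u, u⁻¹), so convergence of the inverses has to be
  -- checked too.
  have htend : Tendsto u atTop (𝓝 1) := by
    refine Units.isInducing_embedProduct.tendsto_nhds_iff.mpr ?_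
    refine Tendsto.prodMk_nhds (hlim hu) ?_
    refine (MulOpposite.continuous_op.tendsto _).comp (hlim fun k => (hu k).mono fun j hj => ?_)
    have h2 : ((u j)⁻¹ : Bˣ).1 - 1 = -((u j)⁻¹ : Bˣ).1 * ((u j).1 - 1) := by
      linear_combination (u j).inv_mul
    rw [h2]
    exact Ideal.mul_mem_left _ _ hj
  have hcont : Continuous (diagonalSingle B i) := by
    refine continuous_matrix fun j k => ?_
    simp only [diagonalSingle_apply, Matrix.diagonal_apply, Pi.mulSingle_apply]
    split_ifs <;> fun_prop
  have hcont' : Continuous (Units.map (diagonalSingle B i)) := hcont.units_map _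
  refine (hcont'.tendsto 1).comp htend (IsOpen.mem_nhds hS ?_)
  rwa [map_one]

end Openness

/-! ### A criterion for a representation not to be open -/

section AdicRepresentation

open Filter

variable {k A : Type*} [CommRing k] [CommRing A] [Algebra k A] {v : Ideal A}
  (D : Derivation k A A)

theorem algebraMap_adicCompletion_injective (hv : ⨅ n, v ^ n = ⊥) :
    Function.Injective (algebraMap A (AdicCompletion v A)) := by
  rw [injective_iff_map_eq_zero]
  intro z hz
  rw [← Ideal.mem_bot, ← hv, Ideal.mem_iInf]
  intro n
  have := congrArg (AdicCompletion.evalₐ v n) hz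
  rw [AlgHom.commutes, map_zero] at this
  exact Ideal.Quotient.eq_zero_iff_mem.mp this

theorem isUnit_one_add_algebraMap {y : A} (hy : y ∈ v) :
    IsUnit (1 + algebraMap A (AdicCompletion v A) y) := by
  refine isUnit_of_isUnit_evalₐ_one v ?_
  rw [map_add, map_one, AlgHom.commutes]
  have : algebraMap A (A ⧸ v ^ 1) y = 0 := Ideal.Quotient.eq_zero_iff_mem.mpr (by rwa [pow_one])
  rw [this, add_zero]
  exact isUnit_one

/-- A subgroup of `GL_r(A_v)` on which the trace of the logarithmic derivative takes only finitely
many values is not open. -/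
theorem not_isAdicOpen_of_finite_range_trace [IsDomain A] (hv : ⨅ n, v ^ n = ⊥) {x : A} (hxv : x ∈ v)
    (hDx : D x ≠ 0) {p : ℕ} (hp : 0 < p) (hp0 : (p : A) = 0) {G : Type*} [Group G] {r : ℕ}
    (hr : 1 ≤ r) (ρ : G →* Matrix.GeneralLinearGroup (Fin r) (AdicCompletion v A))
    (hfin : (Set.range fun g => (((ρ g)⁻¹ :
      Matrix.GeneralLinearGroup (Fin r) (AdicCompletion v A)).1 *
        (ρ g).1.map (adicDeriv v D)).trace).Finite)
    {B : Type*} [CommRing B] (e : AdicCompletion v A ≃+* B) {I : Ideal B}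
    (hI : e (algebraMap A _ x) ∈ I) :
    ¬ IsAdicOpen I (Set.range ((Matrix.GeneralLinearGroup.map (n := Fin r) e.toRingHom).comp ρ)) := by
  intro hopen
  -- The exponent is 1 modulo p, so D (y j) = x^(pj) D x is nonzero but tends to 0 v-adically.
  let y : ℕ → A := fun j => x ^ (p * j + 1)
  have hy : ∀ j, y j ∈ v := fun j => Ideal.pow_mem_of_mem _ hxv _ (Nat.succ_pos _)
  have hDy : ∀ j, D (y j) = x ^ (p * j) * D x := by
    intro j
    rw [Derivation.leibniz_pow, Nat.add_sub_cancel, nsmul_eq_mul, smul_eq_mul]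
    push_cast
    rw [hp0, zero_mul, zero_add, one_mul]
  let u : ℕ → (AdicCompletion v A)ˣ := fun j => (isUnit_one_add_algebraMap (hy j)).unit
  have huv : ∀ j, (u j : AdicCompletion v A) = 1 + algebraMap A _ (y j) := fun j => rfl
  let i : Fin r := ⟨0, hr⟩
  have hev := hopen.eventually_mem (one_mem (MonoidHom.range _)) i
    (u := fun j => Units.map e.toRingHom.toMonoidHom (u j)) (by
      intro k
      filter_upwards [eventually_ge_atTop k] with j hj
      have h1 : (Units.map e.toRingHom.toMonoidHom (u j) : B) - 1 =
          e (algebraMap A _ x) ^ (p * j + 1) := by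
        change e (u j : AdicCompletion v A) - 1 = _
        rw [huv, map_add, map_one, add_sub_cancel_left, map_pow, map_pow]
      rw [h1]
      refine Ideal.pow_le_pow_right ?_ (Ideal.pow_mem_pow hI _)
      nlinarith)
  obtain ⟨j₀, hj₀⟩ := eventually_atTop.mp hev
  -- the values of the trace
  have hval : ∀ j, j₀ ≤ j → ((u j)⁻¹ : (AdicCompletion v A)ˣ).1 *
      algebraMap A _ (x ^ (p * j) * D x) ∈ Set.range fun g => (((ρ g)⁻¹ :
      Matrix.GeneralLinearGroup (Fin r) (AdicCompletion v A)).1 *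
        (ρ g).1.map (adicDeriv v D)).trace := by
    intro j hj
    obtain ⟨g, hg⟩ := hj₀ j hj
    have h1 : ρ g = Units.map (diagonalSingle _ i) (u j) := by
      refine Units.ext (Matrix.map_injective e.injective ?_)
      refine (congrArg Units.val hg).trans ?_
      exact (diagonalSingle_map e.toRingHom i _).symm
    refine ⟨g, ?_⟩
    simp only
    rw [h1, ← map_inv]
    refine (trace_diagonalSingle_mul_map _ i _ _).trans ?_
    rw [huv, map_add, Derivation.map_one_eq_zero, zero_add, adicDeriv_algebraMap, hDy]
  -- Among finitely many values one, t, occurs for infinitely many j. Divisibility by x^(pj) forces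
  -- t = 0, although each single value is nonzero.
  obtain ⟨t, ht⟩ : ∃ t : AdicCompletion v A, ∃ᶠ j in atTop, ((u j)⁻¹ : (AdicCompletion v A)ˣ).1 *
      algebraMap A _ (x ^ (p * j) * D x) = t := by
    have h2 : ∃ᶠ j in (atTop : Filter ℕ), ∃ t ∈ (Set.range fun g => (((ρ g)⁻¹ :
      Matrix.GeneralLinearGroup (Fin r) (AdicCompletion v A)).1 *
        (ρ g).1.map (adicDeriv v D)).trace), ((u j)⁻¹ : (AdicCompletion v A)ˣ).1 *
      algebraMap A _ (x ^ (p * j) * D x) = t := by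
      refine Eventually.frequently ?_
      filter_upwards [eventually_ge_atTop j₀] with j hj
      exact ⟨_, hval j hj, rfl⟩
    by_contra! hc
    have h3 := (hfin.eventually_all (l := atTop)).mpr fun t _ => hc t
    exact h2 (h3.mono fun j hj ⟨t, ht, h⟩ => hj t ht h)
  have ht0 : t = 0 := by
    apply AdicCompletion.ext_evalₐ
    intro n
    obtain ⟨j, hjn, hj⟩ := frequently_atTop.mp ht n
    rw [← hj, map_mul, map_zero, AlgHom.commutes]
    have h4 : algebraMap A (A ⧸ v ^ n) (x ^ (p * j) * D x) = 0 := by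
      refine Ideal.Quotient.eq_zero_iff_mem.mpr (Ideal.mul_mem_right _ _ ?_)
      refine Ideal.pow_le_pow_right ?_ (Ideal.pow_mem_pow hxv _)
      nlinarith
    rw [h4, mul_zero]
  obtain ⟨j, -, hj⟩ := frequently_atTop.mp ht 0
  rw [ht0, Units.mul_right_eq_zero, map_eq_zero_iff _ (algebraMap_adicCompletion_injective hv)] at hj
  have hx0 : x ≠ 0 := fun h => hDx (by rw [h, map_zero])
  exact mul_ne_zero (pow_ne_zero _ hx0) hDx hj

end AdicRepresentation

/-! ### Combining local and global regularity -/

section LogarithmicDerivative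

variable {Fq A L : Type*} [Field Fq] [CommRing A] [Algebra Fq A] [Field L] [Algebra Fq L]
  [Algebra A L]

/-- Modulo v the term x ⊗ 1 vanishes and the nonzero constant -1 ⊗ γ(x) remains. This is why J
becomes the unit ideal in A_{v,L^sep}. -/
theorem isUnit_algebraMap_generatorJ (hγ : Function.Injective (algebraMap A L)) {v : Ideal A}
    {x : A} (hxv : x ∈ v) (hx : x ≠ 0) :
    IsUnit (algebraMap (A ⊗[Fq] L) (CompletedCoeff Fq v (SeparableClosure L))
      (generatorJ Fq L x)) := by
  let K := SeparableClosure L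
  let c : K := algebraMap L K (algebraMap A L x)
  have hc : c ≠ 0 := by
    rw [Ne, map_eq_zero, map_eq_zero_iff _ hγ]
    exact hx
  have h1 : coeffMap Fq A (IsScalarTower.toAlgHom Fq L K) (generatorJ Fq L x) =
      x ⊗ₜ 1 - 1 ⊗ₜ c := by
    rw [generatorJ, map_sub]
    simp [coeffMap, c, K]
  refine isUnit_of_isUnit_evalₐ_one _ ?_
  rw [algebraMap_completedCoeff, h1, AlgHom.commutes]
  have h2 : algebraMap (A ⊗[Fq] K) (A ⊗[Fq] K ⧸ coeffIdeal Fq v K ^ 1) (x ⊗ₜ 1) = 0 := by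
    refine Ideal.Quotient.eq_zero_iff_mem.mpr ?_
    rw [pow_one]
    exact Ideal.mem_map_of_mem (algebraMap A (A ⊗[Fq] K)) hxv
  rw [map_sub, h2, zero_sub]
  refine IsUnit.neg (IsUnit.map _ ?_)
  exact (isUnit_iff_ne_zero.mpr hc).map
    (Algebra.TensorProduct.includeRight : K →ₐ[Fq] A ⊗[Fq] K)

variable [Fintype Fq] [IsScalarTower Fq A L] {r : ℕ} {M : Type*} [AddCommGroup M]
  [Module (A ⊗[Fq] L) M]

theorem AMotive.nonempty_basis_and_finite_range_trace (𝓜 : AMotive Fq A L r M)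
    [Algebra.FiniteType Fq A] (hγ : Function.Injective (algebraMap A L))
    {v : Ideal A} [v.IsMaximal] (hfin : ∀ n, Finite (A ⧸ v ^ n)) (hv : ⨅ n, v ^ n = ⊥)
    {x : A} (hxv : x ∈ v) (hx0 : x ≠ 0)
    (hx : ∀ b : A, ∃ f : Polynomial (Polynomial Fq),
      f.eval₂ (Polynomial.aeval x : Polynomial Fq →ₐ[Fq] A).toRingHom b = 0 ∧
      f.derivative.eval₂ (Polynomial.aeval x : Polynomial Fq →ₐ[Fq] A).toRingHom b ≠ 0)
    (hd : (𝓜.dim : Fq) = 0) (D : Derivation Fq A A) :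
    Nonempty (Module.Basis (Fin r) (AdicCompletion v A) (𝓜.tateModule v)) ∧
    ∀ b : Module.Basis (Fin r) (AdicCompletion v A) (𝓜.tateModule v),
    (Set.range fun g : Gal(SeparableClosure L/L) =>
      (((𝓜.galRepMatrix v b g)⁻¹ : Matrix.GeneralLinearGroup (Fin r) (AdicCompletion v A)).1 *
        (𝓜.galRepMatrix v b g).1.map (adicDeriv v D)).trace).Finite := by
  obtain ⟨m⟩ := 𝓜.nonempty_matrixModel
  have hJ : (idealJ Fq A L).IsMaximal := isMaximal_idealJ
  have hu := isUnit_algebraMap_generatorJ (Fq := Fq) hγ hxv hx0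
  have hs0 : generatorJ Fq L x ∈ (A ⊗[Fq] L)⁰ := by
    refine mem_nonZeroDivisors_of_injective (completedCoeff_algebraMap_injective (L := L) hv) ?_
    exact hu.mem_nonZeroDivisors
  obtain ⟨_, _, hs⟩ := isDiscreteValuationRing_atPrime_idealJ hγ x hx hs0
  -- n ≥ m.n clears the denominators of τ, and the factor q makes n zero in Fq: then D kills s^n,
  -- and r n drops out of the cokernel length.
  let n := Fintype.card Fq * m.n
  have hn : m.n ≤ n := Nat.le_mul_of_pos_left _ Fintype.card_pos
  have hn0 : (n : Fq) = 0 := by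
    rw [Nat.cast_mul, FiniteField.cast_card_eq_zero, zero_mul]
  have hf : generatorJ Fq L x ^ n ∈ (idealJ Fq A L) ^ m.n :=
    Ideal.pow_le_pow_right hn (Ideal.pow_mem_pow (generatorJ_mem x) n)
  obtain ⟨w, hw⟩ : ∃ w, algebraMap (A ⊗[Fq] L) (CompletedCoeff Fq v (SeparableClosure L))
      (generatorJ Fq L x ^ n) * w = 1 := by
    rw [map_pow]
    exact (hu.pow n).exists_right_inv
  have hDf : coeffDeriv L D (generatorJ Fq L x ^ n) = 0 := by
    have h1 : ((n : ℕ) : A ⊗[Fq] L) = 0 := by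
      rw [← map_natCast (algebraMap Fq (A ⊗[Fq] L)), hn0, map_zero]
    rw [Derivation.leibniz_pow, ← Nat.cast_smul_eq_nsmul (A ⊗[Fq] L), h1, zero_smul]
  have h := m.Ψ_mul_semilinearMatrix hfin hv hf hw
  obtain ⟨t, ht⟩ := m.mul_self_dvd_trace D hn hn0 hs0 h
    (m.mul_self_dvd_localization_trace D hn hn0 hd hs0 hs h)
  obtain ⟨b, -⟩ := m.exists_tate_basis hfin hf hw
  exact ⟨⟨b⟩, fun b => m.finite_range_trace D hfin hf hw hDf ht b⟩

end LogarithmicDerivative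

end

/-! ### The main theorem -/

theorem mainTheorem4
    {Fq Q L M : Type*} [Field Fq] [Fintype Fq] [Field Q] [Algebra Fq Q]
    (hq : ringChar Fq ≠ 2)
    (hQ : IsCurveFunctionField Fq Q)
    (infty : ValuationSubring Q) (hinfty : IsClosedPoint Fq infty)
    [Field L] [Algebra Fq L] [Algebra Q L] [IsScalarTower Fq Q L] [FiniteDimensional Q L]
    [AddCommGroup M] [Module (regularAway Fq infty ⊗[Fq] L) M]
    (r : ℕ) (hr : 1 ≤ r)
    (𝓜 : AMotive Fq (regularAway Fq infty) L r M)
    (v : Ideal (regularAway Fq infty)) [v.IsMaximal] (hv : v ≠ ⊥)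
    (hd : (ringChar (regularAway Fq infty ⧸ v) : ℤ) ∣ 𝓜.dim) :
    Nonempty (Module.Basis (Fin r) (AdicCompletion v (regularAway Fq infty)) (𝓜.tateModule v)) ∧
    ∀ b : Module.Basis (Fin r) (AdicCompletion v (regularAway Fq infty)) (𝓜.tateModule v),
      ¬ IsAdicOpen (v.map (algebraMap _ (AdicCompletion v (regularAway Fq infty))))
          (Set.range (𝓜.galRepMatrix v b)) ∧
      ∀ e : AdicCompletion v (regularAway Fq infty) ≃+*
          PowerSeries (regularAway Fq infty ⧸ v),
        ¬ IsAdicOpen (Ideal.span {(PowerSeries.X : PowerSeries (regularAway Fq infty ⧸ v))})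
          (Set.range ((Matrix.GeneralLinearGroup.map (n := Fin r) e.toRingHom).comp
            (𝓜.galRepMatrix v b))) := by
  obtain ⟨hft, x, D, hxv, hDx, hx⟩ := exists_regularAway_derivation hQ v hv
  have hx0 : x ≠ 0 := fun h => hDx (by rw [h, map_zero])
  have hγ : Function.Injective (algebraMap (regularAway Fq infty) L) :=
    (algebraMap Q L).injective.comp Subtype.val_injective
  have : IsNoetherianRing (regularAway Fq infty) := Algebra.FiniteType.isNoetherianRing Fq _
  have hres : Finite (regularAway Fq infty ⧸ v) := by
    let _ : Field (regularAway Fq infty ⧸ v) := Ideal.Quotient.field v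
    have : Module.Finite Fq (regularAway Fq infty ⧸ v) :=
      finite_of_finite_type_of_isJacobsonRing Fq _
    exact Module.finite_of_finite Fq
  have hfin : ∀ n, Finite (regularAway Fq infty ⧸ v ^ n) := fun n =>
    Ideal.finite_quotient_pow (IsNoetherian.noetherian v) n
  have hvtop : ⨅ n, v ^ n = ⊥ := Ideal.iInf_pow_eq_bot_of_isDomain v (Ideal.IsMaximal.ne_top ‹_›)
  have hnt : Nontrivial (regularAway Fq infty ⧸ v) :=
    Ideal.Quotient.nontrivial_iff.mpr (Ideal.IsMaximal.ne_top ‹_›)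
  have hchar : CharP (regularAway Fq infty ⧸ v) (ringChar Fq) :=
    charP_of_injective_algebraMap (algebraMap Fq (regularAway Fq infty ⧸ v)).injective _
  have hd0 : (𝓜.dim : Fq) = 0 := by
    rw [ringChar.eq (regularAway Fq infty ⧸ v) (ringChar Fq)] at hd
    exact (CharP.intCast_eq_zero_iff Fq (ringChar Fq) _).mpr hd
  have hp : 0 < ringChar Fq := Nat.pos_of_ne_zero (CharP.ringChar_ne_zero_of_finite Fq)
  have hp0 : ((ringChar Fq : ℕ) : regularAway Fq infty) = 0 := by
    rw [← map_natCast (algebraMap Fq (regularAway Fq infty)), CharP.cast_eq_zero, map_zero]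
  obtain ⟨hb, htr⟩ := 𝓜.nonempty_basis_and_finite_range_trace hγ hfin hvtop hxv hx0 hx hd0 D
  refine ⟨hb, fun b => ⟨?_, fun e => ?_⟩⟩
  · have h1 := not_isAdicOpen_of_finite_range_trace D hvtop hxv hDx hp hp0 hr
      (𝓜.galRepMatrix v b) (htr b) (RingEquiv.refl _)
      (I := v.map (algebraMap _ (AdicCompletion v (regularAway Fq infty))))
      (Ideal.mem_map_of_mem _ hxv)
    have h2 : (Matrix.GeneralLinearGroup.map (n := Fin r) (RingEquiv.refl
        (AdicCompletion v (regularAway Fq infty))).toRingHom).comp (𝓜.galRepMatrix v b) =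
        𝓜.galRepMatrix v b := by
      ext g i j
      rfl
    rwa [h2] at h1
  · refine not_isAdicOpen_of_finite_range_trace D hvtop hxv hDx hp hp0 hr
      (𝓜.galRepMatrix v b) (htr b) e ?_
    let _ : Field (regularAway Fq infty ⧸ v) := Ideal.Quotient.field v
    rw [Ideal.mem_span_singleton, PowerSeries.X_dvd_iff]
    -- If z did not divide e(x), then e(x) and hence x would be a unit, contradicting that x
    -- vanishes modulo v. So any ring isomorphism e carries x into (z), without a continuity
    -- assumption.
    by_contra hc
    have h1 : IsUnit (e (algebraMap _ _ x)) :=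
      PowerSeries.isUnit_iff_constantCoeff.mpr (isUnit_iff_ne_zero.mpr hc)
    have h2 : IsUnit (algebraMap _ (AdicCompletion v (regularAway Fq infty)) x) :=
      (MulEquiv.isUnit_map e).mp h1
    have h3 := h2.map (AdicCompletion.evalₐ v 1)
    rw [AlgHom.commutes] at h3
    have h4 : algebraMap (regularAway Fq infty) (regularAway Fq infty ⧸ v ^ 1) x = 0 :=
      Ideal.Quotient.eq_zero_iff_mem.mpr (by rwa [pow_one])
    rw [h4, isUnit_zero_iff] at h3
    have h5 : Nontrivial (regularAway Fq infty ⧸ v ^ 1) := by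
      rw [pow_one]; infer_instance
    exact zero_ne_one h3
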